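/- \textbf{Setting.} Let $\mathcal S,\mathcal A$ be nonempty finite sets, $P^*(\cdot|s,a)$ a transition kernel on $\mathcal S$, $R:\mathcal S\times\mathcal A\to[0,1]$, $\gamma\in[0,1)$, $\lambda>0$, and let $f$ be a convex function with $f(1)=0$, finite on $(0,\infty)$ and equal to $+\infty$ on $(-\infty,0)$; $f^*(t)=\sup_s\{st-f(s)\}$. Put $$J(\eta,V;s')=-\lambda f^*\!\Big(\tfrac{\eta-V(s')}{\lambda}\Big)+\eta,\qquad J^{(s,a)}(\eta,V)=\sum_{s'}P^*(s'|s,a)J(\eta,V;s').$$ Let $Q^*_{\mathrm{rob,p}}$ be the fixed point of the robust Bellman operator $\mathcal T_{\mathrm{rob,p}}Q(s,a)=R(s,a)+\gamma\sup_{\eta\in\mathbb R}J^{(s,a)}\big(\eta,\max_{a'}Q(\cdot,a')\big)$. \textbf{Assumptions.} $\Theta\subset\mathbb R$ is a compact interval, $\sigma>0$, and for all $(s,a)$ and all $V\in[0,(1-\gamma)^{-1}]^{\mathcal S}$: (i) $J^{(s,a)}(\cdot,V)$ attains its maximum over $\mathbb R$ at a point of $\Theta$; (ii) $J^{(s,a)}(\cdot,V)$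 is finite near, and differentiable at, every point of $\Theta$, with derivative $\frac1{\lambda\sigma}$-Lipschitz on $\Theta$; (iii) $|J(\eta,V;s')|\le C_M$ for all $\eta\in\Theta$ and $s'\in\mathcal S$, where $C_M\ge(1-\gamma)^{-1}$. Let $$C_g=\frac{\mathrm{diam}(\Theta)+(1-\gamma)^{-1}}{\lambda\sigma},\qquad C_N=2\sqrt{2(1+\gamma C_M)^2\log(2|\mathcal S||\mathcal A|)}.$$ \textbf{Algorithm.} $Q_0\equiv(1-\gamma)^{-1}$. For $t=0,\dots,T-1$ let $V_t(s)$ be the projection of $\max_aQ_t(s,a)$ onto $[0,(1-\gamma)^{-1}]$; for each $(s,a)$ put $\eta_{t,0}(s,a)=0$ and, for $k=0,\dots,T'-1$, draw $s'_{t,k}(s,a)\sim P^*(\cdot|s,a)$ and set $$\eta_{t,k+1}(s,a)=\Pi_\Theta\Big(\eta_{t,k}(s,a)+\alpha_k\,\tfrac{\partial J}{\partial\eta}(\eta_{t,k}(s,a),V_t;s'_{t,k}(s,a))\Big);$$ then receive a reward $r_t(s,a)$ with mean $R(s,a)$ and $|r_t(s,a)-R(s,a)|\le1$ and a next state $s'_t(s,a)\sim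 P^*(\cdot|s,a)$, and set $$Q_{t+1}(s,a)=(1-\beta_t)Q_t(s,a)+\beta_t\big(r_t(s,a)+\gamma J(\eta_{t,T'}(s,a),V_t;s'_t(s,a))\big).$$ Draws made at different steps are independent. The step sizes are $\alpha_k=\frac{\mathrm{diam}(\Theta)}{C_g\sqrt k}$ for $k\ge1$ ($\alpha_0\in\mathbb R$ arbitrary) and $\beta_t=\frac1{1+(1-\gamma)(t+1)}$. \textbf{Theorem.} The fixed point $Q^*_{\mathrm{rob,p}}$ exists and is unique. With $\Delta_t=Q_t-Q^*_{\mathrm{rob,p}}$, for all integers $T,T'\ge1$, $$\mathbb E\|\Delta_T\|_\infty\le\frac{\|\Delta_0\|_\infty}{1+(1-\gamma)T}+\frac{2C_N}{\sqrt{(1-\gamma)^3T}}+\frac{\mathrm{diam}(\Theta)C_g(2+\log T')}{(1-\gamma)\sqrt{T'}}+\frac{C_N}{\sqrt{1+(1-\gamma)T}}.$$ Moreover there are universal constants $c,C>0$ such that, for every $0<\varepsilon\le(1-\gamma)^{-1}$, with $$x=\frac{C_N^2}{\varepsilon^2(1-\gamma)^3},\qquad y=\max\Big\{1,\frac{\mathrm{diam}(\Theta)^2C_g^2}{\varepsilon^2(1-\gamma)^2}\Big\},$$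 one has $\mathbb E\|\Delta_T\|_\infty\le\varepsilon$ whenever $T\ge T_0:=\lceil c\,x\rceil$ and $T'\ge T_1:=\lceil c\,y(1+\log y)^2\rceil$, and the total number of draws $|\mathcal S||\mathcal A|\,T_0(T_1+1)$ is at most $C|\mathcal S||\mathcal A|\,x\,y(1+\log y)^2$. If $\varepsilon(1-\gamma)\le\mathrm{diam}(\Theta)C_g$, this upper bound is $$C\,\frac{|\mathcal S||\mathcal A|\,\mathrm{diam}(\Theta)^2C_N^2C_g^2}{\varepsilon^4(1-\gamma)^5}\,\Big(1+\log\frac{\mathrm{diam}(\Theta)^2C_g^2}{\varepsilon^2(1-\gamma)^2}\Big)^2=\widetilde{\mathcal O}\Big(\frac{|\mathcal S||\mathcal A|\,\mathrm{diam}(\Theta)^2C_N^2C_g^2}{\varepsilon^4(1-\gamma)^5}\Big).$$ -/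

import Mathlib

open MeasureTheory ProbabilityTheory Filter Topology

noncomputable section

namespace RobustQ

/-- A penalized robust Markov decision process with finite state space `S` and finite action
space `A`: nominal transition kernel `P`, mean reward `R` with values in `[0, 1]`, discount factor
`γ`, penalty parameter `lam`, and the convex function `f` defining the `f`-divergence.
`f` is used on `(0, ∞)` only: it is `+∞` on the negative axis, and the value of a convex
function at `0` (finite or `+∞`) has no influence on its conjugate. -/
structure RobustMDP (S A : Type*) [Fintype S] where
  P : S → A → S → ℝ
  P_nonneg : ∀ s a s', 0 ≤ P s a s'
  P_sum : ∀ s a, ∑ s', P s a s' = 1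
  R : S → A → ℝ
  R_nonneg : ∀ s a, 0 ≤ R s a
  R_le_one : ∀ s a, R s a ≤ 1
  γ : ℝ
  γ_nonneg : 0 ≤ γ
  γ_lt_one : γ < 1
  lam : ℝ
  lam_pos : 0 < lam
  f : ℝ → ℝ
  f_convex : ConvexOn ℝ (Set.Ioi 0) f
  f_one : f 1 = 0

/-- The convex conjugate `f^*(t) = sup_s (s t - f s)`, with values in the extended reals
(the points `s < 0` do not contribute since `f = +∞` there, and `s = 0` does not change the
supremum by convexity). -/
def conj (f : ℝ → ℝ) (t : ℝ) : EReal :=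
  ⨆ s : Set.Ioi (0 : ℝ), ((s * t - f s : ℝ) : EReal)

namespace RobustMDP

variable {S A : Type*} [Fintype S]

/-- The upper end `(1 - γ)⁻¹` of the range of value functions. -/
def vmax (M : RobustMDP S A) : ℝ := (1 - M.γ)⁻¹

/-- The set `[0, (1 - γ)⁻¹]^S` of value functions. -/
def valueBox (M : RobustMDP S A) : Set (S → ℝ) := {V | ∀ s, 0 ≤ V s ∧ V s ≤ M.vmax}

/-- The sampled dual objective `J(η, V; s') = -λ f^*((η - V(s')) / λ) + η`, as a function of `η`
and of the number `v = V(s')`; it may be `-∞`. -/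
def J (M : RobustMDP S A) (η v : ℝ) : EReal :=
  -(M.lam : EReal) * conj M.f ((η - v) / M.lam) + (η : EReal)

/-- The dual objective
`J^{(s,a)}(η, V) = -λ ∑_{s'} P(s'|s,a) f^*((η - V(s')) / λ) + η`; it may be `-∞`. -/
def Jexp (M : RobustMDP S A) (s : S) (a : A) (η : ℝ) (V : S → ℝ) : EReal :=
  -(M.lam : EReal) * (∑ s', (M.P s a s' : EReal) * conj M.f ((η - V s') / M.lam)) + (η : EReal)

/-- The derivative of `J(η, V; s')` with respect to `η`, where `v = V(s')`. -/
def gradJ (M : RobustMDP S A) (η v : ℝ) : ℝ := deriv (fun x => (M.J x v).toReal) η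

section Bellman

variable [Fintype A] [Nonempty A]

/-- `V(s) = max_a Q(s, a)`. -/
def maxQ (Q : S → A → ℝ) (s : S) : ℝ :=
  Finset.univ.sup' Finset.univ_nonempty (fun a => Q s a)

/-- The robust Bellman operator
`(T Q)(s, a) = R(s, a) + γ sup_{η ∈ ℝ} J^{(s,a)}(η, max_{a'} Q(·, a'))`. -/
def bellman (M : RobustMDP S A) (Q : S → A → ℝ) (s : S) (a : A) : EReal :=
  (M.R s a : EReal) + (M.γ : EReal) * ⨆ η : ℝ, M.Jexp s a η (maxQ Q)

/-- `Q` is the optimal robust Q-value function: a fixed point of the robust Bellman operator. -/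
def IsOptimalQ (M : RobustMDP S A) (Q : S → A → ℝ) : Prop :=
  ∀ s a, ((Q s a : ℝ) : EReal) = M.bellman Q s a

end Bellman

/-! ### Assumptions on the dual objective, for the region `Θ = [lo, hi]` -/

/-- For every value function `V` and every `(s, a)`, the maximum of `J^{(s,a)}(·, V)` over the
whole real line is attained at a point of `Θ = [lo, hi]`. -/
def BoundedDomain (M : RobustMDP S A) (lo hi : ℝ) : Prop :=
  ∀ V ∈ M.valueBox, ∀ s a, ∃ η' ∈ Set.Icc lo hi, ∀ η : ℝ, M.Jexp s a η V ≤ M.Jexp s a η' V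

/-- `J^{(s,a)}(·, V)` is `1 / (λ σ)`-smooth on `Θ = [lo, hi]`: it is (finite and) differentiable
at the points of `Θ`, with derivative `1 / (λ σ)`-Lipschitz on `Θ`. -/
def Smooth (M : RobustMDP S A) (lo hi σ : ℝ) : Prop :=
  ∀ V ∈ M.valueBox, ∀ s a,
    (∀ η ∈ Set.Icc lo hi, (∀ᶠ x in 𝓝 η, M.Jexp s a x V ≠ ⊥) ∧
      DifferentiableAt ℝ (fun x => (M.Jexp s a x V).toReal) η) ∧
    ∀ η ∈ Set.Icc lo hi, ∀ η' ∈ Set.Icc lo hi,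
      |deriv (fun x => (M.Jexp s a x V).toReal) η - deriv (fun x => (M.Jexp s a x V).toReal) η'|
        ≤ 1 / (M.lam * σ) * |η - η'|

/-- `|J(η, V; s')| ≤ C_M` for `η ∈ Θ = [lo, hi]` and `V(s') ∈ [0, (1 - γ)⁻¹]`, where
`C_M ≥ (1 - γ)⁻¹`. -/
def BoundedObjective (M : RobustMDP S A) (lo hi CM : ℝ) : Prop :=
  M.vmax ≤ CM ∧ ∀ η ∈ Set.Icc lo hi, ∀ v ∈ Set.Icc 0 M.vmax,
    ((-CM : ℝ) : EReal) ≤ M.J η v ∧ M.J η v ≤ (CM : EReal)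

/-- `C_g = (diam Θ + (1 - γ)⁻¹) / (λ σ)`. -/
def Cg (M : RobustMDP S A) (lo hi σ : ℝ) : ℝ := ((hi - lo) + M.vmax) / (M.lam * σ)

/-- `C_N = 2 √(2 (1 + γ C_M)² log (2 |S| |A|))`. -/
def CN [Fintype A] (M : RobustMDP S A) (CM : ℝ) : ℝ :=
  2 * √(2 * (1 + M.γ * CM) ^ 2 * Real.log (2 * Fintype.card S * Fintype.card A))

/-! ### The algorithm, as a function of the data it receives -/

/-- Projection of a real number onto the interval `[lo, hi]`. -/
def clamp (lo hi x : ℝ) : ℝ := max lo (min hi x)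

/-- The step size `β_t = 1 / (1 + (1 - γ)(t + 1))`. -/
def β (M : RobustMDP S A) (t : ℕ) : ℝ := 1 / (1 + (1 - M.γ) * (t + 1))

/-- The inner projected stochastic gradient ascent `η_{t,k}(s, a)` for the value function `V` and
the stream `x k s a` of next states. -/
def inner (M : RobustMDP S A) (lo hi : ℝ) (α : ℕ → ℝ) (V : S → ℝ) (x : ℕ → S → A → S)
    (s : S) (a : A) : ℕ → ℝ
  | 0 => 0
  | k + 1 => clamp lo hi (inner M lo hi α V x s a k +
      α k * M.gradJ (inner M lo hi α V x s a k) (V (x k s a)))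

/-- The iterates `Q_t` of the algorithm with `T'` inner steps, `x t k s a` being the next states
received in the inner loop and `r t s a`, `y t s a` the reward and the next state received after
the inner loop. -/
def Qiter [Fintype A] [Nonempty A] (M : RobustMDP S A) (lo hi : ℝ) (α : ℕ → ℝ) (T' : ℕ)
    (x : ℕ → ℕ → S → A → S) (y : ℕ → S → A → S) (r : ℕ → S → A → ℝ) : ℕ → S → A → ℝ
  | 0 => fun _ _ => M.vmax
  | t + 1 =>
    let Q := Qiter M lo hi α T' x y r t
    let V : S → ℝ := fun s => clamp 0 M.vmax (maxQ Q s)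
    fun s a => (1 - M.β t) * Q s a +
      M.β t * (r t s a + M.γ * (M.J (M.inner lo hi α V (x t) s a T') (V (y t s a))).toReal)

/-- The data of the generative model. Next states drawn for `(s, a)` have law `P(·|s, a)`,
the rewards have mean `R(s, a)` and noise bounded by `1`, and the draws made at different steps
are independent (no independence between different pairs `(s, a)`, or between the
reward and the next state drawn together, is required). -/
structure IsGenerativeData [MeasurableSpace S] {Ω : Type*} [MeasurableSpace Ω]
    (M : RobustMDP S A) (μ : Measure Ω)
    (X : ℕ → ℕ → Ω → S → A → S) (Y : ℕ → Ω → S → A → S) (r : ℕ → Ω → S → A → ℝ) : Prop where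
  measurable_X : ∀ t k, Measurable (X t k)
  measurable_Y : ∀ t, Measurable (Y t)
  measurable_r : ∀ t, Measurable (r t)
  law_X : ∀ t k s a s', μ.real {ω | X t k ω s a = s'} = M.P s a s'
  law_Y : ∀ t s a s', μ.real {ω | Y t ω s a = s'} = M.P s a s'
  noise_le : ∀ t s a, ∀ᵐ ω ∂μ, |r t ω s a - M.R s a| ≤ 1
  mean_r : ∀ t s a, ∫ ω, r t ω s a ∂μ = M.R s a
  indep : iIndep (Sum.elim
    (fun p : ℕ × ℕ => MeasurableSpace.comap (X p.1 p.2) inferInstance)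
    (fun t : ℕ => MeasurableSpace.comap (fun ω => (r t ω, Y t ω)) inferInstance)) μ

end RobustMDP

/-- The number of draws from the generative model in `T` iterations with `T'` inner steps:
for each `(s, a)`, one for each inner step and one more for each iteration. -/
def sampleCount (S A : Type*) [Fintype S] [Fintype A] (T T' : ℕ) : ℕ :=
  Fintype.card (((Fin T × Fin T') ⊕ Fin T) × S × A)

end RobustQ

end

/-! The conjugate `f^*` is nondecreasing, because only `s > 0` enters its supremum, and `f 1 = 0`
makes `sup_η J^{(s,a)}(η, ·)` fix constants. This supremum is moreover monotone and compatible with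
translations of `V`, hence nonexpansive in the sup norm (`abs_robustExp_sub_le`). The robust Bellman
operator is therefore a `γ`-contraction: existence and uniqueness of the fixed point follow from
Banach's theorem, without any assumption on `Θ`.

For the error bound, write `W_t` for the `β`-weighted sum of the centred update targets (`noise`)
and `D_t = Δ_t - W_t`. Removing `W_t` leaves a pathwise recursion driven by the conditional mean of
the target. By independence of the inner draws and the final draw (`meanTarget_eq`), this mean is `R
+ γ E[dual objective at the last inner iterate]`. It is within `γ (‖Δ_t‖ + e)` of `Q^*`, where `e`
is the expected suboptimality allowed to the inner loop (`abs_meanTarget_sub_le`). With `ρ_t = 1 +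
(1 - γ) t = 1 / β_{t-1}` for `t ≥ 1`, the step sizes give `ρ_{t+1} ‖D_{t+1}‖ ≤ ρ_t ‖D_t‖ + ‖W_t‖ +
e`, which telescopes (`rho_mul_error_le`). Two estimates remain.

Inner loop. One projected stochastic gradient step on a concave smooth function costs only the
variance of the gradient, not its second moment (`projected_step`). This variance is at most `(C_g /
2)²`, by a case distinction on whether `diam Θ` or `(1 - γ)⁻¹` is smaller (`variance_grad_le`). The
comparison point of the resulting regret bound may be any earlier iterate, so regret is controlled
on every terminal window of iterations. Comparing averages over successive windows transfers the
bound to the last iterate at the price of a logarithm (`last_iterate_le`,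
`robustExp_sub_integral_inner_le`).

Noise. By Hoeffding's lemma applied conditionally on the past, `W_t` is sub-Gaussian in each
coordinate with proxy `(1 + γ C_M)² / ρ_t` (`mgf_noise_le`). The step sizes are such that this proxy
propagates exactly (`variance_recursion`). A maximal inequality over the `2 |S| |A|` signed
coordinates bounds `E ‖W_t‖` by `C_N / (2 √ρ_t)`, and `∑ 1 / √ρ_t` is of order `√ρ_T / (1 - γ)`.

For the sample complexity, each of the four terms of the bound is made at most `ε / 4`; inverting
`(2 + log T') / √T'` produces the factor `(1 + log y)²`. -/

set_option linter.unusedSectionVars false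

noncomputable section

namespace RobustQ

/-! ### The convex conjugate -/

section Conj

variable {f : ℝ → ℝ}

theorem le_conj (t : ℝ) {s : ℝ} (hs : 0 < s) : ((s * t - f s : ℝ) : EReal) ≤ conj f t :=
  le_iSup (fun s : Set.Ioi (0 : ℝ) => ((s * t - f s : ℝ) : EReal)) ⟨s, hs⟩

theorem conj_ne_bot (f : ℝ → ℝ) (t : ℝ) : conj f t ≠ ⊥ := fun h => by
  have := le_conj (f := f) t one_pos
  rw [h] at this
  exact EReal.coe_ne_bot _ (le_bot_iff.1 this)

theorem self_le_conj (hf : f 1 = 0) (t : ℝ) : (t : EReal) ≤ conj f t := by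
  simpa [hf] using le_conj (f := f) t one_pos

/-- Only positive slopes `s` occur in the supremum. This is the source of the monotonicity of the
robust expectation in `V`. -/
theorem conj_mono (f : ℝ → ℝ) : Monotone (conj f) := fun t t' h => by
  refine iSup_le fun s => le_trans ?_ (le_conj (f := f) t' s.2)
  have := mul_le_mul_of_nonneg_left h (le_of_lt s.2)
  exact_mod_cast (by linarith : (s : ℝ) * t - f s ≤ s * t' - f s)

/-- The subgradient is the infimum of the secant slopes from `1` to points on its right; by
convexity these dominate all secant slopes from the left. -/
theorem exists_subgradient_at_one (hc : ConvexOn ℝ (Set.Ioi 0) f) (hf : f 1 = 0) :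
    ∃ t, ∀ s, 0 < s → t * (s - 1) ≤ f s := by
  have key : ∀ s u : ℝ, 0 < s → s < 1 → 1 < u → f s / (s - 1) ≤ f u / (u - 1) := by
    intro s u hs hs1 hu
    have := hc.slope_mono_adjacent (x := s) (y := 1) (z := u) hs (by simp; linarith) hs1 hu
    rw [hf] at this
    rw [show f s / (s - 1) = (0 - f s) / (1 - s) by
      rw [← neg_div_neg_eq]; simp]
    simpa using this
  set B := (fun u => f u / (u - 1)) '' Set.Ioi (1 : ℝ)
  have hne : B.Nonempty := ⟨_, 2, by simp, rfl⟩
  refine ⟨sInf B, fun s hs => ?_⟩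
  rcases lt_trichotomy s 1 with h | h | h
  · have : f s / (s - 1) ≤ sInf B := le_csInf hne (by rintro _ ⟨u, hu, rfl⟩; exact key s u hs h hu)
    rw [div_le_iff_of_neg (by linarith)] at this
    linarith
  · simp [h, hf]
  · have hb : BddBelow B := ⟨f (1/2) / (1/2 - 1), by
      rintro _ ⟨u, hu, rfl⟩; exact key _ u (by norm_num) (by norm_num) hu⟩
    have : sInf B ≤ f s / (s - 1) := csInf_le hb ⟨s, h, rfl⟩
    rwa [le_div_iff₀ (by linarith)] at this

/-- At a subgradient `t` of `f` at `1`, the supremum defining the conjugate is attained at `s = 1`.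
-/
theorem exists_conj_eq_self (hc : ConvexOn ℝ (Set.Ioi 0) f) (hf : f 1 = 0) :
    ∃ t : ℝ, conj f t = t := by
  obtain ⟨t, ht⟩ := exists_subgradient_at_one hc hf
  refine ⟨t, le_antisymm (iSup_le fun s => ?_) (self_le_conj hf t)⟩
  have := ht s s.2
  exact_mod_cast (by linarith : (s : ℝ) * t - f s ≤ t)

theorem sub_le_conj_toReal {t : ℝ} (ht : conj f t ≠ ⊤) {s : ℝ} (hs : 0 < s) :
    s * t - f s ≤ (conj f t).toReal := by
  have := le_conj (f := f) t hs
  rw [← EReal.coe_toReal ht (conj_ne_bot f t)] at this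
  exact_mod_cast this

theorem convexOn_conj (f : ℝ → ℝ) :
    ConvexOn ℝ {t | conj f t ≠ ⊤} (fun t => (conj f t).toReal) := by
  have key : ∀ x, conj f x ≠ ⊤ → ∀ y, conj f y ≠ ⊤ → ∀ a b : ℝ, 0 ≤ a → 0 ≤ b → a + b = 1 →
      conj f (a * x + b * y) ≤ ((a * (conj f x).toReal + b * (conj f y).toReal : ℝ) : EReal) := by
    intro x hx y hy a b ha hb hab
    refine iSup_le fun s => ?_
    have h1 := mul_le_mul_of_nonneg_left (sub_le_conj_toReal hx s.2) ha
    have h2 := mul_le_mul_of_nonneg_left (sub_le_conj_toReal hy s.2) hb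
    have h3 : f s = a * f s + b * f s := by rw [← add_mul, hab, one_mul]
    exact_mod_cast (by rw [h3]; linarith :
      (s : ℝ) * (a * x + b * y) - f s ≤ a * (conj f x).toReal + b * (conj f y).toReal)
  refine ⟨fun x hx y hy a b ha hb hab => ?_, fun x hx y hy a b ha hb hab => ?_⟩
  · exact ne_top_of_le_ne_top (EReal.coe_ne_top _) (key x hx y hy a b ha hb hab)
  · have := EReal.toReal_le_toReal (key x hx y hy a b ha hb hab) (conj_ne_bot _ _)
      (EReal.coe_ne_top _)
    rwa [EReal.toReal_coe] at this

end Conj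

theorem ereal_coe_sum {ι : Type*} (s : Finset ι) (g : ι → ℝ) :
    ((∑ i ∈ s, g i : ℝ) : EReal) = ∑ i ∈ s, (g i : EReal) := by
  classical
  induction s using Finset.induction_on with
  | empty => simp
  | insert i s hi ih => rw [Finset.sum_insert hi, Finset.sum_insert hi, EReal.coe_add, ih]

theorem ereal_sum_mul {ι : Type*} (s : Finset ι) (p : ι → ℝ) (hp : ∀ i, 0 ≤ p i) (c : EReal) :
    ∑ i ∈ s, (p i : EReal) * c = ((∑ i ∈ s, p i : ℝ) : EReal) * c := by
  classical
  induction s using Finset.induction_on with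
  | empty => simp
  | insert i s hi ih =>
    rw [Finset.sum_insert hi, Finset.sum_insert hi, ih, EReal.coe_add,
      EReal.right_distrib_of_nonneg (by exact_mod_cast hp i)
        (by exact_mod_cast Finset.sum_nonneg fun i _ => hp i)]

/-! ### The dual objective in extended and in real form -/

namespace RobustMDP

variable {S A : Type*} [Fintype S] (M : RobustMDP S A)

theorem one_sub_gamma_pos : 0 < 1 - M.γ := sub_pos.2 M.γ_lt_one

theorem vmax_pos : 0 < M.vmax := inv_pos.2 M.one_sub_gamma_pos

/-- The real profile `u - λ f^*(u / λ)` of the dual objective. -/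
def profile (u : ℝ) : ℝ := u - M.lam * (conj M.f (u / M.lam)).toReal

/-- The points where the dual objective `J(·, 0)` is finite. -/
def finiteDom : Set ℝ := {u | conj M.f (u / M.lam) ≠ ⊤}

theorem J_eq_of_mem {η v : ℝ} (h : η - v ∈ M.finiteDom) :
    M.J η v = ((M.profile (η - v) + v : ℝ) : EReal) := by
  unfold J profile
  rw [← EReal.coe_toReal h (conj_ne_bot _ _), EReal.toReal_coe, ← EReal.coe_neg, ← EReal.coe_mul,
    ← EReal.coe_add]
  congr 1; ring

theorem J_eq_bot {η v : ℝ} (h : η - v ∉ M.finiteDom) : M.J η v = ⊥ := by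
  have h' : conj M.f ((η - v) / M.lam) = ⊤ := by simpa [finiteDom] using h
  unfold J
  rw [h', EReal.neg_mul, EReal.coe_mul_top_of_pos M.lam_pos, EReal.neg_top, EReal.bot_add]

theorem mem_finiteDom_iff {η v : ℝ} : η - v ∈ M.finiteDom ↔ M.J η v ≠ ⊥ := by
  by_cases h : η - v ∈ M.finiteDom
  · simp only [h, true_iff, M.J_eq_of_mem h]; exact EReal.coe_ne_bot _
  · simp [h, M.J_eq_bot h]

theorem J_le (η v : ℝ) : M.J η v ≤ v := by
  by_cases h : η - v ∈ M.finiteDom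
  · rw [M.J_eq_of_mem h]
    have h1 := sub_le_conj_toReal (f := M.f) h one_pos
    rw [M.f_one, one_mul, sub_zero, div_le_iff₀' M.lam_pos] at h1
    unfold profile
    exact_mod_cast (by linarith : η - v - M.lam * (conj M.f ((η - v) / M.lam)).toReal + v ≤ v)
  · simp [M.J_eq_bot h]

/-- The upper bound `J η v ≤ v` is attained where `(η - v) / λ` is a subgradient of `f` at `1`, so
robustification does not change the value of a constant. -/
theorem exists_J_eq : ∃ u : ℝ, ∀ v, M.J (u + v) v = v := by
  obtain ⟨t, ht⟩ := exists_conj_eq_self M.f_convex M.f_one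
  refine ⟨M.lam * t, fun v => ?_⟩
  have h : (M.lam * t + v - v) / M.lam = t := by
    rw [add_sub_cancel_right, mul_div_cancel_left₀ _ M.lam_pos.ne']
  rw [M.J_eq_of_mem (by simp only [finiteDom, Set.mem_ofPred_eq, h, ht]; exact EReal.coe_ne_top _)]
  congr 1
  rw [profile, h, ht, EReal.toReal_coe]; ring

theorem Jexp_mono (s : S) (a : A) (η : ℝ) {V V' : S → ℝ} (h : V ≤ V') :
    M.Jexp s a η V ≤ M.Jexp s a η V' := by
  unfold Jexp
  refine add_le_add ?_ le_rfl
  rw [EReal.neg_mul, EReal.neg_mul, EReal.neg_le_neg_iff]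
  have hl : (0 : EReal) ≤ M.lam := by exact_mod_cast M.lam_pos.le
  refine mul_le_mul_of_nonneg_left (Finset.sum_le_sum fun s' _ => ?_) hl
  have hp : (0 : EReal) ≤ M.P s a s' := by exact_mod_cast M.P_nonneg s a s'
  refine mul_le_mul_of_nonneg_left (conj_mono M.f ?_) hp
  have := M.lam_pos
  have := h s'
  gcongr

/-- The conjugate sees only `η - V`, so a translation of `V` is absorbed by `η`, which ranges over
the whole line in the supremum. -/
theorem Jexp_shift (s : S) (a : A) (η δ : ℝ) (V : S → ℝ) :
    M.Jexp s a η (fun s' => V s' + δ) = M.Jexp s a (η - δ) V + δ := by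
  unfold Jexp
  rw [add_assoc, ← EReal.coe_add, sub_add_cancel]
  congr 4 with s'
  congr 3; ring

/-- Constant value functions turn hypotheses on the averaged objective into hypotheses on the
sampled objective; the regularity of each summand is extracted this way. -/
theorem Jexp_const (s : S) (a : A) (η v : ℝ) : M.Jexp s a η (fun _ => v) = M.J η v := by
  unfold Jexp J
  rw [ereal_sum_mul _ _ (M.P_nonneg s a), M.P_sum, EReal.coe_one, one_mul]

/-- The real dual objective `∑ P(s'|s,a) J(η, V; s')`. -/
def dual (s : S) (a : A) (V : S → ℝ) (η : ℝ) : ℝ :=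
  ∑ s', M.P s a s' * (M.profile (η - V s') + V s')

theorem Jexp_eq (s : S) (a : A) {η : ℝ} {V : S → ℝ} (h : ∀ s', η - V s' ∈ M.finiteDom) :
    M.Jexp s a η V = (M.dual s a V η : EReal) := by
  unfold Jexp dual
  have h1 : ∀ s', (M.P s a s' : EReal) * conj M.f ((η - V s') / M.lam)
      = ((M.P s a s' * (conj M.f ((η - V s') / M.lam)).toReal : ℝ) : EReal) := fun s' => by
    rw [EReal.coe_mul, EReal.coe_toReal (h s') (conj_ne_bot _ _)]
  rw [Finset.sum_congr rfl fun s' _ => h1 s', ← ereal_coe_sum, ← EReal.coe_neg, ← EReal.coe_mul,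
    ← EReal.coe_add]
  congr 1
  have h2 : ∀ s', M.P s a s' * (M.profile (η - V s') + V s') =
      η * M.P s a s' - M.lam * (M.P s a s' * (conj M.f ((η - V s') / M.lam)).toReal) := by
    intro s'; unfold profile; ring
  rw [Finset.sum_congr rfl fun s' _ => h2 s', Finset.sum_sub_distrib, ← Finset.mul_sum,
    ← Finset.mul_sum, M.P_sum]
  ring

/-! ### The supremum of the dual objective -/

/-- The robust expectation `sup_η J^{(s,a)}(η, V)`. -/
def dualSup (s : S) (a : A) (V : S → ℝ) : EReal := ⨆ η : ℝ, M.Jexp s a η V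

theorem dualSup_mono (s : S) (a : A) {V V' : S → ℝ} (h : V ≤ V') :
    M.dualSup s a V ≤ M.dualSup s a V' :=
  iSup_mono fun η => M.Jexp_mono s a η h

theorem dualSup_const (s : S) (a : A) (v : ℝ) : M.dualSup s a (fun _ => v) = v := by
  refine le_antisymm (iSup_le fun η => ?_) ?_
  · rw [M.Jexp_const]; exact M.J_le η v
  · obtain ⟨u, hu⟩ := M.exists_J_eq
    rw [← hu v, ← M.Jexp_const s a]
    exact le_iSup (fun η : ℝ => M.Jexp s a η fun _ => v) (u + v)

theorem dualSup_add_le (s : S) (a : A) (δ : ℝ) (V : S → ℝ) :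
    M.dualSup s a (fun s' => V s' + δ) ≤ M.dualSup s a V + δ := by
  refine iSup_le fun η => ?_
  rw [M.Jexp_shift]
  exact add_le_add (le_iSup (fun η : ℝ => M.Jexp s a η V) (η - δ)) le_rfl

/-- The robust expectation as a real number. -/
def robustExp (s : S) (a : A) (V : S → ℝ) : ℝ := (M.dualSup s a V).toReal

theorem coe_robustExp (s : S) (a : A) (V : S → ℝ) :
    (M.robustExp s a V : EReal) = M.dualSup s a V := by
  refine EReal.coe_toReal ?_ ?_
  · refine ne_top_of_le_ne_top (EReal.coe_ne_top ‖V‖) ?_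
    rw [← M.dualSup_const s a]
    exact M.dualSup_mono s a fun s' => (le_abs_self _).trans (norm_le_pi_norm V s')
  · refine ne_bot_of_le_ne_bot (EReal.coe_ne_bot (-‖V‖)) ?_
    rw [← M.dualSup_const s a]
    exact M.dualSup_mono s a fun s' =>
      neg_le_of_abs_le (norm_le_pi_norm V s')

theorem robustExp_mono (s : S) (a : A) {V V' : S → ℝ} (h : V ≤ V') :
    M.robustExp s a V ≤ M.robustExp s a V' := by
  have := M.dualSup_mono s a h
  rw [← coe_robustExp, ← coe_robustExp] at this
  exact_mod_cast this

theorem robustExp_const (s : S) (a : A) (v : ℝ) : M.robustExp s a (fun _ => v) = v := by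
  rw [robustExp, dualSup_const, EReal.toReal_coe]

theorem robustExp_add_le (s : S) (a : A) (δ : ℝ) (V : S → ℝ) :
    M.robustExp s a (fun s' => V s' + δ) ≤ M.robustExp s a V + δ := by
  have := M.dualSup_add_le s a δ V
  rw [← coe_robustExp, ← coe_robustExp] at this
  exact_mod_cast this

/-- Monotonicity together with translation by constants gives nonexpansiveness: `V ≤ V' + δ` passes
to the robust expectations, and symmetrically. -/
theorem abs_robustExp_sub_le (s : S) (a : A) {V V' : S → ℝ} {δ : ℝ}
    (h : ∀ s', |V s' - V' s'| ≤ δ) :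
    |M.robustExp s a V - M.robustExp s a V'| ≤ δ := by
  have key : ∀ V V' : S → ℝ, (∀ s', |V s' - V' s'| ≤ δ) →
      M.robustExp s a V - M.robustExp s a V' ≤ δ := fun V V' h => by
    have h1 : M.robustExp s a V ≤ M.robustExp s a (fun s' => V' s' + δ) :=
      M.robustExp_mono s a fun s' => by have := (abs_le.1 (h s')).2; linarith
    linarith [M.robustExp_add_le s a δ V']
  rw [abs_le]
  constructor
  · linarith [key V' V fun s' => by rw [abs_sub_comm]; exact h s']
  · exact key V V' h

theorem robustExp_mem (s : S) (a : A) {V : S → ℝ} (h : V ∈ M.valueBox) :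
    0 ≤ M.robustExp s a V ∧ M.robustExp s a V ≤ M.vmax := by
  constructor
  · rw [← M.robustExp_const s a 0]; exact M.robustExp_mono s a fun s' => (h s').1
  · rw [← M.robustExp_const s a M.vmax]; exact M.robustExp_mono s a fun s' => (h s').2

/-! ### The robust Bellman operator -/

theorem norm_pi_pi_le [Fintype A] {Q : S → A → ℝ} {c : ℝ} (hc : 0 ≤ c) : ‖Q‖ ≤ c ↔ ∀ s a, |Q s a| ≤ c := by
  simp only [pi_norm_le_iff_of_nonneg hc, Real.norm_eq_abs]

theorem vmax_eq : 1 + M.γ * M.vmax = M.vmax := by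
  unfold vmax
  have := M.one_sub_gamma_pos.ne'
  field_simp
  ring

theorem maxQ_mem {S A : Type*} [Fintype A] [Nonempty A] {Q : S → A → ℝ} {lo hi : ℝ} (h : ∀ s a, lo ≤ Q s a ∧ Q s a ≤ hi) (s : S) :
    lo ≤ maxQ Q s ∧ maxQ Q s ≤ hi := by
  obtain ⟨a⟩ := ‹Nonempty A›
  exact ⟨(h s a).1.trans (Finset.le_sup' (fun a => Q s a) (Finset.mem_univ a)),
    Finset.sup'_le _ _ fun a _ => (h s a).2⟩

section Bellman

variable [Fintype A] [Nonempty A]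

/-- The robust Bellman operator with real values. -/
def bellmanReal (Q : S → A → ℝ) (s : S) (a : A) : ℝ :=
  M.R s a + M.γ * M.robustExp s a (maxQ Q)

theorem bellman_eq (Q : S → A → ℝ) (s : S) (a : A) :
    M.bellman Q s a = (M.bellmanReal Q s a : EReal) := by
  unfold bellman bellmanReal
  rw [EReal.coe_add, EReal.coe_mul, coe_robustExp]
  rfl

theorem isOptimalQ_iff (Q : S → A → ℝ) : M.IsOptimalQ Q ↔ M.bellmanReal Q = Q := by
  simp only [IsOptimalQ, bellman_eq, EReal.coe_eq_coe_iff, funext_iff]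
  exact forall₂_congr fun _ _ => eq_comm

theorem abs_maxQ_sub_le {Q Q' : S → A → ℝ} (s : S) : |maxQ Q s - maxQ Q' s| ≤ ‖Q - Q'‖ := by
  have hQ : ∀ Q Q' : S → A → ℝ, maxQ Q s - maxQ Q' s ≤ ‖Q - Q'‖ := fun Q Q' => by
    rw [sub_le_iff_le_add]
    refine Finset.sup'_le _ _ fun a _ => ?_
    have h1 : Q s a - Q' s a ≤ ‖Q - Q'‖ :=
      (le_abs_self _).trans ((norm_le_pi_norm ((Q - Q') s) a).trans (norm_le_pi_norm (Q - Q') s))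
    have h2 : Q' s a ≤ maxQ Q' s := Finset.le_sup' (fun a => Q' s a) (Finset.mem_univ a)
    linarith
  rw [abs_le]
  constructor
  · have := hQ Q' Q
    rw [norm_sub_rev] at this; linarith
  · exact hQ Q Q'

theorem contracting_bellmanReal : ContractingWith (NNReal.mk M.γ M.γ_nonneg) (M.bellmanReal (A := A)) := by
  refine ⟨by exact_mod_cast M.γ_lt_one, LipschitzWith.of_dist_le_mul fun Q Q' => ?_⟩
  rw [dist_eq_norm, dist_eq_norm, NNReal.coe_mk,
    norm_pi_pi_le (mul_nonneg M.γ_nonneg (norm_nonneg _))]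
  intro s a
  have : M.bellmanReal Q s a - M.bellmanReal Q' s a =
      M.γ * (M.robustExp s a (maxQ Q) - M.robustExp s a (maxQ Q')) := by
    unfold bellmanReal; ring
  rw [Pi.sub_apply, Pi.sub_apply, this, abs_mul, abs_of_nonneg M.γ_nonneg]
  exact mul_le_mul_of_nonneg_left (M.abs_robustExp_sub_le s a fun s' => abs_maxQ_sub_le s')
    M.γ_nonneg

theorem existsUnique_isOptimalQ : ∃! Q : S → A → ℝ, M.IsOptimalQ Q := by
  have h := M.contracting_bellmanReal
  refine ⟨h.fixedPoint _, (M.isOptimalQ_iff _).2 h.fixedPoint_isFixedPt, fun Q hQ => ?_⟩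
  exact h.fixedPoint_unique ((M.isOptimalQ_iff _).1 hQ)

/-- The box is closed and invariant under the Bellman operator, since `1 + γ vmax = vmax`; the
iterates started at `0` stay in it and converge to the fixed point. -/
theorem IsOptimalQ.mem_box {Q : S → A → ℝ} (hQ : M.IsOptimalQ Q) (s : S) (a : A) :
    0 ≤ Q s a ∧ Q s a ≤ M.vmax := by
  have hcl : IsClosed {Q : S → A → ℝ | ∀ s a, 0 ≤ Q s a ∧ Q s a ≤ M.vmax} := by
    simp only [Set.ofPred_forall, Set.ofPred_and]
    refine isClosed_iInter fun s => isClosed_iInter fun a => IsClosed.inter ?_ ?_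
    · exact isClosed_le continuous_const (by fun_prop)
    · exact isClosed_le (by fun_prop) continuous_const
  have h := M.contracting_bellmanReal (A := A)
  have hmap : Set.MapsTo M.bellmanReal {Q : S → A → ℝ | ∀ s a, 0 ≤ Q s a ∧ Q s a ≤ M.vmax}
      {Q : S → A → ℝ | ∀ s a, 0 ≤ Q s a ∧ Q s a ≤ M.vmax} := by
    intro Q hQ s a
    have := M.robustExp_mem s a (V := maxQ Q) (maxQ_mem hQ)
    have h1 := mul_nonneg M.γ_nonneg this.1
    have h2 := mul_le_mul_of_nonneg_left this.2 M.γ_nonneg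
    have h3 := M.vmax_eq
    have h4 := M.R_nonneg s a
    have h5 := M.R_le_one s a
    unfold bellmanReal
    constructor <;> linarith
  have hfix : h.fixedPoint _ = Q :=
    (h.fixedPoint_unique ((M.isOptimalQ_iff _).1 hQ)).symm
  have hlim := h.tendsto_iterate_fixedPoint (fun _ _ => 0)
  rw [hfix] at hlim
  refine hcl.mem_of_tendsto hlim (Eventually.of_forall fun n => ?_) s a
  exact hmap.iterate n (fun _ _ => ⟨le_rfl, M.vmax_pos.le⟩)

end Bellman

end RobustMDP

/-- A function with `L`-Lipschitz derivative on an interval lies above its tangent parabolas. -/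
theorem sub_sq_le_of_lipschitz_deriv {F g : ℝ → ℝ} {lo hi L : ℝ}
    (hF : ∀ x ∈ Set.Icc lo hi, HasDerivAt F (g x) x)
    (hg : ∀ x ∈ Set.Icc lo hi, ∀ y ∈ Set.Icc lo hi, |g x - g y| ≤ L * |x - y|)
    {x y : ℝ} (hx : x ∈ Set.Icc lo hi) (hy : y ∈ Set.Icc lo hi) :
    F x + g x * (y - x) - L / 2 * (y - x) ^ 2 ≤ F y := by
  -- The Lipschitz bound makes the derivative of `h` nonnegative to the right of `x` and nonpositive
  -- to the left, so `h` is minimal at `x`.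
  set h : ℝ → ℝ := fun z => F z - g x * (z - x) + L / 2 * (z - x) ^ 2 with hh
  have hd : ∀ z ∈ Set.Icc lo hi, HasDerivAt h (g z - g x + L * (z - x)) z := fun z hz => by
    have h1 : HasDerivAt (fun z : ℝ => z - x) 1 z := (hasDerivAt_id z).sub_const x
    refine (((hF z hz).sub (h1.const_mul (g x))).add ((h1.pow 2).const_mul (L / 2))).congr_deriv ?_
    push_cast
    ring
  have key : h x ≤ h y := by
    rcases le_total x y with hxy | hxy
    · have hsub : Set.Icc x y ⊆ Set.Icc lo hi := Set.Icc_subset_Icc hx.1 hy.2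
      refine monotoneOn_of_deriv_nonneg (convex_Icc x y)
        (fun z hz => (hd z (hsub hz)).continuousAt.continuousWithinAt) (fun z hz => ?_)
        (fun z hz => ?_) (Set.left_mem_Icc.2 hxy) (Set.right_mem_Icc.2 hxy) hxy
      · exact (hd z (hsub (interior_subset hz))).differentiableAt.differentiableWithinAt
      · have hz' := interior_subset hz
        rw [(hd z (hsub hz')).deriv]
        have := (abs_le.1 (hg z (hsub hz') x hx)).1
        rw [abs_of_nonneg (sub_nonneg.2 hz'.1)] at this
        linarith
    · have hsub : Set.Icc y x ⊆ Set.Icc lo hi := Set.Icc_subset_Icc hy.1 hx.2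
      refine antitoneOn_of_deriv_nonpos (convex_Icc y x)
        (fun z hz => (hd z (hsub hz)).continuousAt.continuousWithinAt) (fun z hz => ?_)
        (fun z hz => ?_) (Set.left_mem_Icc.2 hxy) (Set.right_mem_Icc.2 hxy) hxy
      · exact (hd z (hsub (interior_subset hz))).differentiableAt.differentiableWithinAt
      · have hz' := interior_subset hz
        rw [(hd z (hsub hz')).deriv]
        have := (abs_le.1 (hg z (hsub hz') x hx)).2
        rw [abs_of_nonpos (sub_nonpos.2 hz'.2)] at this
        linarith
  simp only [hh, sub_self, mul_zero, sub_zero] at key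
  norm_num at key
  linarith

theorem _root_.ConcaveOn.le_tangent {s : Set ℝ} {F : ℝ → ℝ} (hF : ConcaveOn ℝ s F) {x y : ℝ}
    (hx : x ∈ s) (hy : y ∈ s) (hd : DifferentiableAt ℝ F x) :
    F y ≤ F x + deriv F x * (y - x) := by
  rcases lt_trichotomy x y with h | h | h
  · have := hF.slope_le_deriv hx hy h hd
    rw [slope_def_field, div_le_iff₀ (by linarith)] at this
    linarith
  · simp [h]
  · have := hF.deriv_le_slope hy hx h hd
    rw [slope_def_field, le_div_iff₀ (by linarith)] at this
    linarith

/-! ### Regularity of the sampled gradients on `Θ` -/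

namespace RobustMDP

variable {S A : Type*} [Fintype S] (M : RobustMDP S A)

theorem convex_finiteDom : Convex ℝ M.finiteDom := by
  have h : M.finiteDom = (LinearMap.mul ℝ ℝ M.lam⁻¹) ⁻¹' {t | conj M.f t ≠ ⊤} := by
    ext u; simp [finiteDom, div_eq_inv_mul]
  rw [h]
  exact (convexOn_conj M.f).1.linear_preimage _

theorem concaveOn_profile : ConcaveOn ℝ M.finiteDom M.profile := by
  have h : M.finiteDom = (LinearMap.mul ℝ ℝ M.lam⁻¹) ⁻¹' {t | conj M.f t ≠ ⊤} := by
    ext u; simp [finiteDom, div_eq_inv_mul]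
  have h1 : ConvexOn ℝ M.finiteDom (fun u => M.lam * (conj M.f (u / M.lam)).toReal) := by
    rw [h]
    have := ((convexOn_conj M.f).comp_linearMap (LinearMap.mul ℝ ℝ M.lam⁻¹)).smul M.lam_pos.le
    refine this.congr fun u _ => ?_
    simp [div_eq_inv_mul]
  exact (concaveOn_id M.convex_finiteDom).sub h1

/-- The assumptions on the dual objective over `Θ = [lo, hi]`. -/
structure Regular (lo hi σ CM : ℝ) : Prop where
  sigma_pos : 0 < σ
  bounded : M.BoundedDomain lo hi
  smooth : M.Smooth lo hi σ
  objective : M.BoundedObjective lo hi CM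

variable {M} {lo hi σ CM : ℝ}

theorem const_mem_valueBox {v : ℝ} (hv : v ∈ Set.Icc 0 M.vmax) : (fun _ => v) ∈ M.valueBox :=
  fun _ => hv

namespace Regular

theorem CM_pos (h : M.Regular lo hi σ CM) : 0 < CM := M.vmax_pos.trans_le h.objective.1

theorem lip_pos (h : M.Regular lo hi σ CM) : 0 < 1 / (M.lam * σ) :=
  one_div_pos.2 (mul_pos M.lam_pos h.sigma_pos)

theorem mem_finiteDom (h : M.Regular lo hi σ CM) {η v : ℝ} (hη : η ∈ Set.Icc lo hi)
    (hv : v ∈ Set.Icc 0 M.vmax) : η - v ∈ M.finiteDom :=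
  M.mem_finiteDom_iff.2 (ne_bot_of_le_ne_bot (EReal.coe_ne_bot _) (h.objective.2 η hη v hv).1)

theorem abs_profile_le (h : M.Regular lo hi σ CM) {η v : ℝ} (hη : η ∈ Set.Icc lo hi)
    (hv : v ∈ Set.Icc 0 M.vmax) : |M.profile (η - v) + v| ≤ CM := by
  have := h.objective.2 η hη v hv
  rw [M.J_eq_of_mem (h.mem_finiteDom hη hv)] at this
  rw [abs_le]
  exact ⟨by exact_mod_cast this.1, by exact_mod_cast this.2⟩

theorem J_toReal (h : M.Regular lo hi σ CM) {η v : ℝ} (hη : η ∈ Set.Icc lo hi)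
    (hv : v ∈ Set.Icc 0 M.vmax) : (M.J η v).toReal = M.profile (η - v) + v := by
  rw [M.J_eq_of_mem (h.mem_finiteDom hη hv), EReal.toReal_coe]

theorem dual_eq_Jexp (h : M.Regular lo hi σ CM) {V : S → ℝ} (hV : V ∈ M.valueBox) (s : S) (a : A)
    {η : ℝ} (hη : η ∈ Set.Icc lo hi) : M.Jexp s a η V = (M.dual s a V η : EReal) :=
  M.Jexp_eq s a fun s' => h.mem_finiteDom hη (hV s')

theorem dual_le_robustExp (h : M.Regular lo hi σ CM) {V : S → ℝ} (hV : V ∈ M.valueBox)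
    (s : S) (a : A) {η : ℝ} (hη : η ∈ Set.Icc lo hi) : M.dual s a V η ≤ M.robustExp s a V := by
  have : M.Jexp s a η V ≤ M.dualSup s a V := le_iSup (fun η : ℝ => M.Jexp s a η V) η
  rw [h.dual_eq_Jexp hV s a hη, ← coe_robustExp] at this
  exact_mod_cast this

theorem exists_dual_eq (h : M.Regular lo hi σ CM) {V : S → ℝ} (hV : V ∈ M.valueBox)
    (s : S) (a : A) : ∃ η ∈ Set.Icc lo hi, M.dual s a V η = M.robustExp s a V := by
  obtain ⟨η, hη, hmax⟩ := h.bounded V hV s a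
  refine ⟨η, hη, le_antisymm (h.dual_le_robustExp hV s a hη) ?_⟩
  have : M.dualSup s a V ≤ M.Jexp s a η V := iSup_le hmax
  rw [h.dual_eq_Jexp hV s a hη, ← coe_robustExp] at this
  exact_mod_cast this

variable [Nonempty S] [Nonempty A]

theorem lo_le_hi (h : M.Regular lo hi σ CM) : lo ≤ hi := by
  obtain ⟨s⟩ := ‹Nonempty S›
  obtain ⟨a⟩ := ‹Nonempty A›
  obtain ⟨η, hη, -⟩ := h.exists_dual_eq
    (const_mem_valueBox (Set.left_mem_Icc.2 M.vmax_pos.le)) s a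
  exact hη.1.trans hη.2

theorem Cg_pos (h : M.Regular lo hi σ CM) : 0 < M.Cg lo hi σ :=
  div_pos (by linarith [h.lo_le_hi, M.vmax_pos]) (mul_pos M.lam_pos h.sigma_pos)

theorem eventually_mem_finiteDom (h : M.Regular lo hi σ CM) {η v : ℝ} (hη : η ∈ Set.Icc lo hi)
    (hv : v ∈ Set.Icc 0 M.vmax) : ∀ᶠ x in 𝓝 η, x - v ∈ M.finiteDom := by
  obtain ⟨s⟩ := ‹Nonempty S›
  obtain ⟨a⟩ := ‹Nonempty A›
  filter_upwards [((h.smooth _ (const_mem_valueBox hv) s a).1 η hη).1] with x hx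
  rw [M.Jexp_const] at hx
  exact M.mem_finiteDom_iff.2 hx

theorem eventuallyEq_J (h : M.Regular lo hi σ CM) {η v : ℝ} (hη : η ∈ Set.Icc lo hi)
    (hv : v ∈ Set.Icc 0 M.vmax) :
    (fun x => (M.J x v).toReal) =ᶠ[𝓝 η] fun x => M.profile (x - v) + v := by
  filter_upwards [h.eventually_mem_finiteDom hη hv] with x hx
  rw [M.J_eq_of_mem hx, EReal.toReal_coe]

theorem gradJ_eq (h : M.Regular lo hi σ CM) {η v : ℝ} (hη : η ∈ Set.Icc lo hi)
    (hv : v ∈ Set.Icc 0 M.vmax) : M.gradJ η v = deriv M.profile (η - v) := by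
  unfold gradJ
  rw [(h.eventuallyEq_J hη hv).deriv_eq, deriv_add_const, deriv_comp_sub_const]

theorem differentiableAt_profile (h : M.Regular lo hi σ CM) {η v : ℝ} (hη : η ∈ Set.Icc lo hi)
    (hv : v ∈ Set.Icc 0 M.vmax) : DifferentiableAt ℝ M.profile (η - v) := by
  obtain ⟨s⟩ := ‹Nonempty S›
  obtain ⟨a⟩ := ‹Nonempty A›
  have h1 := ((h.smooth _ (const_mem_valueBox hv) s a).1 η hη).2
  simp only [M.Jexp_const] at h1
  have h2 := (h.eventuallyEq_J hη hv).differentiableAt_iff.1 h1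
  have h3 : DifferentiableAt ℝ (fun x => M.profile (x - v)) η := by
    simpa using h2.sub_const v
  exact (differentiableAt_comp_sub_const).1 h3

theorem abs_deriv_profile_sub_le (h : M.Regular lo hi σ CM) {η η' v : ℝ}
    (hη : η ∈ Set.Icc lo hi) (hη' : η' ∈ Set.Icc lo hi) (hv : v ∈ Set.Icc 0 M.vmax) :
    |deriv M.profile (η - v) - deriv M.profile (η' - v)| ≤ 1 / (M.lam * σ) * |η - η'| := by
  obtain ⟨s⟩ := ‹Nonempty S›
  obtain ⟨a⟩ := ‹Nonempty A›
  have h1 := (h.smooth _ (const_mem_valueBox hv) s a).2 η hη η' hη'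
  simp only [M.Jexp_const] at h1
  rwa [← h.gradJ_eq hη hv, ← h.gradJ_eq hη' hv]

/-- The derivative of the dual objective. -/
theorem hasDerivAt_dual (h : M.Regular lo hi σ CM) {V : S → ℝ} (hV : V ∈ M.valueBox)
    (s : S) (a : A) {η : ℝ} (hη : η ∈ Set.Icc lo hi) :
    HasDerivAt (M.dual s a V) (∑ s', M.P s a s' * deriv M.profile (η - V s')) η := by
  unfold dual
  refine HasDerivAt.fun_sum fun s' _ => HasDerivAt.const_mul _ (HasDerivAt.add_const _ ?_)
  exact (h.differentiableAt_profile hη (hV s')).hasDerivAt.comp_sub_const η (V s')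

theorem dual_le_tangent (h : M.Regular lo hi σ CM) {V : S → ℝ} (hV : V ∈ M.valueBox)
    (s : S) (a : A) {η η' : ℝ} (hη : η ∈ Set.Icc lo hi) (hη' : η' ∈ Set.Icc lo hi) :
    M.dual s a V η' ≤
      M.dual s a V η + (∑ s', M.P s a s' * deriv M.profile (η - V s')) * (η' - η) := by
  unfold dual
  rw [Finset.sum_mul, ← Finset.sum_add_distrib]
  refine Finset.sum_le_sum fun s' _ => ?_
  have := M.concaveOn_profile.le_tangent (h.mem_finiteDom hη (hV s'))
    (h.mem_finiteDom hη' (hV s')) (h.differentiableAt_profile hη (hV s'))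
  nlinarith [mul_le_mul_of_nonneg_left this (M.P_nonneg s a s')]

theorem parabola_le_dual (h : M.Regular lo hi σ CM) {V : S → ℝ} (hV : V ∈ M.valueBox)
    (s : S) (a : A) {η η' : ℝ} (hη : η ∈ Set.Icc lo hi) (hη' : η' ∈ Set.Icc lo hi) :
    M.dual s a V η + (∑ s', M.P s a s' * deriv M.profile (η - V s')) * (η' - η)
      - 1 / (M.lam * σ) / 2 * (η' - η) ^ 2 ≤ M.dual s a V η' := by
  refine sub_sq_le_of_lipschitz_deriv (F := M.dual s a V)
    (fun x hx => h.hasDerivAt_dual hV s a hx) (fun x hx y hy => ?_) hη hη'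
  rw [← Finset.sum_sub_distrib]
  refine (Finset.abs_sum_le_sum_abs _ _).trans ?_
  calc _ ≤ ∑ s', M.P s a s' * (1 / (M.lam * σ) * |x - y|) := by
        refine Finset.sum_le_sum fun s' _ => ?_
        rw [← mul_sub, abs_mul, abs_of_nonneg (M.P_nonneg s a s')]
        exact mul_le_mul_of_nonneg_left (h.abs_deriv_profile_sub_le hx hy (hV s'))
          (M.P_nonneg s a s')
    _ = _ := by rw [← Finset.sum_mul, M.P_sum, one_mul]

/-- For a constant value function the maximizer provided in `Θ` is global over the line. The
derivative therefore vanishes there even if the maximizer is an endpoint of `Θ`. -/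
theorem exists_deriv_profile_eq_zero (h : M.Regular lo hi σ CM) {v : ℝ}
    (hv : v ∈ Set.Icc 0 M.vmax) : ∃ η ∈ Set.Icc lo hi, deriv M.profile (η - v) = 0 := by
  obtain ⟨s⟩ := ‹Nonempty S›
  obtain ⟨a⟩ := ‹Nonempty A›
  obtain ⟨η, hη, hmax⟩ := h.bounded _ (const_mem_valueBox hv) s a
  refine ⟨η, hη, ?_⟩
  rw [← deriv_comp_sub_const]
  refine IsLocalMax.deriv_eq_zero ?_
  filter_upwards [h.eventually_mem_finiteDom hη hv] with x hx
  have := hmax x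
  rw [M.Jexp_const, M.Jexp_const, M.J_eq_of_mem hx, M.J_eq_of_mem (h.mem_finiteDom hη hv)] at this
  have h2 : M.profile (x - v) + v ≤ M.profile (η - v) + v := by exact_mod_cast this
  linarith

/-- The Lipschitz bound is applied between `η` and a zero of the derivative in `Θ`. -/
theorem abs_deriv_profile_le (h : M.Regular lo hi σ CM) {η v : ℝ}
    (hη : η ∈ Set.Icc lo hi) (hv : v ∈ Set.Icc 0 M.vmax) :
    |deriv M.profile (η - v)| ≤ 1 / (M.lam * σ) * (hi - lo) := by
  obtain ⟨η', hη', h0⟩ := h.exists_deriv_profile_eq_zero hv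
  have := h.abs_deriv_profile_sub_le hη hη' hv
  rw [h0, sub_zero] at this
  refine this.trans (mul_le_mul_of_nonneg_left ?_ h.lip_pos.le)
  exact abs_sub_le_of_le_of_le hη.1 hη.2 hη'.1 hη'.2

/-- The Lipschitz hypothesis varies `η` at a fixed value, whereas here the value varies at fixed
`η`. Since only the difference matters, both arguments are rewritten with one common value and two
points of `Θ`; `hD` makes room for this. -/
theorem abs_deriv_profile_sub_le_vmax (h : M.Regular lo hi σ CM) (hD : M.vmax ≤ hi - lo)
    {η v w : ℝ} (hη : η ∈ Set.Icc lo hi) (hv : v ∈ Set.Icc 0 M.vmax) (hw : w ∈ Set.Icc 0 M.vmax) :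
    |deriv M.profile (η - v) - deriv M.profile (η - w)| ≤ 1 / (M.lam * σ) * M.vmax := by
  wlog hvw : v ≤ w generalizing v w
  · rw [abs_sub_comm]; exact this hw hv (le_of_not_ge hvw)
  obtain ⟨h1, h2⟩ := hη
  set u := max v (lo - η + w) with hu
  have hu1 : v ≤ u := le_max_left _ _
  have hu2 : lo - η + w ≤ u := le_max_right _ _
  have hu3 : u ≤ w := max_le hvw (by linarith)
  have hu4 : u ≤ hi - η + v := max_le (by linarith) (by linarith [hv.1, hw.2])
  have key := h.abs_deriv_profile_sub_le (η := η - v + u) (η' := η - w + u) (v := u)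
    ⟨by linarith, by linarith⟩ ⟨by linarith, by linarith⟩ ⟨hv.1.trans hu1, hu3.trans hw.2⟩
  rw [add_sub_cancel_right, add_sub_cancel_right] at key
  refine key.trans (mul_le_mul_of_nonneg_left ?_ h.lip_pos.le)
  rw [abs_le]
  constructor <;> linarith [hv.1, hw.2]

/-- The variance of the stochastic gradient is at most `(C_g / 2)²`. -/
theorem variance_grad_le (h : M.Regular lo hi σ CM) {V : S → ℝ} (hV : V ∈ M.valueBox)
    (s : S) (a : A) {η : ℝ} (hη : η ∈ Set.Icc lo hi) :
    ∑ s', M.P s a s' * (deriv M.profile (η - V s')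
      - ∑ s'', M.P s a s'' * deriv M.profile (η - V s'')) ^ 2 ≤ (M.Cg lo hi σ / 2) ^ 2 := by
  set g : S → ℝ := fun s' => deriv M.profile (η - V s') with hg
  set m := ∑ s'', M.P s a s'' * g s'' with hm
  have hCg : M.Cg lo hi σ = 1 / (M.lam * σ) * ((hi - lo) + M.vmax) := by
    unfold Cg; ring
  have hL := h.lip_pos
  have hlo := h.lo_le_hi
  have hsum : ∀ c, ∑ s', M.P s a s' * c = c := fun c => by
    rw [← Finset.sum_mul, M.P_sum, one_mul]
  -- The smaller of `diam Θ` and `vmax` is at most half their sum, which is where the factor `1 / 2`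
  -- in `C_g / 2` comes from. If `diam Θ` is smaller, the second moment is bounded; otherwise the
  -- oscillation of the gradient over the next states is.
  rcases le_total (hi - lo) M.vmax with hD | hD
  · have h1 : ∑ s', M.P s a s' * (g s' - m) ^ 2 = ∑ s', M.P s a s' * g s' ^ 2 - m ^ 2 := by
      have : ∀ s', M.P s a s' * (g s' - m) ^ 2 =
          M.P s a s' * g s' ^ 2 - 2 * m * (M.P s a s' * g s') + M.P s a s' * m ^ 2 :=
        fun s' => by ring
      rw [Finset.sum_congr rfl fun s' _ => this s', Finset.sum_add_distrib,
        Finset.sum_sub_distrib, ← Finset.mul_sum, ← hm, hsum _]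
      ring
    rw [h1]
    have h2 : ∑ s', M.P s a s' * g s' ^ 2 ≤ ∑ s', M.P s a s' * (M.Cg lo hi σ / 2) ^ 2 := by
      refine Finset.sum_le_sum fun s' _ => mul_le_mul_of_nonneg_left ?_ (M.P_nonneg s a s')
      refine sq_le_sq' ?_ ?_ <;>
      · have := abs_le.1 (h.abs_deriv_profile_le hη (hV s'))
        rw [hCg]
        have := mul_le_mul_of_nonneg_left hD hL.le
        simp only [hg]
        linarith
    rw [hsum _] at h2
    linarith [sq_nonneg m]
  · have h2 : ∀ s', |g s' - m| ≤ M.Cg lo hi σ / 2 := fun s' => by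
      have h3 : g s' - m = ∑ s'', M.P s a s'' * (g s' - g s'') := by
        simp only [mul_sub, Finset.sum_sub_distrib, hsum (g s'), hm]
      rw [h3]
      refine (Finset.abs_sum_le_sum_abs _ _).trans ?_
      calc _ ≤ ∑ s'', M.P s a s'' * (1 / (M.lam * σ) * M.vmax) := by
            refine Finset.sum_le_sum fun s'' _ => ?_
            rw [abs_mul, abs_of_nonneg (M.P_nonneg s a s'')]
            exact mul_le_mul_of_nonneg_left
              (h.abs_deriv_profile_sub_le_vmax hD hη (hV s') (hV s'')) (M.P_nonneg s a s'')
        _ = 1 / (M.lam * σ) * M.vmax := hsum _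
        _ ≤ _ := by
            rw [hCg]
            have := mul_le_mul_of_nonneg_left hD hL.le
            linarith
    calc _ ≤ ∑ s', M.P s a s' * (M.Cg lo hi σ / 2) ^ 2 :=
          Finset.sum_le_sum fun s' _ => mul_le_mul_of_nonneg_left
            (sq_le_sq' (abs_le.1 (h2 s')).1 (abs_le.1 (h2 s')).2) (M.P_nonneg s a s')
      _ = _ := hsum _

/-- Every point of `Θ` is suboptimal by at most `diam(Θ) C_g`. -/
theorem robustExp_sub_dual_le (h : M.Regular lo hi σ CM) {V : S → ℝ} (hV : V ∈ M.valueBox)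
    (s : S) (a : A) {η : ℝ} (hη : η ∈ Set.Icc lo hi) :
    M.robustExp s a V - M.dual s a V η ≤ (hi - lo) * M.Cg lo hi σ := by
  obtain ⟨η', hη', he⟩ := h.exists_dual_eq hV s a
  have h1 := h.dual_le_tangent hV s a hη hη'
  rw [he] at h1
  have hlo := h.lo_le_hi
  have h2 : |∑ s', M.P s a s' * deriv M.profile (η - V s')| ≤ M.Cg lo hi σ := by
    refine (Finset.abs_sum_le_sum_abs _ _).trans ?_
    calc _ ≤ ∑ s', M.P s a s' * (1 / (M.lam * σ) * (hi - lo)) := by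
          refine Finset.sum_le_sum fun s' _ => ?_
          rw [abs_mul, abs_of_nonneg (M.P_nonneg s a s')]
          exact mul_le_mul_of_nonneg_left (h.abs_deriv_profile_le hη (hV s')) (M.P_nonneg s a s')
      _ = 1 / (M.lam * σ) * (hi - lo) := by rw [← Finset.sum_mul, M.P_sum, one_mul]
      _ ≤ 1 / (M.lam * σ) * (hi - lo + M.vmax) :=
          mul_le_mul_of_nonneg_left (by linarith [M.vmax_pos]) h.lip_pos.le
      _ = _ := by unfold Cg; ring
  have h3 : |η' - η| ≤ hi - lo := abs_sub_le_of_le_of_le hη'.1 hη'.2 hη.1 hη.2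
  have h4 := mul_le_mul h3 h2 (abs_nonneg _) (by linarith)
  rw [← abs_mul, mul_comm (η' - η)] at h4
  linarith [le_abs_self ((∑ s', M.P s a s' * deriv M.profile (η - V s')) * (η' - η))]

end Regular

end RobustMDP

/-! ### Last-iterate convergence from windowed regret bounds -/

/-- Summation by parts with increasing weights. The initial distance `d m` is kept separate because
it vanishes when the comparison point is the `m`-th iterate itself. -/
theorem sum_sqrt_mul_sub_le {d : ℕ → ℝ} {D2 : ℝ} (hd : ∀ t, d t ≤ D2) (m k : ℕ) :
    ∑ t ∈ Finset.Ico m (m + k + 1), √((t : ℝ) + 1) * (d t - d (t + 1)) ≤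
      √((m : ℝ) + 1) * d m + D2 * (√((m + k + 1 : ℕ) : ℝ) - √((m : ℝ) + 1))
        - √((m + k + 1 : ℕ) : ℝ) * d (m + k + 1) := by
  induction k with
  | zero => simp; linarith
  | succ k ih =>
    rw [show m + (k + 1) + 1 = (m + k + 1) + 1 by ring, Finset.sum_Ico_succ_top (by omega)]
    have h1 : √((m + k + 1 : ℕ) : ℝ) ≤ √(((m + k + 1 : ℕ) : ℝ) + 1) :=
      Real.sqrt_le_sqrt (by linarith)
    have h2 := mul_le_mul_of_nonneg_left (hd (m + k + 1)) (sub_nonneg.2 h1)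
    have h3 : (((m + k + 1) + 1 : ℕ) : ℝ) = ((m + k + 1 : ℕ) : ℝ) + 1 := by push_cast; ring
    rw [h3]
    linarith

theorem one_div_sqrt_le (x : ℝ) (hx : 0 ≤ x) : 1 / √(x + 1) ≤ 2 * (√(x + 1) - √x) := by
  have h1 : 0 < √(x + 1) := Real.sqrt_pos.2 (by linarith)
  have h2 := Real.sq_sqrt (show 0 ≤ x + 1 by linarith)
  have h3 := Real.sq_sqrt hx
  rw [div_le_iff₀ h1]
  nlinarith [sq_nonneg (√(x + 1) - √x)]

theorem sum_one_div_sqrt_le {m N : ℕ} (h : m ≤ N) :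
    ∑ t ∈ Finset.Ico m N, 1 / √((t : ℝ) + 1) ≤ 2 * (√(N : ℝ) - √(m : ℝ)) := by
  induction N, h using Nat.le_induction with
  | base => simp
  | succ N hN ih =>
    rw [Finset.sum_Ico_succ_top hN]
    have := one_div_sqrt_le (N : ℝ) (Nat.cast_nonneg N)
    push_cast
    linarith

/-- Let `a_k` be the average of the last `k` errors. Regret against the iterate just before this
window, with initial distance zero, gives `a_k ≤ a_{k+1} + B / (k + 1)` with `B = K / √N`. Regret
against the optimum gives `a_N ≤ B`. Summing down to `k = 1` costs a harmonic sum, hence `1 + log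
N`. -/
theorem last_iterate_le {N : ℕ} (hN : 1 ≤ N) {e ds : ℕ → ℝ} {d : ℕ → ℕ → ℝ} {c D2 s2 : ℝ}
    (hc : 0 < c) (hs2 : 0 ≤ s2) (hd : ∀ j t, 0 ≤ d j t ∧ d j t ≤ D2) (hdd : ∀ j, d j j = 0)
    (hds : ∀ t, 0 ≤ ds t ∧ ds t ≤ D2)
    (h1 : ∀ t, ∀ j ≤ t, e (t + 1) - e j ≤
      √((t : ℝ) + 1) / (2 * c) * (d j t - d j (t + 1)) + c * s2 * (1 / √((t : ℝ) + 1)))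
    (h2 : ∀ t, e (t + 1) ≤
      √((t : ℝ) + 1) / (2 * c) * (ds t - ds (t + 1)) + c * s2 * (1 / √((t : ℝ) + 1))) :
    e N ≤ (D2 / (2 * c) + 2 * c * s2) * ((1 + Real.log N) / √(N : ℝ)) := by
  set K := D2 / (2 * c) + 2 * c * s2 with hK
  have hD2 : 0 ≤ D2 := (hds 0).1.trans (hds 0).2
  have hK0 : 0 ≤ K := by positivity
  have hNpos : (0 : ℝ) < N := by exact_mod_cast hN
  have hsN : 0 < √(N : ℝ) := Real.sqrt_pos.2 hNpos
  have hreg : ∀ (f δ : ℕ → ℝ) (m : ℕ), m < N → (∀ t, 0 ≤ δ t ∧ δ t ≤ D2) →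
      (∀ t, m ≤ t → f t ≤
        √((t : ℝ) + 1) / (2 * c) * (δ t - δ (t + 1)) + c * s2 * (1 / √((t : ℝ) + 1))) →
      ∑ t ∈ Finset.Ico m N, f t ≤
        1 / (2 * c) * (√((m : ℝ) + 1) * δ m + D2 * (√(N : ℝ) - √((m : ℝ) + 1)))
        + c * s2 * (2 * (√(N : ℝ) - √(m : ℝ))) := by
    intro f δ m hm hδ hf
    obtain ⟨k, rfl⟩ : ∃ k, N = m + k + 1 := ⟨N - m - 1, by omega⟩
    calc ∑ t ∈ Finset.Ico m (m + k + 1), f t ≤ ∑ t ∈ Finset.Ico m (m + k + 1),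
          (1 / (2 * c) * (√((t : ℝ) + 1) * (δ t - δ (t + 1)))
            + c * s2 * (1 / √((t : ℝ) + 1))) := by
          refine Finset.sum_le_sum fun t ht => (hf t (Finset.mem_Ico.1 ht).1).trans (le_of_eq ?_)
          ring
      _ ≤ _ := by
          rw [Finset.sum_add_distrib, ← Finset.mul_sum, ← Finset.mul_sum]
          have g1 := sum_sqrt_mul_sub_le (fun t => (hδ t).2) m k
          have g2 := sum_one_div_sqrt_le hm.le
          have g3 := mul_nonneg (Real.sqrt_nonneg ((m + k + 1 : ℕ) : ℝ)) (hδ (m + k + 1)).1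
          refine add_le_add (mul_le_mul_of_nonneg_left ?_ (by positivity))
            (mul_le_mul_of_nonneg_left g2 (by positivity))
          linarith
  -- The comparison point is the iterate `m`, so `d m m = 0` removes the boundary term, and the
  -- regret is of order `√N - √m ≤ (N - m) / √N`.
  have hwin : ∀ m, m < N → ∑ t ∈ Finset.Ico m N, e (t + 1) ≤
      ((N : ℝ) - m) * e m + K * (((N : ℝ) - m) / √(N : ℝ)) := by
    intro m hm
    have g := hreg (fun t => e (t + 1) - e m) (d m) m hm (hd m) fun t ht => h1 t m ht
    rw [hdd, Finset.sum_sub_distrib, Finset.sum_const, Nat.card_Ico, nsmul_eq_mul,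
      Nat.cast_sub hm.le] at g
    have g1 : √(m : ℝ) ≤ √((m : ℝ) + 1) := Real.sqrt_le_sqrt (by linarith)
    have g2 : √(N : ℝ) - √(m : ℝ) ≤ ((N : ℝ) - m) / √(N : ℝ) := by
      rw [le_div_iff₀ hsN]
      have a1 := Real.sq_sqrt hNpos.le
      have a2 := Real.sq_sqrt (Nat.cast_nonneg (α := ℝ) m)
      have a3 : √(m : ℝ) ≤ √(N : ℝ) := Real.sqrt_le_sqrt (by exact_mod_cast hm.le)
      nlinarith [mul_nonneg (Real.sqrt_nonneg (m : ℝ)) (sub_nonneg.2 a3)]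
    have g3 : 1 / (2 * c) * (√((m : ℝ) + 1) * 0 + D2 * (√(N : ℝ) - √((m : ℝ) + 1)))
        ≤ D2 / (2 * c) * (√(N : ℝ) - √(m : ℝ)) := by
      rw [mul_zero, zero_add, ← mul_assoc, one_div_mul_eq_div]
      exact mul_le_mul_of_nonneg_left (by linarith) (by positivity)
    have g4 := mul_le_mul_of_nonneg_left g2 hK0
    have g5 : K * (√(N : ℝ) - √(m : ℝ)) = D2 / (2 * c) * (√(N : ℝ) - √(m : ℝ))
      + c * s2 * (2 * (√(N : ℝ) - √(m : ℝ))) := by rw [hK]; ring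
    linarith
  have htot : ∑ t ∈ Finset.Ico 0 N, e (t + 1) ≤ K * √(N : ℝ) := by
    have g := hreg (fun t => e (t + 1)) ds 0 hN hds fun t _ => h2 t
    simp only [Nat.cast_zero, zero_add, Real.sqrt_one, Real.sqrt_zero, one_mul, sub_zero] at g
    refine g.trans ?_
    rw [hK, add_mul]
    refine add_le_add ?_ (le_of_eq (by ring))
    rw [show D2 / (2 * c) * √(N : ℝ) = 1 / (2 * c) * (D2 * √(N : ℝ)) by ring]
    exact mul_le_mul_of_nonneg_left (by linarith [(hds 0).2]) (by positivity)
  have key : ∀ m, m < N → ∑ t ∈ Finset.Ico m N, e (t + 1) ≤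
      ((N : ℝ) - m) * (K / √(N : ℝ) * (1 + Real.log N - Real.log ((N : ℝ) - m))) := by
    intro m
    induction m with
    | zero =>
      intro _
      refine htot.trans (le_of_eq ?_)
      rw [Nat.cast_zero, sub_zero, add_sub_cancel_right, mul_one]
      field_simp
      rw [Real.sq_sqrt hNpos.le]
    | succ m ih =>
      intro hm
      have i1 := ih (by omega)
      rw [Finset.sum_eq_sum_Ico_succ_bot (show m < N by omega)] at i1
      have i2 := hwin (m + 1) hm
      set E := ∑ t ∈ Finset.Ico (m + 1) N, e (t + 1)
      push_cast at i1 i2 ⊢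
      set k : ℝ := (N : ℝ) - (m + 1) with hk
      have hk0 : 0 < k := by
        rw [hk, sub_pos]; exact_mod_cast hm
      rw [show (N : ℝ) - m = k + 1 by rw [hk]; ring] at i1
      have hlog : 1 / (k + 1) ≤ Real.log (k + 1) - Real.log k := by
        rw [← Real.log_div (by positivity) hk0.ne']
        have := Real.one_sub_inv_le_log_of_pos (show 0 < (k + 1) / k by positivity)
        refine le_trans (le_of_eq ?_) this
        field_simp
        ring
      set B := K / √(N : ℝ) with hB
      have hB0 : 0 ≤ B := by positivity
      have i3 : K * (k / √(N : ℝ)) = B * k := by rw [hB]; ring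
      rw [i3] at i2
      -- `k` times the induction hypothesis plus the window bound `i2`; the term `k * e (m + 1)`
      -- cancels.
      have i4 : E * (k + 1) ≤
          k * (k + 1) * (B * (1 + Real.log N - Real.log (k + 1))) + B * k := by
        nlinarith [mul_le_mul_of_nonneg_left i1 hk0.le]
      have i5 := mul_le_mul_of_nonneg_left hlog hB0
      have i6 : B * k = k * (k + 1) * (B * (1 / (k + 1))) := by field_simp
      have i7 : E * (k + 1) ≤ (k * (B * (1 + Real.log N - Real.log k))) * (k + 1) := by
        have := mul_le_mul_of_nonneg_left i5 (show 0 ≤ k * (k + 1) by positivity)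
        nlinarith
      exact le_of_mul_le_mul_right i7 (by linarith)
  obtain ⟨n, rfl⟩ : ∃ n, N = n + 1 := ⟨N - 1, by omega⟩
  have := key n (by omega)
  rw [Finset.sum_Ico_succ_top le_rfl] at this
  simp only [Finset.Ico_self, Finset.sum_empty, zero_add] at this
  rw [show ((n + 1 : ℕ) : ℝ) - n = 1 by push_cast; ring, Real.log_one, one_mul, sub_zero] at this
  refine this.trans (le_of_eq (by ring))

/-- Absorbs the loss of one inner step: the regret analysis starts only at the first projected
iterate, which costs the change from `1` to `2` in the numerator. -/
theorem log_div_sqrt_succ_le {N : ℕ} (hN : 1 ≤ N) :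
    (1 + Real.log N) / √(N : ℝ) ≤ (2 + Real.log ((N + 1 : ℕ) : ℝ)) / √((N + 1 : ℕ) : ℝ) := by
  have hNpos : (1 : ℝ) ≤ N := by exact_mod_cast hN
  push_cast
  have hs : 0 < √(N : ℝ) := Real.sqrt_pos.2 (by linarith)
  have hs1 : 0 < √((N : ℝ) + 1) := Real.sqrt_pos.2 (by linarith)
  rw [div_le_div_iff₀ hs hs1]
  have h1 : Real.log N ≤ N - 1 := Real.log_le_sub_one_of_pos (by linarith)
  have h2 : Real.log N ≤ Real.log ((N : ℝ) + 1) := Real.log_le_log (by linarith) (by linarith)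
  have h0 : 0 ≤ Real.log N := Real.log_nonneg hNpos
  have h3 : √((N : ℝ) + 1) ≤ √(N : ℝ) * (1 + 1 / (2 * N)) := by
    rw [Real.sqrt_le_left (by positivity), mul_pow, Real.sq_sqrt (by linarith)]
    field_simp
    nlinarith
  calc (1 + Real.log N) * √((N : ℝ) + 1) ≤ (1 + Real.log N) * (√(N : ℝ) * (1 + 1 / (2 * N))) :=
        mul_le_mul_of_nonneg_left h3 (by linarith)
    _ = (1 + Real.log N + (1 + Real.log N) / (2 * N)) * √(N : ℝ) := by ring
    _ ≤ _ := by
      refine mul_le_mul_of_nonneg_right ?_ hs.le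
      have : (1 + Real.log N) / (2 * N) ≤ 1 := by
        rw [div_le_one (by linarith)]; linarith
      linarith

/-! ### Projections and a projected gradient step -/

namespace RobustMDP

theorem clamp_mem {lo hi : ℝ} (h : lo ≤ hi) (x : ℝ) : clamp lo hi x ∈ Set.Icc lo hi :=
  ⟨le_max_left _ _, max_le h (min_le_left _ _)⟩

theorem clamp_eq_self {lo hi x : ℝ} (h : x ∈ Set.Icc lo hi) : clamp lo hi x = x := by
  rw [clamp, min_eq_right h.2, max_eq_right h.1]

theorem abs_clamp_sub_le (lo hi x y : ℝ) : |clamp lo hi x - clamp lo hi y| ≤ |x - y| := by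
  unfold clamp
  have h1 := abs_max_sub_max_le_max lo (min hi x) lo (min hi y)
  have h2 := abs_min_sub_min_le_max hi x hi y
  simp only [sub_self, abs_zero, abs_nonneg, max_eq_right] at h1 h2
  exact h1.trans h2

theorem continuous_clamp (lo hi : ℝ) : Continuous (clamp lo hi) := by
  unfold clamp; fun_prop

/-- The variational characterization of the projection onto a convex set, in dimension one. -/
theorem clamp_variational {lo hi x u : ℝ} (hu : u ∈ Set.Icc lo hi) :
    (x - clamp lo hi x) * (u - clamp lo hi x) ≤ 0 := by
  have hlh : lo ≤ hi := hu.1.trans hu.2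
  unfold clamp
  rcases le_total x lo with h | h
  · rw [min_eq_right (h.trans hlh), max_eq_left h]
    nlinarith [hu.1]
  · rcases le_total x hi with h' | h'
    · rw [min_eq_right h', max_eq_right h]; simp
    · rw [min_eq_left h', max_eq_right hlh]
      nlinarith [hu.2]

/-- One step `w ↦ Π(w + a g)` of projected ascent on a concave `L`-smooth function with gradient
`m` at `w`, when `a L ≤ 1`. -/
theorem projected_step {F : ℝ → ℝ} {lo hi w u m g a L : ℝ} (hu : u ∈ Set.Icc lo hi)
    (ha : 0 ≤ a) (haL : a * L ≤ 1) (hFu : F u ≤ F w + m * (u - w))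
    (hFw : F w + m * (clamp lo hi (w + a * g) - w) - L / 2 * (clamp lo hi (w + a * g) - w) ^ 2
      ≤ F (clamp lo hi (w + a * g))) :
    a * (F u - F (clamp lo hi (w + a * g))) ≤
      ((w - u) ^ 2 - (clamp lo hi (w + a * g) - u) ^ 2) / 2 + a ^ 2 * (g - m) ^ 2
        + a * (g - m) * (clamp lo hi (w + a * m) - u) := by
  set z := clamp lo hi (w + a * g) with hz
  -- `b` is the noiseless step. In the cross term, `z - u` is split as `(z - b) + (b - u)`: the
  -- first part is of size `a |g - m|` because the projection is nonexpansive, and the second does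
  -- not depend on the sample, so it averages out.
  set b := clamp lo hi (w + a * m) with hb
  have h1 : (w + a * g - z) * (u - z) ≤ 0 := clamp_variational hu
  have h2 := mul_le_mul_of_nonneg_left (show F u - F z ≤ m * (u - z) + L / 2 * (z - w) ^ 2 by
    linarith) ha
  -- The curvature term `a L (z - w)² / 2` is absorbed by the `-(z - w)² / 2` in the three-point
  -- identity for `h1`.
  have h3 := mul_le_mul_of_nonneg_right haL (sq_nonneg (z - w))
  have h4 : a * (g - m) * (z - b) ≤ a ^ 2 * (g - m) ^ 2 := by
    have : |z - b| ≤ |a * (g - m)| := by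
      have := abs_clamp_sub_le lo hi (w + a * g) (w + a * m)
      rwa [show w + a * g - (w + a * m) = a * (g - m) by ring] at this
    have h5 := mul_le_mul_of_nonneg_left this (abs_nonneg (a * (g - m)))
    rw [← abs_mul, abs_mul_abs_self] at h5
    have := (le_abs_self _).trans h5
    nlinarith
  nlinarith

variable {S A : Type*} [Fintype S] {M : RobustMDP S A} {lo hi σ CM : ℝ}

/-- Averaging the pathwise step over the next state kills the term linear in `g - m` and replaces
`(g - m)²` by the variance. The inequality is written as nonnegativity of one sum so that it can be
integrated over the past directly. -/
theorem Regular.sum_projected_step [Nonempty S] [Nonempty A] (h : M.Regular lo hi σ CM)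
    {V : S → ℝ} (hV : V ∈ M.valueBox) (s : S) (a : A) {w u α : ℝ} (hw : w ∈ Set.Icc lo hi)
    (hu : u ∈ Set.Icc lo hi) (hα : 0 ≤ α) (hαL : α * (1 / (M.lam * σ)) ≤ 1) :
    0 ≤ ∑ s', M.P s a s' *
      (((w - u) ^ 2 - (clamp lo hi (w + α * deriv M.profile (w - V s')) - u) ^ 2) / 2
        + α ^ 2 * (M.Cg lo hi σ / 2) ^ 2
        - α * (M.dual s a V u
          - M.dual s a V (clamp lo hi (w + α * deriv M.profile (w - V s'))))) := by
  set g : S → ℝ := fun s' => deriv M.profile (w - V s') with hg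
  set m := ∑ s', M.P s a s' * g s' with hm
  set b := clamp lo hi (w + α * m) with hb
  have hstep : ∀ s', M.P s a s' * (α ^ 2 * ((M.Cg lo hi σ / 2) ^ 2 - (g s' - m) ^ 2)
      - α * (b - u) * (g s' - m)) ≤ M.P s a s' *
      (((w - u) ^ 2 - (clamp lo hi (w + α * g s') - u) ^ 2) / 2
        + α ^ 2 * (M.Cg lo hi σ / 2) ^ 2
        - α * (M.dual s a V u - M.dual s a V (clamp lo hi (w + α * g s')))) := fun s' => by
    refine mul_le_mul_of_nonneg_left ?_ (M.P_nonneg s a s')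
    have := projected_step (g := g s') hu hα hαL (h.dual_le_tangent hV s a hw hu)
      (h.parabola_le_dual hV s a hw (clamp_mem h.lo_le_hi _))
    linarith
  refine le_trans ?_ (Finset.sum_le_sum fun s' _ => hstep s')
  have e : ∀ s', M.P s a s' * (α ^ 2 * ((M.Cg lo hi σ / 2) ^ 2 - (g s' - m) ^ 2)
      - α * (b - u) * (g s' - m)) = M.P s a s' * (α ^ 2 * (M.Cg lo hi σ / 2) ^ 2)
      - α ^ 2 * (M.P s a s' * (g s' - m) ^ 2) - α * (b - u) * (M.P s a s' * g s')
      + M.P s a s' * (α * (b - u) * m) := fun s' => by ring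
  rw [Finset.sum_congr rfl fun s' _ => e s', Finset.sum_add_distrib, Finset.sum_sub_distrib,
    Finset.sum_sub_distrib, ← Finset.mul_sum, ← Finset.mul_sum, ← Finset.sum_mul,
    ← Finset.sum_mul, M.P_sum, ← hm]
  have := mul_le_mul_of_nonneg_left (h.variance_grad_le hV s a hw) (sq_nonneg α)
  simp only [hg] at this hm ⊢
  linarith

end RobustMDP

/-! ### Independence -/

/-- The freezing lemma, with the independent copy living on the same probability space. It plays the
role of conditioning on the past throughout. -/
theorem integral_comp_of_indepFun {Ω E F : Type*} [MeasurableSpace Ω] [MeasurableSpace E]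
    [MeasurableSpace F] {μ : Measure Ω} [IsProbabilityMeasure μ] {U : Ω → E} {Z : Ω → F}
    (hU : Measurable U) (hZ : Measurable Z) (hUZ : IndepFun U Z μ) {φ : E × F → ℝ}
    (hφ : Measurable φ) {C : ℝ} (hC : ∀ ω ω', |φ (U ω, Z ω')| ≤ C) :
    ∫ ω, φ (U ω, Z ω) ∂μ = ∫ ω, ∫ ω', φ (U ω, Z ω') ∂μ ∂μ := by
  have : IsProbabilityMeasure (μ.map U) := Measure.isProbabilityMeasure_map hU.aemeasurable
  have : IsProbabilityMeasure (μ.map Z) := Measure.isProbabilityMeasure_map hZ.aemeasurable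
  have hint : Integrable φ ((μ.map U).prod (μ.map Z)) := by
    rw [← hUZ.map_prod_eq_prod_map_map hU.aemeasurable hZ.aemeasurable]
    refine Integrable.of_bound hφ.aestronglyMeasurable C ?_
    rw [ae_map_iff (hU.prodMk hZ).aemeasurable (measurableSet_le hφ.norm measurable_const)]
    exact Eventually.of_forall fun ω => hC ω ω
  calc ∫ ω, φ (U ω, Z ω) ∂μ = ∫ p, φ p ∂(μ.map fun ω => (U ω, Z ω)) :=
        (integral_map (hU.prodMk hZ).aemeasurable hφ.aestronglyMeasurable).symm
    _ = ∫ p, φ p ∂((μ.map U).prod (μ.map Z)) := by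
        rw [hUZ.map_prod_eq_prod_map_map hU.aemeasurable hZ.aemeasurable]
    _ = ∫ u, ∫ z, φ (u, z) ∂(μ.map Z) ∂(μ.map U) := integral_prod φ hint
    _ = ∫ ω, ∫ z, φ (U ω, z) ∂(μ.map Z) ∂μ :=
        integral_map hU.aemeasurable
          (hφ.stronglyMeasurable.integral_prod_right' (ν := μ.map Z)).aestronglyMeasurable
    _ = _ := integral_congr_ae (Eventually.of_forall fun ω =>
        integral_map hZ.aemeasurable (hφ.comp measurable_prodMk_left).aestronglyMeasurable)

theorem integral_comp_of_law {Ω S : Type*} [MeasurableSpace Ω] [Fintype S] [MeasurableSpace S]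
    [MeasurableSingletonClass S] {μ : Measure Ω} [IsProbabilityMeasure μ] {Z : Ω → S}
    (hZ : Measurable Z) {p : S → ℝ} (hp : ∀ s, μ.real {ω | Z ω = s} = p s) (φ : S → ℝ) :
    ∫ ω, φ (Z ω) ∂μ = ∑ s, p s * φ s := by
  rw [← integral_map hZ.aemeasurable (f := φ) (measurable_of_finite φ).aestronglyMeasurable,
    integral_fintype (Integrable.of_finite)]
  refine Finset.sum_congr rfl fun s _ => ?_
  rw [map_measureReal_apply hZ (measurableSet_singleton s), smul_eq_mul, ← hp s]
  rfl

theorem indepFun_of_disjoint {Ω ι E F : Type*} {m : ι → MeasurableSpace Ω}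
    [mΩ : MeasurableSpace Ω] {μ : Measure Ω} [mE : MeasurableSpace E] [mF : MeasurableSpace F]
    (hm : ∀ i, m i ≤ mΩ) (hind : iIndep m μ) {I J : Set ι} (hIJ : Disjoint I J) {U : Ω → E}
    {Z : Ω → F} (hU : Measurable[⨆ i ∈ I, m i] U) (hZ : Measurable[⨆ i ∈ J, m i] Z) :
    IndepFun U Z μ :=
  (IndepFun_iff_Indep U Z μ).2 (indep_of_indep_of_le_left
    (indep_of_indep_of_le_right (indep_iSup_of_disjoint hm hind hIJ) hZ.comap_le) hU.comap_le)

theorem iIndep_mono {Ω ι : Type*} {m m' : ι → MeasurableSpace Ω} [MeasurableSpace Ω]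
    {μ : Measure Ω} (h : iIndep m μ) (hm : ∀ i, m' i ≤ m i) : iIndep m' μ := by
  rw [iIndep_iff] at h ⊢
  exact fun s f hf => h s fun i hi => hm i _ (hf i hi)

theorem measurable_apply_of_finite {E S : Type*} [MeasurableSpace E] [Fintype S]
    [MeasurableSpace S] [MeasurableSingletonClass S] {V : E → S → ℝ} (hV : Measurable V)
    {z : E → S} (hz : Measurable z) : Measurable fun e => V e (z e) := by
  have : Measurable fun p : (S → ℝ) × S => p.1 p.2 :=
    measurable_from_prod_countable_left fun s => measurable_pi_apply s
  exact this.comp (hV.prodMk hz)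

namespace RobustMDP

variable {S A : Type*} [Fintype S] {M : RobustMDP S A} {lo hi σ CM : ℝ}

/-! ### Measurability of the objective and its gradient -/

variable (M) in
theorem measurable_profile : Measurable M.profile := by
  unfold profile
  have : Measurable fun u : ℝ => conj M.f (u / M.lam) := by
    refine Monotone.measurable fun u v h => conj_mono M.f ?_
    have := M.lam_pos
    gcongr
  fun_prop

variable (M) in
theorem measurable_deriv_profile : Measurable (deriv M.profile) := measurable_deriv _

variable (M) in
theorem mem_finiteDom_of_le {u v : ℝ} (h : u ≤ v) (hv : v ∈ M.finiteDom) : u ∈ M.finiteDom := by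
  have := M.lam_pos
  exact ne_top_of_le_ne_top hv (conj_mono M.f (by gcongr))

variable (M) in
-- The finiteness domain is a lower set, hence empty, a half-line or the whole line.
theorem subsingleton_frontier_finiteDom : (frontier M.finiteDom).Subsingleton := by
  have key : ∀ a b, a ∈ frontier M.finiteDom → b ∈ frontier M.finiteDom → ¬ a < b := by
    intro a b ha hb hab
    obtain ⟨d, hd, had⟩ := mem_closure_iff.1 hb.1 (Set.Ioi a) isOpen_Ioi hab
    refine ha.2 (mem_interior.2 ⟨Set.Iio d, fun x hx => ?_, isOpen_Iio, hd⟩)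
    exact M.mem_finiteDom_of_le (le_of_lt hx) had
  exact fun a ha b hb => le_antisymm (not_lt.1 (key b a hb ha)) (not_lt.1 (key a b ha hb))

variable (M) in
/-- The gradient at a fixed point is a measurable function of the value. -/
theorem measurable_gradJ (η : ℝ) : Measurable fun v => M.gradJ η v := by
  classical
  have hset : MeasurableSet {v : ℝ | η - v ∈ M.finiteDom} :=
    (M.convex_finiteDom.ordConnected.measurableSet).preimage (measurable_const.sub measurable_id)
  have h1 : Measurable fun v : ℝ => if η - v ∈ M.finiteDom then deriv M.profile (η - v) else 0 :=
    Measurable.ite hset (M.measurable_deriv_profile.comp (measurable_const.sub measurable_id))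
      measurable_const
  -- Away from the frontier of the finiteness domain the two functions agree, so they differ at no
  -- more than one `v`.
  refine h1.measurable_of_countable_ne (Set.Subsingleton.countable ?_)
  have hsub : ∀ v, (if η - v ∈ M.finiteDom then deriv M.profile (η - v) else 0) ≠ M.gradJ η v →
      η - v ∈ frontier M.finiteDom := by
    intro v hv
    have hcont : ContinuousAt (fun x : ℝ => x - v) η := by fun_prop
    refine ⟨?_, fun hint => hv ?_⟩
    · by_contra hcl
      refine hv ?_
      have hev : ∀ᶠ x in 𝓝 η, x - v ∈ (closure M.finiteDom)ᶜ :=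
        hcont (isClosed_closure.isOpen_compl.mem_nhds hcl)
      rw [if_neg fun hh => hcl (subset_closure hh)]
      -- Where the objective is `⊥`, `toReal` returns `0`; near such an exterior point the function
      -- is constant and its derivative is the value `0` of the other branch.
      have : (fun x => (M.J x v).toReal) =ᶠ[𝓝 η] fun _ => 0 := by
        filter_upwards [hev] with x hx
        rw [M.J_eq_bot fun hh => hx (subset_closure hh), EReal.toReal_bot]
      rw [gradJ, this.deriv_eq, deriv_const]
    · have hev : ∀ᶠ x in 𝓝 η, x - v ∈ M.finiteDom := hcont (mem_interior_iff_mem_nhds.1 hint)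
      rw [if_pos (interior_subset hint)]
      have : (fun x => (M.J x v).toReal) =ᶠ[𝓝 η] fun x => M.profile (x - v) + v := by
        filter_upwards [hev] with x hx
        rw [M.J_eq_of_mem hx, EReal.toReal_coe]
      rw [gradJ, this.deriv_eq, deriv_add_const, deriv_comp_sub_const]
  intro v hv w hw
  have := M.subsingleton_frontier_finiteDom (hsub v hv) (hsub w hw)
  linarith

theorem measurable_dual (M : RobustMDP S A) (s : S) (a : A) (V : S → ℝ) :
    Measurable (M.dual s a V) := by
  unfold dual
  have := M.measurable_profile
  fun_prop

theorem Regular.abs_dual_le (h : M.Regular lo hi σ CM) {V : S → ℝ} (hV : V ∈ M.valueBox) (s : S)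
    (a : A) {η : ℝ} (hη : η ∈ Set.Icc lo hi) : |M.dual s a V η| ≤ CM := by
  unfold dual
  refine (Finset.abs_sum_le_sum_abs _ _).trans ?_
  calc _ ≤ ∑ s', M.P s a s' * CM := by
        refine Finset.sum_le_sum fun s' _ => ?_
        rw [abs_mul, abs_of_nonneg (M.P_nonneg s a s')]
        exact mul_le_mul_of_nonneg_left (h.abs_profile_le hη (hV s')) (M.P_nonneg s a s')
    _ = CM := by rw [← Finset.sum_mul, M.P_sum, one_mul]

/-! ### The inner iterates -/

variable [Nonempty S] [Nonempty A] {α : ℕ → ℝ}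

theorem Regular.inner_mem (h : M.Regular lo hi σ CM) (V : S → ℝ) (x : ℕ → S → A → S) (s : S)
    (a : A) (k : ℕ) : M.inner lo hi α V x s a (k + 1) ∈ Set.Icc lo hi :=
  clamp_mem h.lo_le_hi _

/-- The gradient is replaced by the derivative of the profile from the second step on only: the
starting point `0` need not lie in `Θ`, and nothing is known about the gradient there. -/
theorem Regular.inner_succ (h : M.Regular lo hi σ CM) {V : S → ℝ} (hV : V ∈ M.valueBox)
    (x : ℕ → S → A → S) (s : S) (a : A) (k : ℕ) :
    M.inner lo hi α V x s a (k + 2) = clamp lo hi (M.inner lo hi α V x s a (k + 1) +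
      α (k + 1) * deriv M.profile (M.inner lo hi α V x s a (k + 1) - V (x (k + 1) s a))) := by
  rw [inner, h.gradJ_eq (h.inner_mem V x s a k) (hV _)]

/-- Only the first `k` draws are required to be measurable, so that the lemma can be applied to the
σ-algebra of the past and gives adaptedness. The first step needs `measurable_gradJ`, since `0` may
lie outside `Θ`. -/
theorem Regular.measurable_inner [MeasurableSpace S] [MeasurableSingletonClass S] {E : Type*}
    [MeasurableSpace E] (h : M.Regular lo hi σ CM) {V : E → S → ℝ} (hV : Measurable V)
    (hbox : ∀ e, V e ∈ M.valueBox) {x : ℕ → E → S → A → S} (s : S) (a : A) (k : ℕ)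
    (hx : ∀ i < k, Measurable (x i)) :
    Measurable fun e => M.inner lo hi α (V e) (fun k => x k e) s a k := by
  have hVx : ∀ i < k, Measurable fun e => V e (x i e s a) := fun i hi =>
    measurable_apply_of_finite hV ((measurable_pi_apply a).comp ((measurable_pi_apply s).comp
      (hx i hi)))
  clear hx
  rcases k with _ | k
  · exact measurable_const
  induction k with
  | zero =>
    simp only [inner]
    exact (continuous_clamp lo hi).measurable.comp (measurable_const.add
      (measurable_const.mul ((M.measurable_gradJ 0).comp (hVx 0 one_pos))))
  | succ k ih =>
    simp only [h.inner_succ (hbox _)]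
    have h1 := ih fun i hi => hVx i (by omega)
    exact (continuous_clamp lo hi).measurable.comp (h1.add (measurable_const.mul
      (M.measurable_deriv_profile.comp (h1.sub (hVx (k + 1) (by omega))))))

section Expectation

variable [MeasurableSpace S] [MeasurableSingletonClass S] {Ω : Type*} [mΩ : MeasurableSpace Ω]
  {μ : Measure Ω} [IsProbabilityMeasure μ] {X : ℕ → Ω → S → A → S}

/-- The regret of one expected inner step against a point `u` determined by earlier draws. -/
theorem Regular.integral_inner_step (h : M.Regular lo hi σ CM) {V : S → ℝ}
    (hV : V ∈ M.valueBox) (s : S) (a : A) (hX : ∀ k, Measurable (X k))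
    (hlaw : ∀ k s', μ.real {ω | X k ω s a = s'} = M.P s a s')
    (hind : iIndep (fun k => MeasurableSpace.comap (X k) inferInstance) μ) (t : ℕ)
    (hα : 0 ≤ α (t + 1)) (hαL : α (t + 1) * (1 / (M.lam * σ)) ≤ 1) {u : Ω → ℝ}
    (hu : Measurable[⨆ i ∈ Set.Iio (t + 1), MeasurableSpace.comap (X i) inferInstance] u)
    (hu' : ∀ ω, u ω ∈ Set.Icc lo hi) :
    α (t + 1) * (∫ ω, M.dual s a V (u ω) ∂μ
      - ∫ ω, M.dual s a V (M.inner lo hi α V (fun k => X k ω) s a (t + 2)) ∂μ) ≤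
    (∫ ω, (M.inner lo hi α V (fun k => X k ω) s a (t + 1) - u ω) ^ 2 ∂μ
      - ∫ ω, (M.inner lo hi α V (fun k => X k ω) s a (t + 2) - u ω) ^ 2 ∂μ) / 2
      + α (t + 1) ^ 2 * (M.Cg lo hi σ / 2) ^ 2 := by
  have hle : ∀ i, MeasurableSpace.comap (X i) inferInstance ≤ mΩ := fun i => (hX i).comap_le
  have hsup : (⨆ i ∈ Set.Iio (t + 1), MeasurableSpace.comap (X i) inferInstance) ≤ mΩ :=
    iSup₂_le fun i _ => hle i
  set w : ℕ → Ω → ℝ := fun k ω => M.inner lo hi α V (fun k => X k ω) s a k with hw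
  have hwm : ∀ k, Measurable (w k) := fun k =>
    h.measurable_inner (V := fun _ => V) measurable_const (fun _ => hV) s a k fun i _ => hX i
  have hwm' : Measurable[⨆ i ∈ Set.Iio (t + 1), MeasurableSpace.comap (X i) inferInstance]
      (w (t + 1)) := by
    refine @Regular.measurable_inner S A _ M lo hi σ CM _ _ α _ _ Ω
      (⨆ i ∈ Set.Iio (t + 1), MeasurableSpace.comap (X i) inferInstance) h (fun _ => V)
      (@measurable_const _ _ _ (_) _) (fun _ => hV) X s a (t + 1) fun i hi => ?_
    exact (comap_measurable (X i)).mono (le_iSup₂_of_le i hi le_rfl) le_rfl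
  have hum : Measurable u := hu.mono hsup le_rfl
  have hmem : ∀ k ω, w (k + 1) ω ∈ Set.Icc lo hi := fun k ω => h.inner_mem V _ s a k
  set Z : Ω → S := fun ω => X (t + 1) ω s a with hZ
  have hZm : Measurable Z :=
    (measurable_pi_apply a).comp ((measurable_pi_apply s).comp (hX (t + 1)))
  have hZm' : Measurable[⨆ i ∈ ({t + 1} : Set ℕ), MeasurableSpace.comap (X i) inferInstance] Z :=
    (measurable_pi_apply a).comp ((measurable_pi_apply s).comp
      ((comap_measurable (X (t + 1))).mono (le_iSup₂_of_le (t + 1) rfl le_rfl) le_rfl))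
  -- The iterate `w (t + 1)` uses the draws `0, …, t` and is updated with the draw `t + 1`.
  have hUZ : IndepFun (fun ω => (w (t + 1) ω, u ω)) Z μ :=
    indepFun_of_disjoint hle hind (I := Set.Iio (t + 1)) (J := {t + 1}) (by simp)
      (hwm'.prodMk hu) hZm'
  set stp : ℝ × S → ℝ := fun p =>
    clamp lo hi (p.1 + α (t + 1) * deriv M.profile (p.1 - V p.2)) with hstp
  have hstpm : Measurable stp :=
    (continuous_clamp lo hi).measurable.comp (measurable_fst.add (measurable_const.mul
      (M.measurable_deriv_profile.comp (measurable_fst.sub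
        ((measurable_of_finite V).comp measurable_snd)))))
  have hstpmem : ∀ p, stp p ∈ Set.Icc lo hi := fun p => clamp_mem h.lo_le_hi _
  set φ : (ℝ × ℝ) × S → ℝ := fun p =>
    ((p.1.1 - p.1.2) ^ 2 - (stp (p.1.1, p.2) - p.1.2) ^ 2) / 2
        + α (t + 1) ^ 2 * (M.Cg lo hi σ / 2) ^ 2
        - α (t + 1) * (M.dual s a V p.1.2 - M.dual s a V (stp (p.1.1, p.2))) with hφ
  have hdm := M.measurable_dual s a V
  have hφm : Measurable φ := by
    have h1 : Measurable fun p : (ℝ × ℝ) × S => stp (p.1.1, p.2) := by fun_prop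
    have h2 := hdm.comp h1
    simp only [Function.comp_def] at h2
    fun_prop
  have hsq : ∀ x y, x ∈ Set.Icc lo hi → y ∈ Set.Icc lo hi → (x - y) ^ 2 ≤ (hi - lo) ^ 2 :=
    fun x y hx hy => sq_le_sq' (by linarith [hx.1, hy.2]) (by linarith [hx.2, hy.1])
  have hφb : ∀ ω ω', |φ ((w (t + 1) ω, u ω), Z ω')| ≤
      (hi - lo) ^ 2 + α (t + 1) ^ 2 * (M.Cg lo hi σ / 2) ^ 2 + α (t + 1) * (2 * CM) := by
    intro ω ω'
    have b1 := hsq _ _ (hmem t ω) (hu' ω)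
    have b2 := hsq _ _ (hstpmem (w (t + 1) ω, Z ω')) (hu' ω)
    have b3 := abs_le.1 (h.abs_dual_le hV s a (hu' ω))
    have b4 := abs_le.1 (h.abs_dual_le hV s a (hstpmem (w (t + 1) ω, Z ω')))
    have b5 : |M.dual s a V (u ω) - M.dual s a V (stp (w (t + 1) ω, Z ω'))| ≤ 2 * CM :=
      abs_le.2 ⟨by linarith, by linarith⟩
    have b6 := abs_le.1 b5
    have b7 := mul_le_mul_of_nonneg_left b6.1 hα
    have b8 := mul_le_mul_of_nonneg_left b6.2 hα
    have b9 := mul_nonneg (sq_nonneg (α (t + 1))) (sq_nonneg (M.Cg lo hi σ / 2))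
    have b10 := sq_nonneg (w (t + 1) ω - u ω)
    have b11 := sq_nonneg (stp (w (t + 1) ω, Z ω') - u ω)
    simp only [hφ]
    rw [abs_le]
    constructor <;> linarith
  have hpos : 0 ≤ ∫ ω, φ ((w (t + 1) ω, u ω), Z ω) ∂μ := by
    rw [integral_comp_of_indepFun ((hwm _).prodMk hum) hZm hUZ hφm hφb]
    refine integral_nonneg fun ω => ?_
    have := integral_comp_of_law hZm (hlaw (t + 1)) fun s' => φ ((w (t + 1) ω, u ω), s')
    simp only [Pi.zero_apply]
    rw [this]
    exact h.sum_projected_step hV s a (hmem t ω) (hu' ω) hα hαL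
  have hnext : ∀ ω, stp (w (t + 1) ω, Z ω) = w (t + 2) ω := fun ω =>
    (h.inner_succ hV _ s a t).symm
  have i1 : ∀ k, Integrable (fun ω => (w (k + 1) ω - u ω) ^ 2) μ := fun k =>
    Integrable.of_bound (((hwm _).sub hum).pow_const 2).aestronglyMeasurable ((hi - lo) ^ 2)
      (Eventually.of_forall fun ω => by
        rw [Real.norm_of_nonneg (sq_nonneg _)]; exact hsq _ _ (hmem k ω) (hu' ω))
  have i2 : Integrable (fun ω => M.dual s a V (u ω)) μ :=
    Integrable.of_bound (hdm.comp hum).aestronglyMeasurable CM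
      (Eventually.of_forall fun ω => h.abs_dual_le hV s a (hu' ω))
  have i3 : Integrable (fun ω => M.dual s a V (w (t + 2) ω)) μ :=
    Integrable.of_bound (hdm.comp (hwm _)).aestronglyMeasurable CM
      (Eventually.of_forall fun ω => h.abs_dual_le hV s a (hmem (t + 1) ω))
  simp only [hφ, hnext] at hpos
  have j1 := i1 t
  have j2 := i1 (t + 1)
  have q1 : Integrable (fun ω => (w (t + 1) ω - u ω) ^ 2 - (w (t + 2) ω - u ω) ^ 2) μ := j1.sub j2
  have q2 : Integrable
      (fun ω => ((w (t + 1) ω - u ω) ^ 2 - (w (t + 2) ω - u ω) ^ 2) / 2) μ := q1.div_const 2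
  have q3 : Integrable (fun ω => ((w (t + 1) ω - u ω) ^ 2 - (w (t + 2) ω - u ω) ^ 2) / 2
      + α (t + 1) ^ 2 * (M.Cg lo hi σ / 2) ^ 2) μ := q2.add (integrable_const _)
  have q4 : Integrable (fun ω => M.dual s a V (u ω) - M.dual s a V (w (t + 2) ω)) μ := i2.sub i3
  rw [integral_sub q3 (q4.const_mul _), integral_add q2 (integrable_const _),
      integral_div, integral_const_mul (α (t + 1)), integral_sub j1 j2, integral_sub i2 i3] at hpos
  simp only [integral_const, probReal_univ, one_smul] at hpos
  linarith

/-- The last iterate of the inner loop is optimal up to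
`diam(Θ) C_g (2 + log T') / √T'` in expectation. -/
theorem Regular.robustExp_sub_integral_inner_le (h : M.Regular lo hi σ CM)
    (hα : ∀ k : ℕ, 1 ≤ k → α k = (hi - lo) / (M.Cg lo hi σ * √(k : ℝ))) {V : S → ℝ}
    (hV : V ∈ M.valueBox) (s : S) (a : A) (hX : ∀ k, Measurable (X k))
    (hlaw : ∀ k s', μ.real {ω | X k ω s a = s'} = M.P s a s')
    (hind : iIndep (fun k => MeasurableSpace.comap (X k) inferInstance) μ) {T' : ℕ}
    (hT' : 1 ≤ T') :
    M.robustExp s a V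
      - ∫ ω, M.dual s a V (M.inner lo hi α V (fun k => X k ω) s a T') ∂μ ≤
    (hi - lo) * M.Cg lo hi σ * ((2 + Real.log T') / √(T' : ℝ)) := by
  have hlh := h.lo_le_hi
  have hCg := h.Cg_pos
  set w : ℕ → Ω → ℝ := fun k ω => M.inner lo hi α V (fun k => X k ω) s a k with hw
  have hwm : ∀ k, Measurable (w k) := fun k =>
    h.measurable_inner (V := fun _ => V) measurable_const (fun _ => hV) s a k fun i _ => hX i
  have hmem : ∀ k ω, w (k + 1) ω ∈ Set.Icc lo hi := fun k ω => h.inner_mem V _ s a k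
  have hdm := M.measurable_dual s a V
  have hint : ∀ k, Integrable (fun ω => M.dual s a V (w (k + 1) ω)) μ := fun k =>
    Integrable.of_bound (hdm.comp (hwm _)).aestronglyMeasurable CM
      (Eventually.of_forall fun ω => h.abs_dual_le hV s a (hmem k ω))
  -- The index is shifted by one: `e 0` belongs to `w 1`, the first iterate known to lie in `Θ`.
  set e : ℕ → ℝ := fun k => M.robustExp s a V - ∫ ω, M.dual s a V (w (k + 1) ω) ∂μ with he
  have hetriv : ∀ k, e k ≤ (hi - lo) * M.Cg lo hi σ := fun k => by
    have : M.robustExp s a V - (hi - lo) * M.Cg lo hi σ ≤ ∫ ω, M.dual s a V (w (k + 1) ω) ∂μ := by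
      have := integral_mono (integrable_const (M.robustExp s a V - (hi - lo) * M.Cg lo hi σ))
        (hint k) fun ω => by
          have := h.robustExp_sub_dual_le hV s a (hmem k ω)
          simp only; linarith
      simpa using this
    simp only [he]; linarith
  obtain ⟨N, rfl⟩ : ∃ N, T' = N + 1 := ⟨T' - 1, by omega⟩
  change e N ≤ _
  -- For `T' = 1` no regular step has been made, and the trivial bound `diam(Θ) C_g` suffices. A
  -- one-point `Θ` is separated next because then the scale `c` of the step sizes is zero.
  rcases Nat.eq_zero_or_pos N with rfl | hN
  · refine (hetriv 0).trans ?_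
    have : 0 ≤ (hi - lo) * M.Cg lo hi σ := mul_nonneg (by linarith) hCg.le
    norm_num
    linarith
  rcases hlh.eq_or_lt with hD | hD
  · refine (hetriv N).trans (le_of_eq ?_)
    rw [hD]; simp
  have hD' : 0 < hi - lo := sub_pos.2 hD
  set c := (hi - lo) / M.Cg lo hi σ with hc
  have hc0 : 0 < c := div_pos hD' hCg
  have hαc : ∀ t : ℕ, α (t + 1) = c / √((t : ℝ) + 1) := fun t => by
    rw [hα (t + 1) (by omega), hc]; push_cast; rw [div_div]
  -- This quantity equals `diam Θ / (diam Θ + vmax)`, so every step size is below the inverse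
  -- smoothness constant.
  have hcL : c * (1 / (M.lam * σ)) ≤ 1 := by
    have hl := mul_pos M.lam_pos h.sigma_pos
    rw [hc, Cg, div_div_eq_mul_div, div_mul_div_comm, mul_one, div_le_one
      (mul_pos (by linarith [M.vmax_pos]) hl)]
    exact mul_le_mul_of_nonneg_right (by linarith [M.vmax_pos]) hl.le
  have hsq : ∀ x y, x ∈ Set.Icc lo hi → y ∈ Set.Icc lo hi → (x - y) ^ 2 ≤ (hi - lo) ^ 2 :=
    fun x y hx hy => sq_le_sq' (by linarith [hx.1, hy.2]) (by linarith [hx.2, hy.1])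
  have hstep : ∀ t (u : Ω → ℝ),
      Measurable[⨆ i ∈ Set.Iio (t + 1), MeasurableSpace.comap (X i) inferInstance] u →
      (∀ ω, u ω ∈ Set.Icc lo hi) →
      ∫ ω, M.dual s a V (u ω) ∂μ - ∫ ω, M.dual s a V (w (t + 2) ω) ∂μ ≤
        √((t : ℝ) + 1) / (2 * c) * (∫ ω, (w (t + 1) ω - u ω) ^ 2 ∂μ
          - ∫ ω, (w (t + 2) ω - u ω) ^ 2 ∂μ)
          + c * (M.Cg lo hi σ / 2) ^ 2 * (1 / √((t : ℝ) + 1)) := by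
    intro t u hu hu'
    have hs : 1 ≤ √((t : ℝ) + 1) := Real.one_le_sqrt.2 (by linarith [Nat.cast_nonneg (α := ℝ) t])
    have hs0 : 0 < √((t : ℝ) + 1) := by linarith
    have h1 : α (t + 1) * (1 / (M.lam * σ)) ≤ 1 := by
      refine le_trans (mul_le_mul_of_nonneg_right ?_ h.lip_pos.le) hcL
      rw [hαc]
      exact div_le_self hc0.le hs
    have := h.integral_inner_step (α := α) hV s a hX hlaw hind t
      (by rw [hαc]; positivity) h1 hu hu'
    rw [hαc] at this
    change c / √((t : ℝ) + 1) * (_ - ∫ ω, M.dual s a V (w (t + 2) ω) ∂μ) ≤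
      (∫ ω, (w (t + 1) ω - u ω) ^ 2 ∂μ - ∫ ω, (w (t + 2) ω - u ω) ^ 2 ∂μ) / 2 + _ at this
    have h2 := mul_le_mul_of_nonneg_left this (show 0 ≤ √((t : ℝ) + 1) / c by positivity)
    refine (le_of_eq ?_).trans (h2.trans (le_of_eq ?_))
    · field_simp
    · field_simp
  obtain ⟨ηs, hηs, hopt⟩ := h.exists_dual_eq hV s a
  have hd : ∀ (u : Ω → ℝ), (∀ ω, u ω ∈ Set.Icc lo hi) → ∀ t,
      0 ≤ ∫ ω, (w (t + 1) ω - u ω) ^ 2 ∂μ ∧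
        ∫ ω, (w (t + 1) ω - u ω) ^ 2 ∂μ ≤ (hi - lo) ^ 2 := by
    intro u hu t
    refine ⟨integral_nonneg fun ω => sq_nonneg _, ?_⟩
    have := integral_mono_of_nonneg (μ := μ) (Eventually.of_forall fun ω => sq_nonneg _)
      (integrable_const ((hi - lo) ^ 2)) (Eventually.of_forall fun ω =>
        hsq _ _ (hmem t ω) (hu ω))
    simpa using this
  have hlast := last_iterate_le hN (e := e)
    (ds := fun t => ∫ ω, (w (t + 1) ω - ηs) ^ 2 ∂μ)
    (d := fun j t => ∫ ω, (w (t + 1) ω - w (j + 1) ω) ^ 2 ∂μ)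
    (c := c) (D2 := (hi - lo) ^ 2) (s2 := (M.Cg lo hi σ / 2) ^ 2) hc0 (sq_nonneg _)
    (fun j => hd _ (hmem j)) (fun j => by simp) (hd _ fun _ => hηs)
    (fun t j hj => by
      have hm : Measurable[⨆ i ∈ Set.Iio (t + 1), MeasurableSpace.comap (X i) inferInstance]
          (w (j + 1)) := by
        refine @Regular.measurable_inner S A _ M lo hi σ CM _ _ α _ _ Ω
          (⨆ i ∈ Set.Iio (t + 1), MeasurableSpace.comap (X i) inferInstance) h (fun _ => V)
          (@measurable_const _ _ _ (_) _) (fun _ => hV) X s a (j + 1) fun i hi => ?_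
        exact (comap_measurable (X i)).mono
          (le_iSup₂_of_le i (show i < t + 1 by omega) le_rfl) le_rfl
      have := hstep t _ hm (hmem j)
      simp only [he]
      linarith)
    (fun t => by
      have := hstep t (fun _ => ηs) (@measurable_const _ _ _ (_) _) fun _ => hηs
      rw [hopt] at this
      simpa only [integral_const, probReal_univ, one_smul, he] using this)
  refine hlast.trans ?_
  -- The choice `c = diam Θ / C_g` makes the two summands equal.
  have hK : (hi - lo) ^ 2 / (2 * c) + 2 * c * (M.Cg lo hi σ / 2) ^ 2 =
      (hi - lo) * M.Cg lo hi σ := by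
    rw [hc]; field_simp; ring
  rw [hK]
  exact mul_le_mul_of_nonneg_left (log_div_sqrt_succ_le hN) (mul_pos hD' hCg).le

end Expectation

end RobustMDP

/-- The expected sup-norm of a finite family of sub-Gaussian variables. -/
theorem integral_norm_le_of_mgf_le {S A Ω : Type*} [Fintype S] [Fintype A] [Nonempty S]
    [Nonempty A] [MeasurableSpace Ω] {μ : Measure Ω} [IsProbabilityMeasure μ]
    {W : Ω → S → A → ℝ} (hW : Measurable W) {K : ℝ} (hK : ∀ ω, ‖W ω‖ ≤ K) {κ : ℝ} (hκ : 0 < κ)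
    (hmgf : ∀ s a θ, ∫ ω, Real.exp (θ * W ω s a) ∂μ ≤ Real.exp (θ ^ 2 * κ / 2)) :
    ∫ ω, ‖W ω‖ ∂μ ≤ √(2 * κ * Real.log (2 * Fintype.card S * Fintype.card A)) := by
  set n : ℝ := Fintype.card S * Fintype.card A with hn
  have hn1 : 1 ≤ n := by
    rw [hn]; exact_mod_cast Nat.mul_pos Fintype.card_pos Fintype.card_pos
  rw [mul_assoc 2 (Fintype.card S : ℝ), ← hn]
  set l := Real.log (2 * n) with hl
  have hl0 : 0 < l := Real.log_pos (by linarith)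
  -- This `θ` minimizes `l / θ + θ κ / 2`, the bound on the expectation given by exponential
  -- moments.
  set θ := √(2 * l / κ) with hθ
  have hθ0 : 0 < θ := Real.sqrt_pos.2 (by positivity)
  have hWm : ∀ s a, Measurable fun ω => W ω s a := fun s a =>
    (measurable_pi_apply a).comp ((measurable_pi_apply s).comp hW)
  have hWb : ∀ ω s a, |W ω s a| ≤ K := fun ω s a =>
    ((norm_le_pi_norm (W ω s) a).trans (norm_le_pi_norm (W ω) s)).trans (hK ω)
  have hint : ∀ s a (τ : ℝ), Integrable (fun ω => Real.exp (τ * W ω s a)) μ := fun s a τ =>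
    Integrable.of_bound (by have := hWm s a; fun_prop) (Real.exp (|τ| * K))
      (Eventually.of_forall fun ω => by
        rw [Real.norm_of_nonneg (Real.exp_pos _).le, Real.exp_le_exp]
        refine (le_abs_self _).trans ?_
        rw [abs_mul]
        exact mul_le_mul_of_nonneg_left (hWb ω s a) (abs_nonneg _))
  set expSum : Ω → ℝ := fun ω => ∑ s, ∑ a, (Real.exp (θ * W ω s a) + Real.exp (-θ * W ω s a)) with hexpSum
  have hexpSum_int : Integrable expSum μ :=
    integrable_finsetSum _ fun s _ => integrable_finsetSum _ fun a _ => (hint s a θ).add (hint s a _)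
  have hpair : ∀ s a,
      Integrable (fun ω => Real.exp (θ * W ω s a) + Real.exp (-θ * W ω s a)) μ := fun s a =>
    (hint s a θ).add (hint s a _)
  have hterm : ∀ ω s a, Real.exp (θ * |W ω s a|) ≤ expSum ω := by
    intro ω s a
    have h1 : Real.exp (θ * |W ω s a|) ≤ Real.exp (θ * W ω s a) + Real.exp (-θ * W ω s a) := by
      rcases abs_choice (W ω s a) with h | h <;> rw [h]
      · linarith [Real.exp_pos (-θ * W ω s a)]
      · rw [mul_neg, ← neg_mul]; linarith [Real.exp_pos (θ * W ω s a)]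
    have hp : ∀ s a, 0 ≤ Real.exp (θ * W ω s a) + Real.exp (-θ * W ω s a) := fun s a => by positivity
    refine h1.trans (le_trans ?_ (Finset.single_le_sum (f := fun s => ∑ a, _)
      (fun s _ => Finset.sum_nonneg fun a _ => hp s a) (Finset.mem_univ s)))
    exact Finset.single_le_sum (f := fun a => Real.exp (θ * W ω s a) + Real.exp (-θ * W ω s a))
      (fun a _ => hp s a) (Finset.mem_univ a)
  have hpt : ∀ ω, Real.exp (θ * ‖W ω‖) ≤ expSum ω := by
    intro ω
    obtain ⟨s₀⟩ := ‹Nonempty S›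
    obtain ⟨a₀⟩ := ‹Nonempty A›
    have hpos : 0 < expSum ω := (Real.exp_pos _).trans_le (hterm ω s₀ a₀)
    have hle : ∀ s a, |W ω s a| ≤ Real.log (expSum ω) / θ := fun s a => by
      rw [le_div_iff₀ hθ0, mul_comm, Real.le_log_iff_exp_le hpos]
      exact hterm ω s a
    have : ‖W ω‖ ≤ Real.log (expSum ω) / θ :=
      (RobustMDP.norm_pi_pi_le ((abs_nonneg _).trans (hle s₀ a₀))).2 hle
    rwa [le_div_iff₀ hθ0, mul_comm, Real.le_log_iff_exp_le hpos] at this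
  have hnint : Integrable (fun ω => ‖W ω‖) μ :=
    Integrable.of_bound hW.norm.aestronglyMeasurable K (Eventually.of_forall fun ω => by
      rw [norm_norm]; exact hK ω)
  set E := ∫ ω, ‖W ω‖ ∂μ with hE
  -- Jensen's inequality through the tangent line of `exp` at `θ * E`.
  have hjensen : Real.exp (θ * E) ≤ ∫ ω, expSum ω ∂μ := by
    have h1 : ∀ ω, Real.exp (θ * E) * (1 - θ * E) + Real.exp (θ * E) * θ * ‖W ω‖ ≤ expSum ω := by
      intro ω
      refine le_trans ?_ (hpt ω)
      have h2 := Real.add_one_le_exp (θ * ‖W ω‖ - θ * E)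
      have h3 := mul_le_mul_of_nonneg_left h2 (Real.exp_pos (θ * E)).le
      rw [← Real.exp_add, add_sub_cancel] at h3
      linarith
    have q : Integrable
        (fun ω => Real.exp (θ * E) * (1 - θ * E) + Real.exp (θ * E) * θ * ‖W ω‖) μ :=
      (integrable_const _).add (hnint.const_mul _)
    have h2 := integral_mono q hexpSum_int h1
    rw [integral_add (integrable_const _) (hnint.const_mul _),
      integral_const_mul (Real.exp (θ * E) * θ), ← hE] at h2
    simp only [integral_const, probReal_univ, one_smul] at h2
    linarith
  have hsum : ∫ ω, expSum ω ∂μ ≤ Real.exp (l + θ ^ 2 * κ / 2) := by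
    simp only [hexpSum]
    rw [integral_finsetSum _ fun s _ => integrable_finsetSum _ fun a _ => hpair s a]
    calc _ ≤ ∑ _s : S, ∑ _a : A, 2 * Real.exp (θ ^ 2 * κ / 2) := by
          refine Finset.sum_le_sum fun s _ => ?_
          rw [integral_finsetSum _ fun a _ => hpair s a]
          refine Finset.sum_le_sum fun a _ => ?_
          rw [integral_add (hint s a θ) (hint s a _)]
          have h1 := hmgf s a θ
          have h2 := hmgf s a (-θ)
          rw [neg_sq] at h2
          linarith
      _ = _ := by
          rw [Real.exp_add, hl, Real.exp_log (by linarith)]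
          simp only [Finset.sum_const, Finset.card_univ, nsmul_eq_mul, hn]
          ring
  have hfin := Real.exp_le_exp.1 (hjensen.trans hsum)
  have hθ2 : θ ^ 2 = 2 * l / κ := Real.sq_sqrt (by positivity)
  have h1 : θ * E ≤ 2 * l := by
    rw [hθ2] at hfin
    refine hfin.trans (le_of_eq ?_)
    field_simp; ring
  refine Real.le_sqrt_of_sq_le ?_
  have hE0 : 0 ≤ E := integral_nonneg fun ω => norm_nonneg _
  have h2 : (θ * E) ^ 2 ≤ (2 * l) ^ 2 := pow_le_pow_left₀ (by positivity) h1 2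
  rw [mul_pow, hθ2, div_mul_eq_mul_div, div_le_iff₀ hκ] at h2
  have h3 : 2 * l * E ^ 2 ≤ 2 * l * (2 * κ * l) := by linarith
  exact le_of_mul_le_mul_left h3 (by positivity)

theorem measurable_entry {E S A : Type*} [MeasurableSpace E] (s : S) (a : A) {f : E → S → A → ℝ}
    (hf : Measurable f) : Measurable fun e => f e s a :=
  (measurable_pi_apply a).comp ((measurable_pi_apply s).comp hf)

/-! ### The outer recursion: update targets, step sizes and noise -/

namespace RobustMDP

variable {S A : Type*} [Fintype S] [Fintype A] [Nonempty S] [Nonempty A] {M : RobustMDP S A}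
  {lo hi σ CM : ℝ} {α : ℕ → ℝ}

/-- The projected greedy value function of `Q`. -/
def greedy (M : RobustMDP S A) (Q : S → A → ℝ) (s : S) : ℝ := clamp 0 M.vmax (maxQ Q s)

/-- The update target of the algorithm. -/
def target (M : RobustMDP S A) (lo hi : ℝ) (α : ℕ → ℝ) (T' : ℕ) (Q : S → A → ℝ)
    (x : ℕ → S → A → S) (y : S → A → S) (r : S → A → ℝ) (s : S) (a : A) : ℝ :=
  r s a + M.γ * (M.J (M.inner lo hi α (M.greedy Q) x s a T') (M.greedy Q (y s a))).toReal

theorem greedy_mem (M : RobustMDP S A) (Q : S → A → ℝ) : M.greedy Q ∈ M.valueBox :=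
  fun _ => clamp_mem M.vmax_pos.le _

theorem measurable_greedy (M : RobustMDP S A) : Measurable M.greedy := by
  refine measurable_pi_lambda _ fun s => (continuous_clamp 0 M.vmax).measurable.comp ?_
  have : LipschitzWith 1 fun Q : S → A → ℝ => maxQ Q s := LipschitzWith.of_dist_le_mul fun Q Q' => by
    rw [Real.dist_eq, dist_eq_norm, NNReal.coe_one, one_mul]
    exact abs_maxQ_sub_le s
  exact this.continuous.measurable

theorem abs_greedy_sub_le (M : RobustMDP S A) {Q Q' : S → A → ℝ}
    (hQ' : ∀ s a, 0 ≤ Q' s a ∧ Q' s a ≤ M.vmax) (s : S) :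
    |M.greedy Q s - maxQ Q' s| ≤ ‖Q - Q'‖ := by
  rw [← clamp_eq_self (lo := 0) (hi := M.vmax) (x := maxQ Q' s) (maxQ_mem hQ' s)]
  exact (abs_clamp_sub_le _ _ _ _).trans (abs_maxQ_sub_le s)

theorem Regular.target_eq (h : M.Regular lo hi σ CM) {T' : ℕ} (hT' : 1 ≤ T') (Q : S → A → ℝ)
    (x : ℕ → S → A → S) (y : S → A → S) (r : S → A → ℝ) (s : S) (a : A) :
    M.target lo hi α T' Q x y r s a =
      r s a + M.γ * (M.profile (M.inner lo hi α (M.greedy Q) x s a T' - M.greedy Q (y s a))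
        + M.greedy Q (y s a)) := by
  obtain ⟨k, rfl⟩ : ∃ k, T' = k + 1 := ⟨T' - 1, by omega⟩
  rw [target, h.J_toReal (h.inner_mem _ x s a k) (M.greedy_mem Q _)]

theorem Regular.measurable_target [MeasurableSpace S] [MeasurableSingletonClass S] {E : Type*}
    [MeasurableSpace E] (h : M.Regular lo hi σ CM) {T' : ℕ} (hT' : 1 ≤ T') {Q : E → S → A → ℝ}
    {x : ℕ → E → S → A → S} {y : E → S → A → S} {r : E → S → A → ℝ} (hQ : Measurable Q)
    (hx : ∀ k, Measurable (x k)) (hy : Measurable y) (hr : Measurable r) :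
    Measurable fun e => M.target lo hi α T' (Q e) (fun k => x k e) (y e) (r e) := by
  refine measurable_pi_lambda _ fun s => measurable_pi_lambda _ fun a => ?_
  simp only [h.target_eq hT']
  have h1 : Measurable fun e => M.greedy (Q e) := M.measurable_greedy.comp hQ
  have h2 := h.measurable_inner (α := α) h1 (fun e => M.greedy_mem (Q e)) s a T' fun i _ => hx i
  have h3 : Measurable fun e => M.greedy (Q e) (y e s a) :=
    measurable_apply_of_finite h1 ((measurable_pi_apply a).comp ((measurable_pi_apply s).comp hy))
  have h4 : Measurable fun e => r e s a :=
    measurable_entry s a hr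
  exact h4.add (((M.measurable_profile.comp (h2.sub h3)).add h3).const_mul _)

theorem Regular.target_mem (h : M.Regular lo hi σ CM) {T' : ℕ} (hT' : 1 ≤ T') (Q : S → A → ℝ)
    (x : ℕ → S → A → S) (y : S → A → S) {r : S → A → ℝ} {s : S} {a : A}
    (hr : |r s a - M.R s a| ≤ 1) :
    M.target lo hi α T' Q x y r s a ∈
      Set.Icc (M.R s a - (1 + M.γ * CM)) (M.R s a + (1 + M.γ * CM)) := by
  rw [h.target_eq hT']
  obtain ⟨k, rfl⟩ : ∃ k, T' = k + 1 := ⟨T' - 1, by omega⟩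
  have h1 := abs_le.1 (h.abs_profile_le (h.inner_mem (α := α) (M.greedy Q) x s a k)
    (M.greedy_mem Q (y s a)))
  have h2 := abs_le.1 hr
  have h3 := mul_le_mul_of_nonneg_left h1.1 M.γ_nonneg
  have h4 := mul_le_mul_of_nonneg_left h1.2 M.γ_nonneg
  constructor <;> linarith

theorem Regular.scale_pos (h : M.Regular lo hi σ CM) : 0 < 1 + M.γ * CM := by
  have := mul_nonneg M.γ_nonneg h.CM_pos.le
  linarith

theorem Regular.CN_pos (h : M.Regular lo hi σ CM) : 0 < M.CN CM := by
  have h1 := h.scale_pos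
  have h2 : 0 < Real.log (2 * Fintype.card S * Fintype.card A) := by
    refine Real.log_pos ?_
    have : 1 ≤ Fintype.card S * Fintype.card A := Nat.mul_pos Fintype.card_pos Fintype.card_pos
    have : (1 : ℝ) ≤ Fintype.card S * Fintype.card A := by exact_mod_cast this
    rw [mul_assoc]; linarith
  unfold CN
  positivity

/-! ### The step sizes -/

/-- The inverse `1 + (1 - γ) t` of the step size `β_{t-1}`. -/
def rho (M : RobustMDP S A) (t : ℕ) : ℝ := 1 + (1 - M.γ) * t

theorem rho_ge_one (M : RobustMDP S A) (t : ℕ) : 1 ≤ M.rho t := by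
  have := mul_nonneg M.one_sub_gamma_pos.le (Nat.cast_nonneg (α := ℝ) t)
  unfold rho; linarith

theorem rho_pos (M : RobustMDP S A) (t : ℕ) : 0 < M.rho t := one_pos.trans_le (M.rho_ge_one t)

theorem rho_succ (M : RobustMDP S A) (t : ℕ) : M.rho (t + 1) = M.rho t + (1 - M.γ) := by
  unfold rho; push_cast; ring

theorem β_eq (M : RobustMDP S A) (t : ℕ) : M.β t = 1 / M.rho (t + 1) := by
  unfold β rho; push_cast; rfl

theorem β_pos (M : RobustMDP S A) (t : ℕ) : 0 < M.β t := by
  rw [β_eq]; exact one_div_pos.2 (M.rho_pos _)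

theorem β_le_one (M : RobustMDP S A) (t : ℕ) : M.β t ≤ 1 := by
  rw [β_eq, div_le_one (M.rho_pos _)]; exact M.rho_ge_one _

/-- Since `γ ≥ 0`, `ρ_{t+1} - 1 ≤ ρ_t`, that is `1 - β_t ≤ ρ_t β_t`. The left side is then at most
`(1 - β_t) β_t + β_t² = β_t`. -/
theorem variance_recursion (M : RobustMDP S A) (t : ℕ) :
    (1 - M.β t) ^ 2 / M.rho t + M.β t ^ 2 ≤ 1 / M.rho (t + 1) := by
  have h1 := M.rho_pos t
  have h2 := M.rho_pos (t + 1)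
  have h3 := M.rho_succ t
  have h4 := M.γ_nonneg
  have h5 : (1 - M.β t) ≤ M.rho t * M.β t := by
    rw [β_eq, mul_one_div, sub_le_iff_le_add, ← add_div, le_div_iff₀ h2]
    linarith
  have h6 : (1 - M.β t) ^ 2 / M.rho t ≤ (1 - M.β t) * M.β t := by
    rw [div_le_iff₀ h1, sq, mul_assoc, mul_comm (M.β t)]
    exact mul_le_mul_of_nonneg_left h5 (sub_nonneg.2 (M.β_le_one t))
  rw [← β_eq]
  nlinarith

/-! ### The noise process -/

section NoiseProcess

variable [MeasurableSpace S] {Ω : Type*} [mΩ : MeasurableSpace Ω]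

/-- The expected update target at the table `Q`. -/
def meanTarget (M : RobustMDP S A) (μ : Measure Ω) (lo hi : ℝ) (α : ℕ → ℝ) (T' : ℕ)
    (X : ℕ → Ω → S → A → S) (Y : Ω → S → A → S) (r : Ω → S → A → ℝ)
    (Q : S → A → ℝ) (s : S) (a : A) : ℝ :=
  ∫ ω, M.target lo hi α T' Q (fun k => X k ω) (Y ω) (r ω) s a ∂μ

/-- The iterates `Q_t` as random variables. -/
def iter (M : RobustMDP S A) (lo hi : ℝ) (α : ℕ → ℝ) (T' : ℕ) (X : ℕ → ℕ → Ω → S → A → S)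
    (Y : ℕ → Ω → S → A → S) (r : ℕ → Ω → S → A → ℝ) (t : ℕ) (ω : Ω) : S → A → ℝ :=
  M.Qiter lo hi α T' (fun t k => X t k ω) (fun t => Y t ω) (fun t => r t ω) t

/-- The weighted sum of the centred update targets. -/
def noise (M : RobustMDP S A) (μ : Measure Ω) (lo hi : ℝ) (α : ℕ → ℝ) (T' : ℕ)
    (X : ℕ → ℕ → Ω → S → A → S) (Y : ℕ → Ω → S → A → S) (r : ℕ → Ω → S → A → ℝ) :
    ℕ → Ω → S → A → ℝ
  | 0 => fun _ _ _ => 0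
  | t + 1 => fun ω s a => (1 - M.β t) * noise M μ lo hi α T' X Y r t ω s a +
      M.β t * (M.target lo hi α T' (M.iter lo hi α T' X Y r t ω) (fun k => X t k ω) (Y t ω)
        (r t ω) s a - M.meanTarget μ lo hi α T' (X t) (Y t) (r t) (M.iter lo hi α T' X Y r t ω) s a)

variable {μ : Measure Ω} {X : ℕ → ℕ → Ω → S → A → S} {Y : ℕ → Ω → S → A → S}
  {r : ℕ → Ω → S → A → ℝ} {T' : ℕ}

theorem iter_succ (t : ℕ) (ω : Ω) (s : S) (a : A) :
    M.iter lo hi α T' X Y r (t + 1) ω s a = (1 - M.β t) * M.iter lo hi α T' X Y r t ω s a +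
      M.β t * M.target lo hi α T' (M.iter lo hi α T' X Y r t ω) (fun k => X t k ω) (Y t ω)
        (r t ω) s a := rfl

/-- The σ-algebras generated by the individual draws. -/
abbrev drawAlgebra (X : ℕ → ℕ → Ω → S → A → S) (Y : ℕ → Ω → S → A → S) (r : ℕ → Ω → S → A → ℝ) :
    (ℕ × ℕ) ⊕ ℕ → MeasurableSpace Ω :=
  Sum.elim (fun p : ℕ × ℕ => MeasurableSpace.comap (X p.1 p.2) inferInstance)
    (fun t : ℕ => MeasurableSpace.comap (fun ω => (r t ω, Y t ω)) inferInstance)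

/-- The iteration of the algorithm at which a draw is made. -/
def drawTime : (ℕ × ℕ) ⊕ ℕ → ℕ := Sum.elim Prod.fst id

/-- The σ-algebra generated by the draws made at the iterations in `I`. -/
abbrev stepAlgebra (X : ℕ → ℕ → Ω → S → A → S) (Y : ℕ → Ω → S → A → S) (r : ℕ → Ω → S → A → ℝ)
    (I : Set ℕ) : MeasurableSpace Ω := ⨆ i ∈ drawTime ⁻¹' I, drawAlgebra X Y r i

theorem stepAlgebra_mono {I J : Set ℕ} (h : I ⊆ J) : stepAlgebra X Y r I ≤ stepAlgebra X Y r J :=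
  biSup_mono fun _ hi => h hi

theorem measurable_X_step {I : Set ℕ} {t : ℕ} (ht : t ∈ I) (k : ℕ) :
    Measurable[stepAlgebra X Y r I] (X t k) :=
  (comap_measurable (X t k)).mono
    (le_iSup₂_of_le (f := fun i (_ : i ∈ drawTime ⁻¹' I) => drawAlgebra X Y r i)
      (Sum.inl (t, k)) ht le_rfl) le_rfl

theorem measurable_rY_step {I : Set ℕ} {t : ℕ} (ht : t ∈ I) :
    Measurable[stepAlgebra X Y r I] fun ω => (r t ω, Y t ω) :=
  (comap_measurable fun ω => (r t ω, Y t ω)).mono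
    (le_iSup₂_of_le (f := fun i (_ : i ∈ drawTime ⁻¹' I) => drawAlgebra X Y r i)
      (Sum.inr t) ht le_rfl) le_rfl

variable [MeasurableSingletonClass S]

theorem IsGenerativeData.drawAlgebra_le (hG : M.IsGenerativeData μ X Y r) (i : (ℕ × ℕ) ⊕ ℕ) :
    drawAlgebra X Y r i ≤ mΩ := by
  rcases i with p | t
  · exact (hG.measurable_X p.1 p.2).comap_le
  · exact ((hG.measurable_r t).prodMk (hG.measurable_Y t)).comap_le

theorem IsGenerativeData.stepAlgebra_le (hG : M.IsGenerativeData μ X Y r) (I : Set ℕ) :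
    stepAlgebra X Y r I ≤ mΩ := iSup₂_le fun i _ => hG.drawAlgebra_le i

theorem Regular.measurable_meanTarget (h : M.Regular lo hi σ CM) (hT' : 1 ≤ T') [SFinite μ]
    (hG : M.IsGenerativeData μ X Y r) (t : ℕ) :
    Measurable (M.meanTarget μ lo hi α T' (X t) (Y t) (r t)) := by
  have h1 : Measurable fun p : (S → A → ℝ) × Ω =>
      M.target lo hi α T' p.1 (fun k => X t k p.2) (Y t p.2) (r t p.2) :=
    h.measurable_target (Q := fun p : (S → A → ℝ) × Ω => p.1) (x := fun k p => X t k p.2)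
      (y := fun p => Y t p.2) (r := fun p => r t p.2) hT' measurable_fst
      (fun k => (hG.measurable_X t k).comp measurable_snd)
      ((hG.measurable_Y t).comp measurable_snd) ((hG.measurable_r t).comp measurable_snd)
  refine measurable_pi_lambda _ fun s => measurable_pi_lambda _ fun a => ?_
  have h2 : Measurable fun p : (S → A → ℝ) × Ω =>
      M.target lo hi α T' p.1 (fun k => X t k p.2) (Y t p.2) (r t p.2) s a :=
    measurable_entry s a h1
  exact (h2.stronglyMeasurable.integral_prod_right' (ν := μ)).measurable

theorem Regular.measurable_iter (h : M.Regular lo hi σ CM) (hT' : 1 ≤ T') (t : ℕ) :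
    Measurable[stepAlgebra X Y r (Set.Iio t)] (M.iter lo hi α T' X Y r t) := by
  induction t with
  | zero => exact @measurable_const _ _ _ (_) _
  | succ t ih =>
    let m := stepAlgebra X Y r (Set.Iio (t + 1))
    have hQ : Measurable[m] (M.iter lo hi α T' X Y r t) :=
      ih.mono (stepAlgebra_mono (Set.Iio_subset_Iio (Nat.le_succ t))) le_rfl
    have ht : t ∈ Set.Iio (t + 1) := Nat.lt_succ_self t
    have hrY := measurable_rY_step (X := X) (Y := Y) (r := r) ht
    have htar := @Regular.measurable_target S A _ _ _ _ M lo hi σ CM α _ _ Ω m h T' hT'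
      (M.iter lo hi α T' X Y r t) (fun k ω => X t k ω) (Y t) (r t) hQ
      (fun k => measurable_X_step ht k) hrY.snd hrY.fst
    exact (hQ.const_smul (1 - M.β t)).add (htar.const_smul (M.β t))

theorem Regular.measurable_noise (h : M.Regular lo hi σ CM) (hT' : 1 ≤ T') [SFinite μ]
    (hG : M.IsGenerativeData μ X Y r) (t : ℕ) :
    Measurable[stepAlgebra X Y r (Set.Iio t)] (M.noise μ lo hi α T' X Y r t) := by
  induction t with
  | zero => exact @measurable_const _ _ _ (_) _
  | succ t ih =>
    have hmt := h.measurable_meanTarget (α := α) hT' hG t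
    let m := stepAlgebra X Y r (Set.Iio (t + 1))
    have hle := stepAlgebra_mono (X := X) (Y := Y) (r := r) (Set.Iio_subset_Iio (Nat.le_succ t))
    have hQ : Measurable[m] (M.iter lo hi α T' X Y r t) :=
      (h.measurable_iter hT' t).mono hle le_rfl
    have hW := ih.mono hle le_rfl
    have ht : t ∈ Set.Iio (t + 1) := Nat.lt_succ_self t
    have hrY := measurable_rY_step (X := X) (Y := Y) (r := r) ht
    have htar := @Regular.measurable_target S A _ _ _ _ M lo hi σ CM α _ _ Ω m h T' hT'
      (M.iter lo hi α T' X Y r t) (fun k ω => X t k ω) (Y t) (r t) hQ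
      (fun k => measurable_X_step ht k) hrY.snd hrY.fst
    have hmean := hmt.comp hQ
    exact (hW.const_smul (1 - M.β t)).add ((htar.sub hmean).const_smul (M.β t))

variable [IsProbabilityMeasure μ]

theorem Regular.measurable_target_fixed (h : M.Regular lo hi σ CM) (hT' : 1 ≤ T')
    (hG : M.IsGenerativeData μ X Y r) (t : ℕ) (Q : S → A → ℝ) (s : S) (a : A) :
    Measurable fun ω => M.target lo hi α T' Q (fun k => X t k ω) (Y t ω) (r t ω) s a :=
  measurable_entry s a (h.measurable_target (Q := fun _ => Q)
    (x := fun k ω => X t k ω) hT' measurable_const (hG.measurable_X t) (hG.measurable_Y t)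
    (hG.measurable_r t))

theorem Regular.meanTarget_mem (h : M.Regular lo hi σ CM) (hT' : 1 ≤ T')
    (hG : M.IsGenerativeData μ X Y r) (hr : ∀ t ω s a, |r t ω s a - M.R s a| ≤ 1)
    (t : ℕ) (Q : S → A → ℝ) (s : S) (a : A) :
    M.meanTarget μ lo hi α T' (X t) (Y t) (r t) Q s a ∈
      Set.Icc (M.R s a - (1 + M.γ * CM)) (M.R s a + (1 + M.γ * CM)) := by
  have hm := h.measurable_target_fixed (α := α) hT' hG t Q s a
  have hb := fun ω => h.target_mem (α := α) hT' Q (fun k => X t k ω) (Y t ω) (hr t ω s a)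
  have hint : Integrable (fun ω => M.target lo hi α T' Q (fun k => X t k ω) (Y t ω) (r t ω) s a) μ :=
    Integrable.of_mem_Icc _ _ hm.aemeasurable (Eventually.of_forall hb)
  have h1 := integral_mono (integrable_const _) hint fun ω => (hb ω).1
  have h2 := integral_mono hint (integrable_const _) fun ω => (hb ω).2
  simp only [integral_const, probReal_univ, one_smul] at h1 h2
  exact ⟨h1, h2⟩

theorem Regular.abs_target_sub_mean_le (h : M.Regular lo hi σ CM) (hT' : 1 ≤ T')
    (hG : M.IsGenerativeData μ X Y r) (hr : ∀ t ω s a, |r t ω s a - M.R s a| ≤ 1)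
    (t : ℕ) (Q : S → A → ℝ) (s : S) (a : A) (ω : Ω) :
    |M.target lo hi α T' Q (fun k => X t k ω) (Y t ω) (r t ω) s a -
      M.meanTarget μ lo hi α T' (X t) (Y t) (r t) Q s a| ≤ 2 * (1 + M.γ * CM) := by
  have h1 := h.target_mem (α := α) hT' Q (fun k => X t k ω) (Y t ω) (hr t ω s a)
  have h2 := h.meanTarget_mem (α := α) hT' hG hr t Q s a
  rw [abs_le]
  constructor <;> linarith [h1.1, h1.2, h2.1, h2.2]

theorem abs_convex_comb_le {b u v K : ℝ} (hb0 : 0 ≤ b) (hb1 : b ≤ 1) (hu : |u| ≤ K)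
    (hv : |v| ≤ K) : |(1 - b) * u + b * v| ≤ K := by
  have h1 := mul_le_mul_of_nonneg_left hu (sub_nonneg.2 hb1)
  have h2 := mul_le_mul_of_nonneg_left hv hb0
  calc |(1 - b) * u + b * v| ≤ (1 - b) * |u| + b * |v| := by
        refine (abs_add_le _ _).trans (le_of_eq ?_)
        rw [abs_mul, abs_mul, abs_of_nonneg hb0, abs_of_nonneg (sub_nonneg.2 hb1)]
    _ ≤ K := by linarith

theorem Regular.abs_noise_le (h : M.Regular lo hi σ CM) (hT' : 1 ≤ T')
    (hG : M.IsGenerativeData μ X Y r) (hr : ∀ t ω s a, |r t ω s a - M.R s a| ≤ 1)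
    (t : ℕ) (ω : Ω) (s : S) (a : A) :
    |M.noise μ lo hi α T' X Y r t ω s a| ≤ 2 * (1 + M.γ * CM) := by
  induction t with
  | zero => simp [noise, h.scale_pos.le]
  | succ t ih =>
    exact abs_convex_comb_le (M.β_pos t).le (M.β_le_one t) ih
      (h.abs_target_sub_mean_le hT' hG hr t _ s a ω)

theorem Regular.abs_iter_le (h : M.Regular lo hi σ CM) (hT' : 1 ≤ T')
    (hr : ∀ t ω s a, |r t ω s a - M.R s a| ≤ 1) (t : ℕ) (ω : Ω) (s : S) (a : A) :
    |M.iter lo hi α T' X Y r t ω s a| ≤ M.vmax + (2 + M.γ * CM) := by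
  have h1 := h.scale_pos
  have h2 := M.vmax_pos
  induction t with
  | zero =>
    change |M.vmax| ≤ _
    rw [abs_of_pos h2]; linarith
  | succ t ih =>
    rw [iter_succ]
    refine abs_convex_comb_le (M.β_pos t).le (M.β_le_one t) ih ?_
    have h3 := h.target_mem (α := α) hT' (M.iter lo hi α T' X Y r t ω) (fun k => X t k ω)
      (Y t ω) (hr t ω s a)
    have h4 := M.R_nonneg s a
    have h5 := M.R_le_one s a
    rw [abs_le]
    constructor <;> linarith [h3.1, h3.2]

/-- The noise process is sub-Gaussian with variance proxy `(1 + γ C_M)² / (1 + (1 - γ) t)`. -/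
theorem Regular.mgf_noise_le (h : M.Regular lo hi σ CM) (hT' : 1 ≤ T')
    (hG : M.IsGenerativeData μ X Y r) (hr : ∀ t ω s a, |r t ω s a - M.R s a| ≤ 1)
    (t : ℕ) (s : S) (a : A) (θ : ℝ) :
    ∫ ω, Real.exp (θ * M.noise μ lo hi α T' X Y r t ω s a) ∂μ ≤
      Real.exp (θ ^ 2 * ((1 + M.γ * CM) ^ 2 / M.rho t) / 2) := by
  induction t generalizing θ with
  | zero =>
    simp only [noise, mul_zero, Real.exp_zero, integral_const, probReal_univ, one_smul]
    have := M.rho_pos 0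
    exact Real.one_le_exp (by positivity)
  | succ t ih =>
    set b := M.β t with hb
    set v := 1 + M.γ * CM with hv
    have hv0 : 0 < v := h.scale_pos
    set U : Ω → (S → A → ℝ) × (S → A → ℝ) := fun ω =>
      (M.iter lo hi α T' X Y r t ω, M.noise μ lo hi α T' X Y r t ω) with hU
    set Z : Ω → (ℕ → S → A → S) × ((S → A → ℝ) × (S → A → S)) := fun ω =>
      (fun k => X t k ω, (r t ω, Y t ω)) with hZ
    have hUm' : Measurable[stepAlgebra X Y r (Set.Iio t)] U :=
      (h.measurable_iter hT' t).prodMk (h.measurable_noise hT' hG t)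
    have hUm : Measurable U := hUm'.mono (hG.stepAlgebra_le _) le_rfl
    have hZm' : Measurable[stepAlgebra X Y r {t}] Z :=
      (@measurable_pi_lambda _ _ _ (_) _ _ fun k =>
        measurable_X_step (Set.mem_singleton t) k).prodMk
        (measurable_rY_step (Set.mem_singleton t))
    have hZm : Measurable Z := hZm'.mono (hG.stepAlgebra_le _) le_rfl
    -- `U` collects what is determined before iteration `t`, and `Z` all draws of iteration `t`, so
    -- the current table can be frozen while the new draws are integrated out.
    have hUZ : IndepFun U Z μ :=
      indepFun_of_disjoint (m := drawAlgebra X Y r) hG.drawAlgebra_le hG.indep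
        (I := drawTime ⁻¹' Set.Iio t) (J := drawTime ⁻¹' {t})
        (Disjoint.preimage _ (by simp)) hUm' hZm'
    set φ : ((S → A → ℝ) × (S → A → ℝ)) × ((ℕ → S → A → S) × ((S → A → ℝ) × (S → A → S))) → ℝ :=
      fun p => Real.exp (θ * ((1 - b) * p.1.2 s a + b * (M.target lo hi α T' p.1.1
        (fun k => p.2.1 k) p.2.2.2 p.2.2.1 s a
          - M.meanTarget μ lo hi α T' (X t) (Y t) (r t) p.1.1 s a))) with hφ
    have hφm : Measurable φ := by
      have h1 := measurable_entry s a (measurable_snd.comp (measurable_fst (α := (S → A → ℝ) × (S → A → ℝ))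
        (β := (ℕ → S → A → S) × ((S → A → ℝ) × (S → A → S)))))
      have h2 := measurable_entry s a (h.measurable_target (α := α) (T' := T')
        (E := ((S → A → ℝ) × (S → A → ℝ)) × ((ℕ → S → A → S) × ((S → A → ℝ) × (S → A → S))))
        (Q := fun p => p.1.1) (x := fun k p => p.2.1 k) (y := fun p => p.2.2.2)
        (r := fun p => p.2.2.1) hT' (by fun_prop)
        (fun k => (measurable_pi_apply k).comp (by fun_prop)) (by fun_prop) (by fun_prop))
      have h3 := measurable_entry s a ((h.measurable_meanTarget (α := α) hT' hG t).comp
        ((measurable_fst (α := S → A → ℝ) (β := S → A → ℝ)).comp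
        (measurable_fst (β := (ℕ → S → A → S) × ((S → A → ℝ) × (S → A → S))))))
      exact Real.measurable_exp.comp (((h1.const_mul _).add ((h2.sub h3).const_mul _)).const_mul _)
    have hφb : ∀ ω ω', |φ (U ω, Z ω')| ≤ Real.exp (|θ| * (2 * v)) := fun ω ω' => by
      simp only [hφ, Real.abs_exp, Real.exp_le_exp]
      refine (le_abs_self _).trans ?_
      rw [abs_mul]
      refine mul_le_mul_of_nonneg_left ?_ (abs_nonneg _)
      exact abs_convex_comb_le (M.β_pos t).le (M.β_le_one t) (h.abs_noise_le hT' hG hr t ω s a)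
        (h.abs_target_sub_mean_le hT' hG hr t _ s a ω')
    -- Hoeffding's lemma at a frozen table: the target lies in an interval of length `2 v`, which
    -- gives variance proxy `v ^ 2`.
    have hHoef : ∀ Q : S → A → ℝ, ∫ ω, Real.exp ((θ * b) *
        (M.target lo hi α T' Q (fun k => X t k ω) (Y t ω) (r t ω) s a -
          M.meanTarget μ lo hi α T' (X t) (Y t) (r t) Q s a)) ∂μ ≤
        Real.exp (v ^ 2 * (θ * b) ^ 2 / 2) := fun Q => by
      have hsub := hasSubgaussianMGF_of_mem_Icc (μ := μ)
        (h.measurable_target_fixed (α := α) hT' hG t Q s a).aemeasurable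
        (Eventually.of_forall fun ω => h.target_mem (α := α) hT' Q (fun k => X t k ω) (Y t ω)
          (hr t ω s a))
      have := hsub.mgf_le (θ * b)
      rw [mgf] at this
      refine this.trans (le_of_eq ?_)
      congr 3
      push_cast
      rw [Real.norm_eq_abs, show M.R s a + (1 + M.γ * CM) - (M.R s a - (1 + M.γ * CM))
        = 2 * v by rw [hv]; ring, abs_of_pos (by positivity)]
      ring
    have hexp_int : Integrable
        (fun ω => Real.exp (θ * (1 - b) * M.noise μ lo hi α T' X Y r t ω s a)) μ :=
      Integrable.of_bound (C := Real.exp (|θ * (1 - b)| * (2 * v)))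
        (Real.measurable_exp.comp ((measurable_entry s a ((h.measurable_noise hT' hG t).mono
          (hG.stepAlgebra_le _) le_rfl)).const_mul _)).aestronglyMeasurable
        (Eventually.of_forall fun ω => by
          rw [Real.norm_eq_abs, Real.abs_exp, Real.exp_le_exp]
          refine (le_abs_self _).trans ?_
          rw [abs_mul]
          exact mul_le_mul_of_nonneg_left (h.abs_noise_le hT' hG hr t ω s a) (abs_nonneg _))
    calc ∫ ω, Real.exp (θ * M.noise μ lo hi α T' X Y r (t + 1) ω s a) ∂μ
        = ∫ ω, φ (U ω, Z ω) ∂μ := rfl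
      _ = ∫ ω, ∫ ω', φ (U ω, Z ω') ∂μ ∂μ := integral_comp_of_indepFun hUm hZm hUZ hφm hφb
      _ = ∫ ω, Real.exp (θ * (1 - b) * M.noise μ lo hi α T' X Y r t ω s a) *
            ∫ ω', Real.exp ((θ * b) * (M.target lo hi α T' (M.iter lo hi α T' X Y r t ω)
              (fun k => X t k ω') (Y t ω') (r t ω') s a - M.meanTarget μ lo hi α T' (X t) (Y t)
                (r t) (M.iter lo hi α T' X Y r t ω) s a)) ∂μ ∂μ := by
          refine integral_congr_ae (Eventually.of_forall fun ω => ?_)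
          simp only
          rw [← integral_const_mul]
          refine integral_congr_ae (Eventually.of_forall fun ω' => ?_)
          simp only [hφ, hU, hZ]
          rw [← Real.exp_add]
          congr 1; ring
      _ ≤ ∫ ω, Real.exp (θ * (1 - b) * M.noise μ lo hi α T' X Y r t ω s a) *
            Real.exp (v ^ 2 * (θ * b) ^ 2 / 2) ∂μ := by
          refine integral_mono_of_nonneg (Eventually.of_forall fun ω => ?_)
            (hexp_int.mul_const _) (Eventually.of_forall fun ω => ?_)
          · exact mul_nonneg (Real.exp_pos _).le (integral_nonneg fun _ => (Real.exp_pos _).le)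
          · exact mul_le_mul_of_nonneg_left (hHoef _) (Real.exp_pos _).le
      _ ≤ Real.exp ((θ * (1 - b)) ^ 2 * (v ^ 2 / M.rho t) / 2) *
            Real.exp (v ^ 2 * (θ * b) ^ 2 / 2) := by
          rw [integral_mul_const]
          exact mul_le_mul_of_nonneg_right (ih _) (Real.exp_pos _).le
      _ ≤ _ := by
          rw [← Real.exp_add, Real.exp_le_exp]
          have h1 := mul_le_mul_of_nonneg_left (M.variance_recursion t)
            (show 0 ≤ θ ^ 2 * v ^ 2 / 2 by positivity)
          refine (le_of_eq ?_).trans (h1.trans (le_of_eq ?_))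
          · rw [← hb]; ring
          · ring

theorem Regular.integral_norm_noise_le (h : M.Regular lo hi σ CM) (hT' : 1 ≤ T')
    (hG : M.IsGenerativeData μ X Y r) (hr : ∀ t ω s a, |r t ω s a - M.R s a| ≤ 1) (t : ℕ) :
    ∫ ω, ‖M.noise μ lo hi α T' X Y r t ω‖ ∂μ ≤ M.CN CM / 2 / √(M.rho t) := by
  have hv := h.scale_pos
  have hρ := M.rho_pos t
  have := integral_norm_le_of_mgf_le (μ := μ) (κ := (1 + M.γ * CM) ^ 2 / M.rho t)
    ((h.measurable_noise (α := α) hT' hG t).mono (hG.stepAlgebra_le _) le_rfl)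
    (K := 2 * (1 + M.γ * CM)) (fun ω => (norm_pi_pi_le (by positivity)).2
      (h.abs_noise_le hT' hG hr t ω)) (by positivity)
    (fun s a θ => h.mgf_noise_le hT' hG hr t s a θ)
  refine this.trans (le_of_eq ?_)
  rw [CN, mul_div_cancel_left₀ _ (two_ne_zero), ← Real.sqrt_div' _ hρ.le]
  congr 1; ring

end NoiseProcess

end RobustMDP

/-! ### Bias of the targets and the error recursion -/

namespace RobustMDP

variable {S A : Type*} [Fintype S] [Fintype A] [Nonempty S] [Nonempty A] {M : RobustMDP S A}
  {lo hi σ CM : ℝ} {α : ℕ → ℝ}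
  [MeasurableSpace S] {Ω : Type*} [mΩ : MeasurableSpace Ω]
  {μ : Measure Ω} {X : ℕ → ℕ → Ω → S → A → S} {Y : ℕ → Ω → S → A → S}
  {r : ℕ → Ω → S → A → ℝ} {T' : ℕ}
  [MeasurableSingletonClass S] [IsProbabilityMeasure μ]

/-- The expected target is the expected dual objective at the last inner iterate. -/
theorem Regular.meanTarget_eq (h : M.Regular lo hi σ CM) (hT' : 1 ≤ T')
    (hG : M.IsGenerativeData μ X Y r) (hr : ∀ t ω s a, |r t ω s a - M.R s a| ≤ 1)
    (t : ℕ) (Q : S → A → ℝ) (s : S) (a : A) :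
    M.meanTarget μ lo hi α T' (X t) (Y t) (r t) Q s a = M.R s a + M.γ *
      ∫ ω, M.dual s a (M.greedy Q)
        (M.inner lo hi α (M.greedy Q) (fun k => X t k ω) s a T') ∂μ := by
  set V := M.greedy Q with hV
  have hVbox : V ∈ M.valueBox := M.greedy_mem Q
  set η : Ω → ℝ := fun ω => M.inner lo hi α V (fun k => X t k ω) s a T' with hη
  set Z : Ω → S := fun ω => Y t ω s a with hZ
  have hηmem : ∀ ω, η ω ∈ Set.Icc lo hi := fun ω => by
    obtain ⟨k, rfl⟩ : ∃ k, T' = k + 1 := ⟨T' - 1, by omega⟩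
    exact h.inner_mem V _ s a k
  have hηm' : Measurable[⨆ i ∈ Set.range fun k => Sum.inl (t, k), drawAlgebra X Y r i] η := by
    refine @Regular.measurable_inner S A _ M lo hi σ CM _ _ α _ _ Ω
      (⨆ i ∈ Set.range fun k => Sum.inl (t, k), drawAlgebra X Y r i) h (fun _ => V)
      (@measurable_const _ _ _ (_) _) (fun _ => hVbox) (X t) s a T' fun i _ => ?_
    exact (comap_measurable (X t i)).mono (le_iSup₂_of_le
      (f := fun j (_ : j ∈ Set.range fun k => Sum.inl (t, k)) => drawAlgebra X Y r j)
      (Sum.inl (t, i)) ⟨i, rfl⟩ le_rfl) le_rfl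
  have hZm' : Measurable[⨆ i ∈ ({Sum.inr t} : Set ((ℕ × ℕ) ⊕ ℕ)), drawAlgebra X Y r i] Z := by
    have h1 : Measurable[⨆ i ∈ ({Sum.inr t} : Set ((ℕ × ℕ) ⊕ ℕ)), drawAlgebra X Y r i]
        fun ω => (r t ω, Y t ω) :=
      (comap_measurable fun ω => (r t ω, Y t ω)).mono (le_iSup₂_of_le
        (f := fun j (_ : j ∈ ({Sum.inr t} : Set ((ℕ × ℕ) ⊕ ℕ))) => drawAlgebra X Y r j)
        (Sum.inr t) rfl le_rfl) le_rfl
    exact (measurable_pi_apply a).comp ((measurable_pi_apply s).comp h1.snd)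
  have hηm : Measurable η := hηm'.mono (iSup₂_le fun i _ => hG.drawAlgebra_le i) le_rfl
  have hZm : Measurable Z := hZm'.mono (iSup₂_le fun i _ => hG.drawAlgebra_le i) le_rfl
  have hind : IndepFun η Z μ :=
    indepFun_of_disjoint (m := drawAlgebra X Y r) hG.drawAlgebra_le hG.indep
      (by simp) hηm' hZm'
  have hφm : Measurable fun p : ℝ × S => M.profile (p.1 - V p.2) + V p.2 := by
    have h1 : Measurable fun p : ℝ × S => V p.2 := (measurable_of_finite V).comp measurable_snd
    exact (M.measurable_profile.comp (measurable_fst.sub h1)).add h1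
  have hφb : ∀ ω ω', |M.profile (η ω - V (Z ω')) + V (Z ω')| ≤ CM := fun ω ω' =>
    h.abs_profile_le (hηmem ω) (hVbox _)
  have hfub := integral_comp_of_indepFun hηm hZm hind hφm (C := CM) hφb
  have hrm : Measurable fun ω => r t ω s a := measurable_entry s a (hG.measurable_r t)
  have hrint : Integrable (fun ω => r t ω s a) μ :=
    Integrable.of_mem_Icc (M.R s a - 1) (M.R s a + 1) hrm.aemeasurable
      (Eventually.of_forall fun ω => by
        have := abs_le.1 (hr t ω s a)
        constructor <;> linarith)
  have hJint : Integrable (fun ω => M.profile (η ω - V (Z ω)) + V (Z ω)) μ :=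
    Integrable.of_bound (hφm.comp (hηm.prodMk hZm)).aestronglyMeasurable CM
      (Eventually.of_forall fun ω => hφb ω ω)
  unfold meanTarget
  simp only [h.target_eq hT']
  change ∫ ω, r t ω s a + M.γ * (M.profile (η ω - V (Z ω)) + V (Z ω)) ∂μ = _
  rw [integral_add hrint (hJint.const_mul _), integral_const_mul, hG.mean_r]
  simp only at hfub
  rw [hfub]
  congr 2
  refine integral_congr_ae (Eventually.of_forall fun ω => ?_)
  exact integral_comp_of_law hZm (hG.law_Y t s a) fun s' => M.profile (η ω - V s') + V s'

/-- The bias bound `diam(Θ) C_g (2 + log T') / √T'` of the inner loop. -/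
def innerError (M : RobustMDP S A) (lo hi σ : ℝ) (T' : ℕ) : ℝ :=
  (hi - lo) * M.Cg lo hi σ * ((2 + Real.log T') / √(T' : ℝ))

theorem Regular.innerError_nonneg (h : M.Regular lo hi σ CM) (hT' : 1 ≤ T') :
    0 ≤ M.innerError lo hi σ T' := by
  have h1 := h.lo_le_hi
  have h2 := h.Cg_pos
  have h3 : 0 ≤ Real.log T' := Real.log_nonneg (by exact_mod_cast hT')
  have h4 : 0 ≤ hi - lo := by linarith
  unfold innerError
  positivity

/-- The bias is one-sided: the expected dual value never exceeds the robust expectation of the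
greedy values and falls short of it by at most the inner error. Replacing the greedy values by those
of `Qstar` is nonexpansive, projection included, because `Qstar` lies in the box. -/
theorem Regular.abs_meanTarget_sub_le (h : M.Regular lo hi σ CM)
    (hα : ∀ k : ℕ, 1 ≤ k → α k = (hi - lo) / (M.Cg lo hi σ * √(k : ℝ))) (hT' : 1 ≤ T')
    (hG : M.IsGenerativeData μ X Y r) (hr : ∀ t ω s a, |r t ω s a - M.R s a| ≤ 1)
    {Qstar : S → A → ℝ} (hQ : M.IsOptimalQ Qstar) (t : ℕ) (Q : S → A → ℝ) (s : S) (a : A) :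
    |M.meanTarget μ lo hi α T' (X t) (Y t) (r t) Q s a - Qstar s a| ≤
      M.γ * (‖Q - Qstar‖ + M.innerError lo hi σ T') := by
  have h1 : Qstar s a = M.R s a + M.γ * M.robustExp s a (maxQ Qstar) :=
    (congrFun (congrFun ((M.isOptimalQ_iff _).1 hQ) s) a).symm
  have hbox := M.greedy_mem Q
  set V := M.greedy Q with hV
  have h2 := h.robustExp_sub_integral_inner_le (μ := μ) hα hbox s a (hG.measurable_X t)
    (fun k s' => hG.law_X t k s a s')
    (hG.indep.precomp (g := fun k => Sum.inl (t, k)) fun k k' hk => by simpa using hk) hT'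
  have hηmem : ∀ ω, M.inner lo hi α V (fun k => X t k ω) s a T' ∈ Set.Icc lo hi := fun ω => by
    obtain ⟨k, rfl⟩ : ∃ k, T' = k + 1 := ⟨T' - 1, by omega⟩
    exact h.inner_mem V _ s a k
  have hηm : Measurable fun ω => M.inner lo hi α V (fun k => X t k ω) s a T' :=
    h.measurable_inner (V := fun _ => V) (x := X t) measurable_const (fun _ => hbox) s a T'
      fun i _ => hG.measurable_X t i
  have h3 : ∫ ω, M.dual s a V (M.inner lo hi α V (fun k => X t k ω) s a T') ∂μ
      ≤ M.robustExp s a V := by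
    have hint : Integrable
        (fun ω => M.dual s a V (M.inner lo hi α V (fun k => X t k ω) s a T')) μ :=
      Integrable.of_bound ((M.measurable_dual s a V).comp hηm).aestronglyMeasurable CM
        (Eventually.of_forall fun ω => h.abs_dual_le hbox s a (hηmem ω))
    have := integral_mono hint (integrable_const (M.robustExp s a V)) fun ω =>
      h.dual_le_robustExp hbox s a (hηmem ω)
    simpa using this
  have h4 : |M.robustExp s a V - M.robustExp s a (maxQ Qstar)| ≤ ‖Q - Qstar‖ :=
    M.abs_robustExp_sub_le s a fun s' => M.abs_greedy_sub_le (hQ.mem_box M) s'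
  rw [h.meanTarget_eq hT' hG hr, h1, add_sub_add_left_eq_sub, ← mul_sub, abs_mul,
    abs_of_nonneg M.γ_nonneg]
  refine mul_le_mul_of_nonneg_left ?_ M.γ_nonneg
  have h5 := abs_le.1 h4
  have h6 := h.innerError_nonneg hT'
  change _ ≤ M.innerError lo hi σ T' at h2
  rw [abs_le]
  constructor <;> linarith

/-- One step of the recursion for the error with the noise removed. -/
theorem Regular.rho_mul_error_succ_le (h : M.Regular lo hi σ CM)
    (hα : ∀ k : ℕ, 1 ≤ k → α k = (hi - lo) / (M.Cg lo hi σ * √(k : ℝ))) (hT' : 1 ≤ T')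
    (hG : M.IsGenerativeData μ X Y r) (hr : ∀ t ω s a, |r t ω s a - M.R s a| ≤ 1)
    {Qstar : S → A → ℝ} (hQ : M.IsOptimalQ Qstar) (t : ℕ) (ω : Ω) :
    M.rho (t + 1) * ‖M.iter lo hi α T' X Y r (t + 1) ω - Qstar
        - M.noise μ lo hi α T' X Y r (t + 1) ω‖ ≤
      M.rho t * ‖M.iter lo hi α T' X Y r t ω - Qstar - M.noise μ lo hi α T' X Y r t ω‖
        + ‖M.noise μ lo hi α T' X Y r t ω‖ + M.innerError lo hi σ T' := by
  set D := M.iter lo hi α T' X Y r t ω - Qstar - M.noise μ lo hi α T' X Y r t ω with hD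
  set W := M.noise μ lo hi α T' X Y r t ω with hW
  have h6 := h.innerError_nonneg hT'
  have hQW : ‖M.iter lo hi α T' X Y r t ω - Qstar‖ ≤ ‖D‖ + ‖W‖ := by
    rw [show M.iter lo hi α T' X Y r t ω - Qstar = D + W by rw [hD]; abel]
    exact norm_add_le _ _
  have hb0 := M.β_pos t
  have hb1 := M.β_le_one t
  have hg0 := M.γ_nonneg
  have hg1 := M.γ_lt_one
  have hstep : ‖M.iter lo hi α T' X Y r (t + 1) ω - Qstar
      - M.noise μ lo hi α T' X Y r (t + 1) ω‖ ≤
      (1 - M.β t) * ‖D‖ + M.β t * (M.γ * (‖D‖ + ‖W‖ + M.innerError lo hi σ T')) := by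
    have hn : 0 ≤ (1 - M.β t) * ‖D‖ := mul_nonneg (sub_nonneg.2 hb1) (norm_nonneg _)
    refine (norm_pi_pi_le (by positivity)).2 fun s a => ?_
    have e : (M.iter lo hi α T' X Y r (t + 1) ω - Qstar
        - M.noise μ lo hi α T' X Y r (t + 1) ω) s a = (1 - M.β t) * D s a + M.β t *
        (M.meanTarget μ lo hi α T' (X t) (Y t) (r t) (M.iter lo hi α T' X Y r t ω) s a
          - Qstar s a) := by
      simp only [hD, hW, Pi.sub_apply, iter_succ, noise]
      ring
    rw [e]
    refine (abs_add_le _ _).trans ?_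
    rw [abs_mul, abs_mul, abs_of_pos hb0, abs_of_nonneg (sub_nonneg.2 hb1)]
    refine add_le_add (mul_le_mul_of_nonneg_left ?_ (sub_nonneg.2 hb1))
      (mul_le_mul_of_nonneg_left ?_ hb0.le)
    · exact (norm_le_pi_norm (D s) a).trans (norm_le_pi_norm D s)
    · refine (h.abs_meanTarget_sub_le hα hT' hG hr hQ t _ s a).trans
        (mul_le_mul_of_nonneg_left ?_ hg0)
      linarith
  have hρ := M.rho_pos (t + 1)
  refine (mul_le_mul_of_nonneg_left hstep hρ.le).trans ?_
  have hρβ : M.rho (t + 1) * M.β t = 1 := by rw [β_eq, mul_one_div_cancel hρ.ne']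
  -- With `ρ_{t+1} β_t = 1`, the coefficient of `‖D‖` is `ρ_{t+1} - 1 + γ = ρ_t`; this is the reason
  -- for the choice of the step sizes.
  have e : M.rho (t + 1) * ((1 - M.β t) * ‖D‖ + M.β t *
      (M.γ * (‖D‖ + ‖W‖ + M.innerError lo hi σ T'))) =
      M.rho (t + 1) * ‖D‖ - (M.rho (t + 1) * M.β t) * ‖D‖ + (M.rho (t + 1) * M.β t) *
      (M.γ * (‖D‖ + ‖W‖ + M.innerError lo hi σ T')) := by ring
  rw [e, hρβ, rho_succ]
  have h7 := mul_le_of_le_one_left (norm_nonneg W) hg1.le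
  have h8 := mul_le_of_le_one_left h6 hg1.le
  linarith

theorem Regular.rho_mul_error_le (h : M.Regular lo hi σ CM)
    (hα : ∀ k : ℕ, 1 ≤ k → α k = (hi - lo) / (M.Cg lo hi σ * √(k : ℝ))) (hT' : 1 ≤ T')
    (hG : M.IsGenerativeData μ X Y r) (hr : ∀ t ω s a, |r t ω s a - M.R s a| ≤ 1)
    {Qstar : S → A → ℝ} (hQ : M.IsOptimalQ Qstar) (T : ℕ) (ω : Ω) :
    M.rho T * ‖M.iter lo hi α T' X Y r T ω - Qstar - M.noise μ lo hi α T' X Y r T ω‖ ≤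
      ‖(fun _ _ => M.vmax : S → A → ℝ) - Qstar‖
        + ∑ t ∈ Finset.range T, ‖M.noise μ lo hi α T' X Y r t ω‖
        + T * M.innerError lo hi σ T' := by
  induction T with
  | zero =>
    have h1 : M.rho 0 = 1 := by simp [rho]
    have h2 : M.noise μ lo hi α T' X Y r 0 ω = 0 := rfl
    rw [h1, h2, sub_zero, one_mul]
    simp only [Finset.range_zero, Finset.sum_empty, add_zero, Nat.cast_zero, zero_mul]
    exact le_rfl
  | succ T ih =>
    rw [Finset.sum_range_succ]
    have := h.rho_mul_error_succ_le hα hT' hG hr hQ T ω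
    push_cast
    linarith

/-- Comparison with the telescoping sum of `√ρ_{t+1} - √ρ_t = (1 - γ) / (√ρ_{t+1} + √ρ_t)`; the
constant `4` comes from the crude bound `√ρ_{t+1} ≤ 3 √ρ_t`. -/
theorem sum_one_div_sqrt_rho_le (M : RobustMDP S A) (T : ℕ) :
    ∑ t ∈ Finset.range T, 1 / √(M.rho t) ≤ 4 / (1 - M.γ) * √(M.rho T) := by
  have hh := M.one_sub_gamma_pos
  induction T with
  | zero => simp only [Finset.range_zero, Finset.sum_empty]; positivity
  | succ T ih =>
    rw [Finset.sum_range_succ]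
    have h1 := M.rho_ge_one T
    have h2 := M.rho_succ T
    have h3 : 1 ≤ √(M.rho T) := Real.one_le_sqrt.2 h1
    have h4 : √(M.rho T) ≤ √(M.rho (T + 1)) := Real.sqrt_le_sqrt (by linarith)
    have h5 := Real.sq_sqrt (M.rho_pos T).le
    have h6 := Real.sq_sqrt (M.rho_pos (T + 1)).le
    have h7 : √(M.rho (T + 1)) ≤ 3 * √(M.rho T) := by
      refine Real.sqrt_le_left (by positivity) |>.2 ?_
      rw [mul_pow, h5]; linarith [M.γ_nonneg]
    set p := √(M.rho T)
    set q := √(M.rho (T + 1))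
    have h8 : 1 / p ≤ 4 / (1 - M.γ) * (q - p) := by
      rw [div_mul_eq_mul_div, div_le_div_iff₀ (by linarith) hh]
      have h9 : 1 - M.γ = (q - p) * (q + p) := by linarith
      have h10 := mul_le_mul_of_nonneg_left (show q + p ≤ 4 * p by linarith) (sub_nonneg.2 h4)
      linarith
    linarith

theorem integrable_norm_of_bound {f : Ω → S → A → ℝ} (hf : Measurable f) {K : ℝ}
    (hK : ∀ ω s a, |f ω s a| ≤ K) : Integrable (fun ω => ‖f ω‖) μ := by
  refine Integrable.of_bound hf.norm.aestronglyMeasurable K (Eventually.of_forall fun ω => ?_)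
  obtain ⟨s⟩ := ‹Nonempty S›
  obtain ⟨a⟩ := ‹Nonempty A›
  rw [norm_norm]
  exact (norm_pi_pi_le ((abs_nonneg _).trans (hK ω s a))).2 (hK ω)

/-- The error bound when the noise of the rewards is bounded everywhere. -/
theorem Regular.integral_error_le_of_forall (h : M.Regular lo hi σ CM)
    (hα : ∀ k : ℕ, 1 ≤ k → α k = (hi - lo) / (M.Cg lo hi σ * √(k : ℝ))) (hT' : 1 ≤ T')
    (hG : M.IsGenerativeData μ X Y r) (hr : ∀ t ω s a, |r t ω s a - M.R s a| ≤ 1)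
    {Qstar : S → A → ℝ} (hQ : M.IsOptimalQ Qstar) {T : ℕ} (hT : 1 ≤ T) :
    Integrable (fun ω => ‖M.iter lo hi α T' X Y r T ω - Qstar‖) μ ∧
    ∫ ω, ‖M.iter lo hi α T' X Y r T ω - Qstar‖ ∂μ ≤
      ‖(fun _ _ => M.vmax : S → A → ℝ) - Qstar‖ / (1 + (1 - M.γ) * T)
        + 2 * M.CN CM / √((1 - M.γ) ^ 3 * T)
        + (hi - lo) * M.Cg lo hi σ * (2 + Real.log T') / ((1 - M.γ) * √(T' : ℝ))
        + M.CN CM / √(1 + (1 - M.γ) * T) := by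
  have hh := M.one_sub_gamma_pos
  have hTpos : (0 : ℝ) < T := by exact_mod_cast hT
  have hρ := M.rho_pos T
  have hCN := h.CN_pos
  have he := h.innerError_nonneg (σ := σ) hT'
  have hWm : ∀ t, Measurable (M.noise μ lo hi α T' X Y r t) := fun t =>
    (h.measurable_noise hT' hG t).mono (hG.stepAlgebra_le _) le_rfl
  have hQm : Measurable (M.iter lo hi α T' X Y r T) :=
    (h.measurable_iter hT' T).mono (hG.stepAlgebra_le _) le_rfl
  have hWb := h.abs_noise_le (α := α) hT' hG hr
  have hWi : ∀ t, Integrable (fun ω => ‖M.noise μ lo hi α T' X Y r t ω‖) μ := fun t =>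
    integrable_norm_of_bound (hWm t) (hWb t)
  have hEi : Integrable (fun ω => ‖M.iter lo hi α T' X Y r T ω - Qstar‖) μ := by
    refine integrable_norm_of_bound (hQm.sub_const Qstar)
      (K := M.vmax + (2 + M.γ * CM) + M.vmax) fun ω s a => ?_
    have h1 := abs_le.1 (h.abs_iter_le (X := X) (Y := Y) (α := α) hT' hr T ω s a)
    have h2 := hQ.mem_box M s a
    simp only [Pi.sub_apply]
    rw [abs_le]
    constructor <;> linarith
  refine ⟨hEi, ?_⟩
  have hpt : ∀ ω, ‖M.iter lo hi α T' X Y r T ω - Qstar‖ ≤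
      (‖(fun _ _ => M.vmax : S → A → ℝ) - Qstar‖ + T * M.innerError lo hi σ T') / M.rho T
      + (1 / M.rho T) * ∑ t ∈ Finset.range T, ‖M.noise μ lo hi α T' X Y r t ω‖
      + ‖M.noise μ lo hi α T' X Y r T ω‖ := by
    intro ω
    have h1 := h.rho_mul_error_le hα hT' hG hr hQ T ω
    have h2 : ‖M.iter lo hi α T' X Y r T ω - Qstar‖ ≤ ‖M.iter lo hi α T' X Y r T ω - Qstar
        - M.noise μ lo hi α T' X Y r T ω‖ + ‖M.noise μ lo hi α T' X Y r T ω‖ := by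
      simpa using norm_add_le (M.iter lo hi α T' X Y r T ω - Qstar
        - M.noise μ lo hi α T' X Y r T ω) (M.noise μ lo hi α T' X Y r T ω)
    rw [mul_comm, ← le_div_iff₀ hρ] at h1
    refine h2.trans (add_le_add (h1.trans (le_of_eq ?_)) le_rfl)
    ring
  have hSi : Integrable
      (fun ω => ∑ t ∈ Finset.range T, ‖M.noise μ lo hi α T' X Y r t ω‖) μ :=
    integrable_finsetSum _ fun t _ => hWi t
  have q1 : Integrable (fun ω =>
      (‖(fun _ _ => M.vmax : S → A → ℝ) - Qstar‖ + T * M.innerError lo hi σ T') / M.rho T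
      + (1 / M.rho T) * ∑ t ∈ Finset.range T, ‖M.noise μ lo hi α T' X Y r t ω‖) μ :=
    (integrable_const _).add (hSi.const_mul _)
  have hmono := integral_mono hEi (q1.add (hWi T)) hpt
  have hsplit : ∫ ω, ((‖(fun _ _ => M.vmax : S → A → ℝ) - Qstar‖
      + T * M.innerError lo hi σ T') / M.rho T
      + (1 / M.rho T) * ∑ t ∈ Finset.range T, ‖M.noise μ lo hi α T' X Y r t ω‖
      + ‖M.noise μ lo hi α T' X Y r T ω‖) ∂μ =
      (‖(fun _ _ => M.vmax : S → A → ℝ) - Qstar‖ + T * M.innerError lo hi σ T') / M.rho T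
      + (1 / M.rho T) * ∑ t ∈ Finset.range T, ∫ ω, ‖M.noise μ lo hi α T' X Y r t ω‖ ∂μ
      + ∫ ω, ‖M.noise μ lo hi α T' X Y r T ω‖ ∂μ := by
    rw [integral_add q1 (hWi T), integral_add (integrable_const _) (hSi.const_mul _),
      integral_const_mul (1 / M.rho T), integral_finsetSum _ fun t _ => hWi t]
    simp only [integral_const, probReal_univ, one_smul]
  have hsum : ∑ t ∈ Finset.range T, ∫ ω, ‖M.noise μ lo hi α T' X Y r t ω‖ ∂μ ≤
      M.CN CM / 2 * (4 / (1 - M.γ) * √(M.rho T)) := by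
    refine le_trans (Finset.sum_le_sum fun t _ => h.integral_norm_noise_le hT' hG hr t) ?_
    simp only [div_eq_mul_one_div (M.CN CM / 2)]
    rw [← Finset.mul_sum]
    exact mul_le_mul_of_nonneg_left (M.sum_one_div_sqrt_rho_le T) (by positivity)
  have hlast := h.integral_norm_noise_le (α := α) hT' hG hr T
  have hsρ : 0 < √(M.rho T) := Real.sqrt_pos.2 hρ
  have b1 : (1 / M.rho T) * (M.CN CM / 2 * (4 / (1 - M.γ) * √(M.rho T))) ≤
      2 * M.CN CM / √((1 - M.γ) ^ 3 * T) := by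
    have e1 : (1 / M.rho T) * (M.CN CM / 2 * (4 / (1 - M.γ) * √(M.rho T))) =
        2 * M.CN CM / ((1 - M.γ) * √(M.rho T)) := by
      have := Real.sq_sqrt hρ.le
      field_simp
      rw [this]; ring
    rw [e1]
    refine div_le_div_of_nonneg_left (by positivity) (by positivity) ?_
    -- The cube consists of the `(1 - γ)²` under the root from the noise sum and the factor in `ρ_T
    -- ≥ (1 - γ) T`.
    rw [show (1 - M.γ) ^ 3 * (T : ℝ) = (1 - M.γ) ^ 2 * ((1 - M.γ) * T) by ring,
      Real.sqrt_mul (sq_nonneg _), Real.sqrt_sq hh.le]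
    refine mul_le_mul_of_nonneg_left (Real.sqrt_le_sqrt ?_) hh.le
    unfold rho; linarith
  have b2 : T * M.innerError lo hi σ T' / M.rho T ≤
      (hi - lo) * M.Cg lo hi σ * (2 + Real.log T') / ((1 - M.γ) * √(T' : ℝ)) := by
    have e1 : (hi - lo) * M.Cg lo hi σ * (2 + Real.log T') / ((1 - M.γ) * √(T' : ℝ)) =
        M.innerError lo hi σ T' / (1 - M.γ) := by
      unfold innerError
      rw [mul_div_assoc', div_div, mul_comm (1 - M.γ)]
    rw [e1, div_le_div_iff₀ hρ hh]
    have : M.innerError lo hi σ T' * (T * (1 - M.γ)) ≤ M.innerError lo hi σ T' * M.rho T :=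
      mul_le_mul_of_nonneg_left (by unfold rho; linarith) he
    linarith
  have b3 : M.CN CM / 2 / √(M.rho T) ≤ M.CN CM / √(M.rho T) :=
    div_le_div_of_nonneg_right (by linarith) hsρ.le
  have b4 := mul_le_mul_of_nonneg_left hsum (one_div_pos.2 hρ).le
  have hmono' := hmono.trans (le_of_eq hsplit)
  rw [add_div] at hmono'
  change _ ≤ _ / M.rho T + _ + _ + _ / √(M.rho T)
  linarith

/-! ### Rewards with almost surely bounded noise -/

/-- The rewards with the noise clipped to `[-1, 1]`. -/
def clipReward (M : RobustMDP S A) (r : ℕ → Ω → S → A → ℝ) (t : ℕ) (ω : Ω) (s : S) (a : A) : ℝ :=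
  clamp (M.R s a - 1) (M.R s a + 1) (r t ω s a)

theorem abs_clipReward_sub_le (t : ℕ) (ω : Ω) (s : S) (a : A) :
    |M.clipReward r t ω s a - M.R s a| ≤ 1 := by
  have := clamp_mem (show M.R s a - 1 ≤ M.R s a + 1 by linarith) (r t ω s a)
  rw [abs_le]
  constructor <;> linarith [this.1, this.2, show M.clipReward r t ω s a =
    clamp (M.R s a - 1) (M.R s a + 1) (r t ω s a) from rfl]

theorem clipReward_eq_self {t : ℕ} {ω : Ω} {s : S} {a : A} (h : |r t ω s a - M.R s a| ≤ 1) :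
    M.clipReward r t ω s a = r t ω s a := by
  have := abs_le.1 h
  exact clamp_eq_self ⟨by linarith, by linarith⟩

theorem IsGenerativeData.ae_clipReward_eq (hG : M.IsGenerativeData μ X Y r) :
    ∀ᵐ ω ∂μ, ∀ t, M.clipReward r t ω = r t ω := by
  have h1 : ∀ᵐ ω ∂μ, ∀ t s a, |r t ω s a - M.R s a| ≤ 1 :=
    ae_all_iff.2 fun t => ae_all_iff.2 fun s => ae_all_iff.2 fun a => hG.noise_le t s a
  filter_upwards [h1] with ω hω t
  funext s a
  exact clipReward_eq_self (hω t s a)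

/-- Clipping changes the rewards on a null set only and is a measurable function of them, so means
and independence persist. The noise bound then holds at every `ω`, as the pathwise estimates
require. -/
theorem IsGenerativeData.clip (hG : M.IsGenerativeData μ X Y r) :
    M.IsGenerativeData μ X Y (M.clipReward r) := by
  have hclip : Measurable fun (q : S → A → ℝ) s a => clamp (M.R s a - 1) (M.R s a + 1) (q s a) :=
    measurable_pi_lambda _ fun s => measurable_pi_lambda _ fun a =>
      (continuous_clamp _ _).measurable.comp (measurable_entry s a measurable_id)
  refine ⟨hG.measurable_X, hG.measurable_Y, fun t => hclip.comp (hG.measurable_r t), hG.law_X,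
    hG.law_Y, fun t s a => Eventually.of_forall fun ω => abs_clipReward_sub_le t ω s a,
    fun t s a => ?_, iIndep_mono hG.indep fun i => ?_⟩
  · rw [← hG.mean_r t s a]
    refine integral_congr_ae ?_
    filter_upwards [hG.ae_clipReward_eq] with ω hω
    rw [hω t]
  · rcases i with p | t
    · exact le_rfl
    · refine Measurable.comap_le (?_ : Measurable[MeasurableSpace.comap _ _] _)
      have h1 : Measurable[MeasurableSpace.comap (fun ω => (r t ω, Y t ω)) inferInstance]
          fun ω => (r t ω, Y t ω) := comap_measurable _
      exact (hclip.comp h1.fst).prodMk h1.snd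

theorem Qiter_congr {x : ℕ → ℕ → S → A → S} {y : ℕ → S → A → S} {ρ ρ' : ℕ → S → A → ℝ}
    (h : ∀ t, ρ t = ρ' t) (T : ℕ) :
    M.Qiter lo hi α T' x y ρ T = M.Qiter lo hi α T' x y ρ' T := by
  rw [show ρ = ρ' from funext h]

/-- The error bound for the iterates of the algorithm. -/
theorem Regular.integral_error_le (h : M.Regular lo hi σ CM)
    (hα : ∀ k : ℕ, 1 ≤ k → α k = (hi - lo) / (M.Cg lo hi σ * √(k : ℝ))) (hT' : 1 ≤ T')
    (hG : M.IsGenerativeData μ X Y r)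
    {Qstar : S → A → ℝ} (hQ : M.IsOptimalQ Qstar) {T : ℕ} (hT : 1 ≤ T) :
    Integrable (fun ω => ‖M.iter lo hi α T' X Y r T ω - Qstar‖) μ ∧
    ∫ ω, ‖M.iter lo hi α T' X Y r T ω - Qstar‖ ∂μ ≤
      ‖(fun _ _ => M.vmax : S → A → ℝ) - Qstar‖ / (1 + (1 - M.γ) * T)
        + 2 * M.CN CM / √((1 - M.γ) ^ 3 * T)
        + (hi - lo) * M.Cg lo hi σ * (2 + Real.log T') / ((1 - M.γ) * √(T' : ℝ))
        + M.CN CM / √(1 + (1 - M.γ) * T) := by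
  have hae : (fun ω => ‖M.iter lo hi α T' X Y (M.clipReward r) T ω - Qstar‖) =ᵐ[μ]
      fun ω => ‖M.iter lo hi α T' X Y r T ω - Qstar‖ := by
    filter_upwards [hG.ae_clipReward_eq] with ω hω
    unfold iter
    rw [Qiter_congr hω]
  have := h.integral_error_le_of_forall hα hT' hG.clip abs_clipReward_sub_le hQ hT
  rw [integral_congr_ae hae] at this
  exact ⟨this.1.congr hae, this.2⟩

end RobustMDP

end RobustQ

end

/-! ### From the error bound to the sample complexity -/

namespace RobustQ

/-- With `z = 4096 y L² q²`, where `L = 1 + log y` and `q ≥ 1`, one has `√z = 64 √y L q`, while `log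
z` is at most a constant plus `3 L + 2 q`, hence of order `L q`. The number `4096` is both `64²` and
`2^12`. -/
theorem two_add_log_div_sqrt_le {y z : ℝ} (hy : 1 ≤ y)
    (hz : 4096 * (y * (1 + Real.log y) ^ 2) ≤ z) : (2 + Real.log z) / √z ≤ 1 / (4 * √y) := by
  have hlogy : 0 ≤ Real.log y := Real.log_nonneg hy
  set L := 1 + Real.log y with hL
  have hL1 : 1 ≤ L := by linarith
  have hB : 0 < 4096 * (y * L ^ 2) := by positivity
  set m := z / (4096 * (y * L ^ 2)) with hm
  have hm1 : 1 ≤ m := (one_le_div hB).2 hz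
  have hzm : z = 4096 * y * L ^ 2 * m := by rw [hm]; field_simp
  set q := √m with hq
  have hq1 : 1 ≤ q := Real.one_le_sqrt.2 hm1
  have hsq : q ^ 2 = m := Real.sq_sqrt (by linarith)
  have hsz : √z = 64 * √y * L * q := by
    rw [hzm, show (4096 : ℝ) * y * L ^ 2 * m = (64 * L) ^ 2 * (y * m) by ring,
      Real.sqrt_mul (by positivity), Real.sqrt_sq (by positivity), Real.sqrt_mul (by linarith)]
    ring
  have hlogz : Real.log z = 12 * Real.log 2 + Real.log y + 2 * Real.log L + 2 * Real.log q := by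
    rw [hzm, ← hsq, Real.log_mul (by positivity) (by positivity),
      Real.log_mul (by positivity) (by positivity), Real.log_mul (by norm_num) (by linarith),
      Real.log_pow, Real.log_pow, show (4096 : ℝ) = 2 ^ 12 by norm_num, Real.log_pow]
    push_cast; ring
  have h1 : Real.log L ≤ L - 1 := Real.log_le_sub_one_of_pos (by linarith)
  have h2 : Real.log q ≤ q - 1 := Real.log_le_sub_one_of_pos (by linarith)
  have h3 := Real.log_two_lt_d9
  have hsy : 0 < √y := Real.sqrt_pos.2 (by linarith)
  rw [hsz, div_le_div_iff₀ (by positivity) (by positivity)]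
  have hLq1 : L ≤ L * q := le_mul_of_one_le_right (by linarith) hq1
  have hLq2 : q ≤ L * q := le_mul_of_one_le_left (by linarith) hL1
  have h4 : 4 * (2 + Real.log z) ≤ 64 * (L * q) := by rw [hlogz]; linarith
  have := mul_le_mul_of_nonneg_right h4 hsy.le
  linarith

namespace RobustMDP

variable {S A : Type*} [Fintype S] [Fintype A] [Nonempty S] [Nonempty A] {M : RobustMDP S A}
  {lo hi σ CM : ℝ}

/-- From `C_N² ≥ 8 log 2`. A lower bound independent of the model lets `x` dominate the iterations
needed by the initial error, and gives `x ≥ 1`. -/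
theorem Regular.four_le_CN_sq (h : M.Regular lo hi σ CM) : 4 ≤ M.CN CM ^ 2 := by
  have h1 : 1 ≤ 1 + M.γ * CM := by linarith [mul_nonneg M.γ_nonneg h.CM_pos.le]
  have h2 : Real.log 2 ≤ Real.log (2 * Fintype.card S * Fintype.card A) := by
    refine Real.log_le_log two_pos ?_
    have : 1 ≤ Fintype.card S * Fintype.card A := Nat.mul_pos Fintype.card_pos Fintype.card_pos
    have : (1 : ℝ) ≤ Fintype.card S * Fintype.card A := by exact_mod_cast this
    rw [mul_assoc]; linarith
  have h3 := Real.log_two_gt_d9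
  set l := Real.log (2 * Fintype.card S * Fintype.card A)
  have h4 : 1 ≤ (1 + M.γ * CM) ^ 2 := one_le_pow₀ h1
  have hl : 0 ≤ l := by linarith
  rw [CN, mul_pow, Real.sq_sqrt (by positivity)]
  have := mul_le_mul_of_nonneg_right h4 hl
  linarith

/-- With enough iterations, the error bound is at most `ε`. -/
theorem Regular.error_bound_le (h : M.Regular lo hi σ CM) {Qstar : S → A → ℝ}
    (hQ : M.IsOptimalQ Qstar) {ε : ℝ} (hε : 0 < ε) (hε' : ε ≤ M.vmax) {y T T' : ℝ}
    (hy : 1 ≤ y)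
    (hy' : (hi - lo) ^ 2 * M.Cg lo hi σ ^ 2 / (ε ^ 2 * (1 - M.γ) ^ 2) ≤ y)
    (hT : 4096 * (M.CN CM ^ 2 / (ε ^ 2 * (1 - M.γ) ^ 3)) ≤ T)
    (hT' : 4096 * (y * (1 + Real.log y) ^ 2) ≤ T') :
    ‖(fun _ _ => M.vmax : S → A → ℝ) - Qstar‖ / (1 + (1 - M.γ) * T)
      + 2 * M.CN CM / √((1 - M.γ) ^ 3 * T)
      + (hi - lo) * M.Cg lo hi σ * (2 + Real.log T') / ((1 - M.γ) * √T')
      + M.CN CM / √(1 + (1 - M.γ) * T) ≤ ε := by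
  have hh := M.one_sub_gamma_pos
  have hh1 : 1 - M.γ ≤ 1 := by linarith [M.γ_nonneg]
  have hvm : M.vmax = 1 / (1 - M.γ) := (one_div _).symm
  set H := 1 - M.γ with hH
  have hCN := h.CN_pos
  have hCN4 := h.four_le_CN_sq
  set N := M.CN CM with hN
  have hεH : ε * H ≤ 1 := by rwa [hvm, le_div_iff₀ hh] at hε'
  have hT1 : 4096 * N ^ 2 ≤ T * (ε ^ 2 * H ^ 3) := by
    rw [← mul_div_assoc, div_le_iff₀ (by positivity)] at hT
    exact hT
  have hTpos : 0 < T := lt_of_lt_of_le (by positivity) hT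
  have t1 : ‖(fun _ _ => M.vmax : S → A → ℝ) - Qstar‖ / (1 + H * T) ≤ ε / 4 := by
    have hn : ‖(fun _ _ => M.vmax : S → A → ℝ) - Qstar‖ ≤ M.vmax := by
      refine (norm_pi_pi_le M.vmax_pos.le).2 fun s a => ?_
      have := hQ.mem_box M s a
      simp only [Pi.sub_apply]
      rw [abs_le]
      constructor <;> linarith
    rw [div_le_iff₀ (by positivity)]
    refine hn.trans ?_
    rw [hvm, div_le_iff₀ hh]
    -- The initial error only needs `T` of order `1 / (ε H²)`, which `ε H ≤ 1` makes weaker than the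
    -- requirement on `T`.
    have : T * (ε ^ 2 * H ^ 3) ≤ T * (ε * H ^ 2) := by
      refine mul_le_mul_of_nonneg_left ?_ hTpos.le
      have := mul_le_mul_of_nonneg_left hεH (show 0 ≤ ε * H ^ 2 by positivity)
      linarith
    have : 0 ≤ ε / 4 * H := by positivity
    linarith
  have hroot : 64 * N / ε ≤ √(H ^ 3 * T) := by
    refine Real.le_sqrt_of_sq_le ?_
    rw [div_pow, div_le_iff₀ (by positivity)]
    linarith
  have hroot_pos : 0 < 64 * N / ε := by positivity
  have t2 : 2 * N / √(H ^ 3 * T) ≤ ε / 4 := by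
    refine (div_le_div_of_nonneg_left (by positivity) hroot_pos hroot).trans ?_
    rw [div_div_eq_mul_div, div_le_iff₀ (by positivity)]
    have : 0 < N * ε := by positivity
    linarith
  have t4 : N / √(1 + H * T) ≤ ε / 4 := by
    have hle : √(H ^ 3 * T) ≤ √(1 + H * T) := by
      refine Real.sqrt_le_sqrt ?_
      have h3 : H ^ 3 ≤ H := by
        simpa using pow_le_pow_of_le_one hh.le hh1 (show 1 ≤ 3 by norm_num)
      have := mul_le_mul_of_nonneg_right h3 hTpos.le
      linarith
    refine (div_le_div_of_nonneg_left (by positivity) hroot_pos (hroot.trans hle)).trans ?_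
    rw [div_div_eq_mul_div, div_le_iff₀ (by positivity)]
    have : 0 < N * ε := by positivity
    linarith
  have t3 : (hi - lo) * M.Cg lo hi σ * (2 + Real.log T') / (H * √T') ≤ ε / 4 := by
    have hlog := two_add_log_div_sqrt_le hy hT'
    have hDC : 0 ≤ (hi - lo) * M.Cg lo hi σ :=
      mul_nonneg (by linarith [h.lo_le_hi]) h.Cg_pos.le
    have hsy : 0 < √y := Real.sqrt_pos.2 (by linarith)
    have hDy : (hi - lo) * M.Cg lo hi σ ≤ √y * (ε * H) := by
      rw [← div_le_iff₀ (by positivity)]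
      refine Real.le_sqrt_of_sq_le ?_
      rwa [div_pow, mul_pow, mul_pow]
    calc (hi - lo) * M.Cg lo hi σ * (2 + Real.log T') / (H * √T')
        = (hi - lo) * M.Cg lo hi σ / H * ((2 + Real.log T') / √T') := by
          rw [div_mul_div_comm]
      _ ≤ (hi - lo) * M.Cg lo hi σ / H * (1 / (4 * √y)) :=
          mul_le_mul_of_nonneg_left hlog (by positivity)
      _ ≤ √y * (ε * H) / H * (1 / (4 * √y)) := by gcongr
      _ = ε / 4 := by field_simp
  linarith

end RobustMDP

theorem sampleCount_eq (S A : Type*) [Fintype S] [Fintype A] (T T' : ℕ) :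
    (sampleCount S A T T' : ℝ) = Fintype.card S * Fintype.card A * (T * (T' + 1)) := by
  simp only [sampleCount, Fintype.card_prod, Fintype.card_sum, Fintype.card_fin]
  push_cast
  ring

/-- Rounding up and the extra draw per iteration each add at most `1`, which is absorbed since `x`
and `z` are at least `1`; hence `c + 2`. -/
theorem sampleCount_ceil_le (S A : Type*) [Fintype S] [Fintype A] {c x z : ℝ} (hc : 0 ≤ c)
    (hx : 1 ≤ x) (hz : 1 ≤ z) :
    (sampleCount S A ⌈c * x⌉₊ ⌈c * z⌉₊ : ℝ) ≤
      (c + 2) ^ 2 * (Fintype.card S * Fintype.card A * x * z) := by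
  rw [sampleCount_eq]
  have h1 : (⌈c * x⌉₊ : ℝ) ≤ (c + 2) * x := by
    have := (Nat.ceil_lt_add_one (show 0 ≤ c * x by positivity)).le
    linarith
  have h2 : (⌈c * z⌉₊ : ℝ) + 1 ≤ (c + 2) * z := by
    have := (Nat.ceil_lt_add_one (show 0 ≤ c * z by positivity)).le
    linarith
  calc (Fintype.card S * Fintype.card A * (⌈c * x⌉₊ * (⌈c * z⌉₊ + 1)) : ℝ)
      ≤ Fintype.card S * Fintype.card A * ((c + 2) * x * ((c + 2) * z)) := by gcongr
    _ = _ := by ring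

end RobustQ

theorem theorem4 :
    ∃ c C : ℝ, 0 < c ∧ 0 < C ∧
    ∀ (S A : Type*) [Fintype S] [Fintype A] [Nonempty S] [Nonempty A]
      [MeasurableSpace S] [MeasurableSingletonClass S]
      (Ω : Type*) [MeasurableSpace Ω] (μ : Measure Ω) [IsProbabilityMeasure μ]
      (M : RobustQ.RobustMDP S A) (lo hi σ CM : ℝ) (α : ℕ → ℝ)
      (X : ℕ → ℕ → Ω → S → A → S) (Y : ℕ → Ω → S → A → S) (r : ℕ → Ω → S → A → ℝ),
      0 < σ → M.BoundedDomain lo hi → M.Smooth lo hi σ → M.BoundedObjective lo hi CM →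
      (∀ k : ℕ, 1 ≤ k → α k = (hi - lo) / (M.Cg lo hi σ * √(k : ℝ))) →
      M.IsGenerativeData μ X Y r →
      (∃! Q : S → A → ℝ, M.IsOptimalQ Q) ∧
      ∀ Qstar : S → A → ℝ, M.IsOptimalQ Qstar →
        -- `err T' T ω` is the sup-norm error `‖Q_T - Q^*‖` after `T` iterations
        let err : ℕ → ℕ → Ω → ℝ := fun T' T ω =>
          ‖M.Qiter lo hi α T' (fun t k => X t k ω) (fun t => Y t ω) (fun t => r t ω) T - Qstar‖
        -- the error bound
        (∀ T T' : ℕ, 1 ≤ T → 1 ≤ T' →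
          Integrable (err T' T) μ ∧
          ∫ ω, err T' T ω ∂μ ≤
            ‖(fun _ _ => M.vmax : S → A → ℝ) - Qstar‖ / (1 + (1 - M.γ) * T)
            + 2 * M.CN CM / √((1 - M.γ) ^ 3 * T)
            + (hi - lo) * M.Cg lo hi σ * (2 + Real.log T') / ((1 - M.γ) * √(T' : ℝ))
            + M.CN CM / √(1 + (1 - M.γ) * T)) ∧
        -- the sample complexity
        ∀ ε : ℝ, 0 < ε → ε ≤ M.vmax →
          let x : ℝ := M.CN CM ^ 2 / (ε ^ 2 * (1 - M.γ) ^ 3)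
          let y : ℝ := max 1 ((hi - lo) ^ 2 * M.Cg lo hi σ ^ 2 / (ε ^ 2 * (1 - M.γ) ^ 2))
          let T₀ : ℕ := ⌈c * x⌉₊
          let T₁ : ℕ := ⌈c * (y * (1 + Real.log y) ^ 2)⌉₊
          (∀ T T' : ℕ, T₀ ≤ T → T₁ ≤ T' → ∫ ω, err T' T ω ∂μ ≤ ε) ∧
          (RobustQ.sampleCount S A T₀ T₁ : ℝ) ≤
            C * (Fintype.card S * Fintype.card A * x * y * (1 + Real.log y) ^ 2) ∧
          (ε * (1 - M.γ) ≤ (hi - lo) * M.Cg lo hi σ →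
            (RobustQ.sampleCount S A T₀ T₁ : ℝ) ≤
              C * (Fintype.card S * Fintype.card A * (hi - lo) ^ 2 * M.CN CM ^ 2
                  * M.Cg lo hi σ ^ 2 / (ε ^ 4 * (1 - M.γ) ^ 5)
                * (1 + Real.log ((hi - lo) ^ 2 * M.Cg lo hi σ ^ 2
                    / (ε ^ 2 * (1 - M.γ) ^ 2))) ^ 2)) := by
  -- `4096` is the constant for which each of the four error terms is at most `ε / 4`, and `4098 =
  -- 4096 + 2` comes from the count of draws with rounding.
  refine ⟨4096, 4098 ^ 2, by norm_num, by norm_num, ?_⟩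
  intro S A _ _ _ _ _ _ Ω _ μ _ M lo hi σ CM α X Y r hσ hBD hSm hBO hα hG
  have h : M.Regular lo hi σ CM := ⟨hσ, hBD, hSm, hBO⟩
  refine ⟨M.existsUnique_isOptimalQ, fun Qstar hQ => ?_⟩
  intro err
  have hbound : ∀ T T' : ℕ, 1 ≤ T → 1 ≤ T' → _ := fun T T' hT hT' =>
    h.integral_error_le hα hT' hG hQ hT
  refine ⟨hbound, fun ε hε hε' => ?_⟩
  intro x y T₀ T₁
  have hh := M.one_sub_gamma_pos
  have hh1 : 1 - M.γ ≤ 1 := by linarith [M.γ_nonneg]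
  have hy1 : 1 ≤ y := le_max_left _ _
  have hlogy : 0 ≤ Real.log y := Real.log_nonneg hy1
  have hz1 : 1 ≤ y * (1 + Real.log y) ^ 2 :=
    one_le_mul_of_one_le_of_one_le hy1 (one_le_pow₀ (by linarith))
  have hx1 : 1 ≤ x := by
    have hεH : ε * (1 - M.γ) ≤ 1 := by
      rwa [RobustQ.RobustMDP.vmax, ← one_div, le_div_iff₀ hh] at hε'
    rw [one_le_div (by positivity)]
    have h2 : (ε * (1 - M.γ)) ^ 2 * (1 - M.γ) ≤ 1 :=
      mul_le_one₀ (pow_le_one₀ (by positivity) hεH) hh.le hh1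
    have := h.four_le_CN_sq
    linarith [show ε ^ 2 * (1 - M.γ) ^ 3 = (ε * (1 - M.γ)) ^ 2 * (1 - M.γ) by ring]
  have hcount : (RobustQ.sampleCount S A T₀ T₁ : ℝ) ≤
      4098 ^ 2 * (Fintype.card S * Fintype.card A * x * y * (1 + Real.log y) ^ 2) := by
    have := RobustQ.sampleCount_ceil_le S A (c := 4096) (by norm_num) hx1 hz1
    refine this.trans (le_of_eq ?_)
    ring
  refine ⟨fun T T' hT hT' => ?_, hcount, fun hsmall => hcount.trans (le_of_eq ?_)⟩
  · have hT0 : 4096 * x ≤ T := (Nat.le_ceil _).trans (by exact_mod_cast hT)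
    have hT1 : 4096 * (y * (1 + Real.log y) ^ 2) ≤ T' :=
      (Nat.le_ceil _).trans (by exact_mod_cast hT')
    have hTn : 1 ≤ T := by exact_mod_cast (show (1 : ℝ) ≤ T by linarith)
    have hTn' : 1 ≤ T' := by exact_mod_cast (show (1 : ℝ) ≤ T' by linarith)
    exact (hbound T T' hTn hTn').2.trans
      (h.error_bound_le hQ hε hε' hy1 (le_max_right _ _) hT0 hT1)
  · have hy : y = (hi - lo) ^ 2 * M.Cg lo hi σ ^ 2 / (ε ^ 2 * (1 - M.γ) ^ 2) := by
      refine max_eq_right ((one_le_div (by positivity)).2 ?_)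
      have := pow_le_pow_left₀ (by positivity) hsmall 2
      rwa [mul_pow, mul_pow] at this
    have hxy : (Fintype.card S * Fintype.card A * x * y : ℝ) =
        Fintype.card S * Fintype.card A * (hi - lo) ^ 2 * M.CN CM ^ 2 * M.Cg lo hi σ ^ 2
          / (ε ^ 4 * (1 - M.γ) ^ 5) := by
      rw [hy]
      simp only [x]
      field_simp
    rw [hxy, ← hy]
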